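/- Let $k$ be an algebraically closed field of characteristic $0$, $\theta\in\mathbb N$, let $\alpha_1,\dots,\alpha_\theta$ be the canonical basis of $\mathbb Z^\theta$, let $\chi:\mathbb Z^\theta\times\mathbb Z^\theta\to k^\times$ be any bicharacter, and put $q_{ij}=\chi(\alpha_i,\alpha_j)$. Let $\mathcal U(\chi)$ be the Hopf algebra generated by $E_i,F_i,K_i^{\pm1},L_i^{\pm1}$ ($1\le i\le\theta$) with the relations: the $K_i^{\pm1},L_i^{\pm1}$ commute with each other, $K_iK_i^{-1}=L_iL_i^{-1}=1$, $E_iF_j-F_jE_i=\delta_{ij}(K_i-L_i)$, $K_iE_jK_i^{-1}=q_{ij}E_j$, $L_iE_jL_i^{-1}=q_{ji}^{-1}E_j$, $L_iF_jL_i^{-1}=q_{ji}F_j$, $K_iF_jK_i^{-1}=q_{ij}^{-1}F_j$, and with $K_i,L_i$ group-like, $\Delta(E_i)=E_i\otimes1+K_i\otimes E_i$, $\Delta(F_i)=F_i\otimes L_i+1\otimes F_i$; write $S$ for the antipode and $K^\alpha=\prod_iK_i^{a_i}$, $L^\alpha=\prod_iL_i^{a_i}$ for $\alpha=\sum_ia_i\alpha_i$.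 The subalgebras $\mathcal U^{+}(\chi)$, $\mathcal U^-(\chi)$ generated by the $E_i$, respectively the $F_i$, are free and graded by $\deg E_i=\alpha_i$, $\deg F_i=-\alpha_i$; $\mathcal U^+(\chi)=T(V)$ is a braided Hopf algebra with primitive generators $E_i$ and braiding $E_i\otimes E_j\mapsto q_{ij}E_j\otimes E_i$. Let $\mathcal I^+(\chi)$ be its greatest braided Hopf ideal generated by elements of degree $\ge2$, $\mathcal I^-(\chi)=\Omega(\mathcal I^+(\chi))$ with $\Omega$ the algebra antiautomorphism exchanging $E_i$ and $F_i$ and fixing $K_i,L_i$, and $\mathfrak u^\pm(\chi)=\mathcal U^\pm(\chi)/\mathcal I^\pm(\chi)$, $\mathfrak u(\chi)=\mathcal U(\chi)/(\mathcal I^+(\chi)+\mathcal I^-(\chi))$, $\mathfrak u^0(\chi)$ the subalgebra generated by the $K_i^{\pm1},L_i^{\pm1}$. Let $\eta:\mathfrak u^+(\chi)\times\mathfrak u^-(\chi)\to k$ be the restriction of the skew-Hopf pairing ($\eta(xx',y)=\eta(x',y_1)\eta(x,y_2)$, $\eta(x,yy')=\eta(x_1,y)\eta(x_2,y')$, $\eta(x,1)=\varepsilon(x)$,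 $\eta(1,y)=\varepsilon(y)$) with $\eta(K_i,L_j)=q_{ij}$, $\eta(E_i,F_j)=-\delta_{ij}$, $\eta(E_i,L_j)=\eta(K_i,F_j)=0$. For $\beta\in\mathbb N_0^\theta$ let $(E^{(\beta)}_x)$, $(F^{(\beta)}_y)$ be bases of $\mathfrak u^+(\chi)_\beta$, $\mathfrak u^-(\chi)_{-\beta}$. The matrix $[\eta(E^{(\beta)}_x,F^{(\beta)}_y)]_{x,y}$ is invertible; with $[b^{(\beta)}_{xy}]$ its inverse let $$\mathcal C_\beta=\sum_{x,y}b^{(\beta)}_{yx}E^{(\beta)}_x\otimes F^{(\beta)}_y\in\mathfrak u(\chi)\otimes\mathfrak u(\chi).$$ For $x\in\{1,2,3\}$ let $V_x$ be a finite-dimensional $\mathfrak u(\chi)$-module, with representation $\rho_x$, having a vector $v_x$ and an algebra map $\Lambda_x:\mathfrak u^0(\chi)\to k$ such that $Xv_x=\Lambda_x(X)v_x$ for $X\in\mathfrak u^0(\chi)$, $V_x=\mathfrak u^-(\chi)v_x$ and $E_iv_x=0$ for all $i$. Let $C_{xy}=\sum_{\beta\in\mathbb N_0^\theta}(\rho_x\otimes\rho_y)(\mathcal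 C_\beta)$. Say that $f_{xy}$ is well defined if there is a (necessarily unique) linear endomorphism $f_{xy}$ of $V_x\otimes V_y$ with $$f_{xy}(Xv_x\otimes Yv_y)=\chi(\beta,\alpha)\Lambda_x(K^{-\beta})\Lambda_y(L^\alpha)\,Xv_x\otimes Yv_y\qquad(\alpha,\beta\in\mathbb N_0^\theta,\ X\in\mathfrak u^-(\chi)_{-\alpha},\ Y\in\mathfrak u^-(\chi)_{-\beta}).$$ This is so, in particular, if the sums $V_x=\sum_\alpha\mathfrak u^-(\chi)_{-\alpha}v_x$ and $V_y=\sum_\beta\mathfrak u^-(\chi)_{-\beta}v_y$ are direct, and $f_{xy}$ is invertible whenever it is well defined; put $R_{xy}=C_{xy}f_{xy}^{-1}$. For an endomorphism $G$ of $V_x\otimes V_y$, $G^{(x,y)}$ denotes $G$ acting on the factors $x,y$ of $V_1\otimes V_2\otimes V_3$. All sums over $\beta$ below have only finitely many nonzero terms, and the following hold. 1. $C_{xy}$ is invertible and $C_{xy}^{-1}=\sum_{\beta\in\mathbb N_0^\theta}(\rho_x\otimes\rho_y)\big((K^\beta\otimes1)(S\otimes\mathrm{id})(\mathcal C_\beta)\big)$.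 2. If $f_{xy}$ is well defined, then $R_{xy}$ is invertible and, for every $X\in\mathfrak u(\chi)$, $R_{xy}\,(\rho_x\otimes\rho_y)(\Delta(X))\,R_{xy}^{-1}=(\rho_x\otimes\rho_y)((\tau\circ\Delta)(X))$, where $\tau(X\otimes Y)=Y\otimes X$. 3. If $f_{13}$ is well defined, then $$\sum_\beta(\rho_1\otimes\rho_2\otimes\rho_3)((\Delta\otimes\mathrm{id})(\mathcal C_\beta))=C_{13}^{(1,3)}(f_{13}^{(1,3)})^{-1}C_{23}^{(2,3)}f_{13}^{(1,3)},$$ $$\sum_\beta(\rho_1\otimes\rho_2\otimes\rho_3)((\mathrm{id}\otimes\Delta)(\mathcal C_\beta))=C_{13}^{(1,3)}(f_{13}^{(1,3)})^{-1}C_{12}^{(1,2)}f_{13}^{(1,3)}.$$ 4. If $f_{12},f_{13},f_{23}$ are well defined, then $R_{12}^{(1,2)}R_{13}^{(1,3)}R_{23}^{(2,3)}=R_{23}^{(2,3)}R_{13}^{(1,3)}R_{12}^{(1,2)}$. -/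

import Mathlib

open scoped TensorProduct

noncomputable section

namespace NicholsDouble

/-! ### Bicharacters on `ℤ^θ` -/

/-- A bicharacter `χ : ℤ^θ × ℤ^θ → kˣ`. -/
structure Bicharacter (k : Type*) [Field k] (θ : ℕ) where
  /-- the underlying function -/
  toFun : (Fin θ → ℤ) → (Fin θ → ℤ) → kˣ
  map_add_left : ∀ a b c, toFun (a + b) c = toFun a c * toFun b c
  map_add_right : ∀ a b c, toFun a (b + c) = toFun a b * toFun a c

/-- The simple root `α_i`, an element of the canonical basis of `ℤ^θ`. -/
def simpleRoot {θ : ℕ} (i : Fin θ) : Fin θ → ℤ := Pi.single i 1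

/-- The inclusion `ℕ^θ → ℤ^θ`. -/
def toInt {θ : ℕ} (β : Fin θ → ℕ) : Fin θ → ℤ := fun i => (β i : ℤ)

variable {k : Type*} [Field k] {θ : ℕ}

/-- `q_{ij} = χ(α_i, α_j)`. -/
def Bicharacter.q (χ : Bicharacter k θ) (i j : Fin θ) : k :=
  (χ.toFun (simpleRoot i) (simpleRoot j) : kˣ)

/-! ### The tensor algebra `T(V)` as a braided Hopf algebra, and the Nichols ideal -/

/-- The tensor algebra `T(V)`, `V` with basis `x_1, …, x_θ`. Both `𝓤⁺(χ)` (with `x_i = E_i`) and,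
as an algebra, `𝓤⁻(χ)` (with `x_i = F_i`) are this free algebra. -/
abbrev TV (k : Type*) [Field k] (θ : ℕ) := FreeAlgebra k (Fin θ)

/-- The word `x_{i_1} ⋯ x_{i_n}`. -/
def word (k : Type*) [Field k] {θ : ℕ} (l : List (Fin θ)) : TV k θ :=
  (l.map (FreeAlgebra.ι k)).prod

/-- The multidegree in `ℕ^θ` of a word. -/
def wdeg {θ : ℕ} (l : List (Fin θ)) : Fin θ → ℕ := fun i => l.count i

/-- The homogeneous component `T(V)_β`. -/
def homog (k : Type*) [Field k] {θ : ℕ} (β : Fin θ → ℕ) : Submodule k (TV k θ) :=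
  Submodule.span k {x | ∃ l : List (Fin θ), wdeg l = β ∧ x = word k l}

/-- The action of `K_i` on `T(V)`: `K_i · x_j = q_{ij} x_j`. -/
def kAct (χ : Bicharacter k θ) (i : Fin θ) : TV k θ →ₐ[k] TV k θ :=
  FreeAlgebra.lift k fun j => χ.q i j • FreeAlgebra.ι k j

/-- Left multiplication in the braided tensor product algebra `T(V) ⊗ T(V)` by the braided
coproduct. There `(1 ⊗ x_i)(a ⊗ b) = (K_i · a) ⊗ x_i b`, so that left multiplication by
`x_i ⊗ 1 + 1 ⊗ x_i` is `a ⊗ b ↦ x_i a ⊗ b + (K_i · a) ⊗ x_i b`. -/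
def braidedMulLeft (χ : Bicharacter k θ) :
    TV k θ →ₐ[k] Module.End k (TV k θ ⊗[k] TV k θ) :=
  FreeAlgebra.lift k fun i =>
    TensorProduct.map (LinearMap.mulLeft k (FreeAlgebra.ι k i)) LinearMap.id +
    TensorProduct.map (kAct χ i).toLinearMap (LinearMap.mulLeft k (FreeAlgebra.ι k i))

/-- The braided comultiplication of `T(V)`: the algebra map to the braided tensor product
with `x_i ↦ x_i ⊗ 1 + 1 ⊗ x_i`. -/
def braidedComul (χ : Bicharacter k θ) : TV k θ →ₗ[k] TV k θ ⊗[k] TV k θ :=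
  (LinearMap.applyₗ ((1 : TV k θ) ⊗ₜ[k] (1 : TV k θ))).comp (braidedMulLeft χ).toLinearMap

/-- The counit of `T(V)`. -/
def braidedCounit (k : Type*) [Field k] (θ : ℕ) : TV k θ →ₐ[k] k :=
  FreeAlgebra.lift k fun _ => 0

/-- The operators `z ↦ -(K_i · z) x_i`, extended multiplicatively. -/
def braidedAntipodeAux (χ : Bicharacter k θ) : TV k θ →ₐ[k] Module.End k (TV k θ) :=
  FreeAlgebra.lift k fun i =>
    -((LinearMap.mulRight k (FreeAlgebra.ι k i)).comp (kAct χ i).toLinearMap)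

/-- The braided antipode of `T(V)`: `S(1) = 1` and `S(x_i w) = -(K_i · S(w)) x_i`, that is
`S(x_i) = -x_i` and `S(x y) = χ(deg x, deg y) S(y) S(x)`. -/
def braidedAntipode (χ : Bicharacter k θ) : TV k θ →ₗ[k] TV k θ :=
  (LinearMap.applyₗ (1 : TV k θ)).comp (braidedAntipodeAux χ).toLinearMap

/-- Braided Hopf ideals of `T(V)` in the category of Yetter–Drinfeld modules over `k ℤ^θ`
(the subobjects of `T(V)` in this category are the `ℤ^θ`-graded subspaces). -/
structure IsBraidedHopfIdeal (χ : Bicharacter k θ) (J : Submodule k (TV k θ)) : Prop where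
  mul_left : ∀ a, ∀ x ∈ J, a * x ∈ J
  mul_right : ∀ a, ∀ x ∈ J, x * a ∈ J
  graded : J ≤ ⨆ β : Fin θ → ℕ, J ⊓ homog k β
  counit : ∀ x ∈ J, braidedCounit k θ x = 0
  comul : ∀ x ∈ J, braidedComul χ x ∈
    LinearMap.range (TensorProduct.map J.subtype (LinearMap.id : TV k θ →ₗ[k] TV k θ)) ⊔
    LinearMap.range (TensorProduct.map (LinearMap.id : TV k θ →ₗ[k] TV k θ) J.subtype)
  antipode : ∀ x ∈ J, braidedAntipode χ x ∈ J

/-- The ideal `𝓘⁺(χ)`: the greatest braided Hopf ideal of `T(V)` generated by elements of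
degree at least two (equivalently, contained in the ideal of elements of degree at least two). -/
def idealPlus (χ : Bicharacter k θ) : Submodule k (TV k θ) :=
  sSup {J | IsBraidedHopfIdeal χ J ∧ J ≤ ⨆ β ∈ {β : Fin θ → ℕ | 2 ≤ ∑ i, β i}, homog k β}

/-- The antiautomorphism of the free algebra fixing the generators. It is the restriction
`𝓤⁺(χ) → 𝓤⁻(χ)`, `E_i ↦ F_i`, of the antiautomorphism `Ω` of `𝓤(χ)`. -/
def revOp (k : Type*) [Field k] (θ : ℕ) : TV k θ →ₐ[k] (TV k θ)ᵐᵒᵖ :=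
  FreeAlgebra.lift k fun i => MulOpposite.op (FreeAlgebra.ι k i)

/-- `revOp` as a linear map. -/
def rev (k : Type*) [Field k] (θ : ℕ) : TV k θ →ₗ[k] TV k θ :=
  (MulOpposite.opLinearEquiv k).symm.toLinearMap.comp (revOp k θ).toLinearMap

/-- The ideal `𝓘⁻(χ) = Ω(𝓘⁺(χ))` of `𝓤⁻(χ)`. -/
def idealMinus (χ : Bicharacter k θ) : Submodule k (TV k θ) :=
  (idealPlus χ).map (rev k θ)

/-- `𝔲⁺(χ) = 𝓤⁺(χ) / 𝓘⁺(χ)`, the Nichols algebra of `V`. -/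
abbrev UPlus (χ : Bicharacter k θ) := TV k θ ⧸ idealPlus χ

/-- `𝔲⁻(χ) = 𝓤⁻(χ) / 𝓘⁻(χ)`. -/
abbrev UMinus (χ : Bicharacter k θ) := TV k θ ⧸ idealMinus χ

/-- The homogeneous component `𝔲⁺(χ)_β`. -/
def UPlusDeg (χ : Bicharacter k θ) (β : Fin θ → ℕ) : Submodule k (UPlus χ) :=
  (homog k β).map (idealPlus χ).mkQ

/-- The homogeneous component `𝔲⁻(χ)_{-β}`. -/
def UMinusDeg (χ : Bicharacter k θ) (β : Fin θ → ℕ) : Submodule k (UMinus χ) :=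
  (homog k β).map (idealMinus χ).mkQ

/-! ### The pairing `η` -/

/-- The functional `y ↦ -(coefficient of x_i in y)` on `T(V)`. -/
def negCoeff (k : Type*) [Field k] {θ : ℕ} (i : Fin θ) : TV k θ →ₗ[k] k :=
  -((TrivSqZeroExt.sndHom k k).comp
    (FreeAlgebra.lift k fun j : Fin θ =>
      (TrivSqZeroExt.inr (if j = i then 1 else 0) : TrivSqZeroExt k k)).toLinearMap)

/-- The skew derivation `y ↦ y₁ · η(E_i, y₂)`, where `y₁ ⊗ y₂` is the braided coproduct. -/
def skewDer (χ : Bicharacter k θ) (i : Fin θ) : TV k θ →ₗ[k] TV k θ :=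
  (TensorProduct.rid k (TV k θ)).toLinearMap.comp
    ((LinearMap.lTensor (TV k θ) (negCoeff k i)).comp (braidedComul χ))

/-- The bilinear form `B(x, y) = η(x, Ω(y))` on `𝓤⁺(χ)`. For `y ∈ 𝓤⁺(χ)` with braided coproduct
`y₁ ⊗ y₂` one has `Δ(Ω(y)) = Ω(y₁) ⊗ Ω(y₂) L^{deg y₁}`, so the rules
`η(x x', Y) = η(x', Y₁) η(x, Y₂)`, `η(1, Y) = ε(Y)`, `η(E_i, F_j) = -δ_{ij}` for the skew-Hopf
pairing `η` say that `B(1, y) = ε(y)` and `B(E_i x, y) = B(x, y₁) B(E_i, y₂)`, which determines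
`B`. -/
def formAux (χ : Bicharacter k θ) : TV k θ →ₐ[k] Module.End k (Module.Dual k (TV k θ)) :=
  FreeAlgebra.lift k fun i => Module.Dual.transpose (skewDer χ i)

/-- See `formAux`. -/
def form (χ : Bicharacter k θ) : TV k θ →ₗ[k] TV k θ →ₗ[k] k :=
  (LinearMap.applyₗ ((braidedCounit k θ).toLinearMap : Module.Dual k (TV k θ))).comp
    (formAux χ).toLinearMap

theorem form_one (χ : Bicharacter k θ) (y : TV k θ) : form χ 1 y = braidedCounit k θ y := by
  simp [form]

theorem form_ι_mul (χ : Bicharacter k θ) (i : Fin θ) (x y : TV k θ) :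
    form χ (FreeAlgebra.ι k i * x) y = form χ x (skewDer χ i y) := by
  simp [form, formAux, Module.Dual.transpose_apply]

theorem tv_induction {p : TV k θ → Prop} (h1 : p 1) (hadd : ∀ a b, p a → p b → p (a + b))
    (hsmul : ∀ (c : k) a, p a → p (c • a)) (hmul : ∀ i a, p a → p (FreeAlgebra.ι k i * a))
    (x : TV k θ) : p x := by
  suffices h : ∀ y, p y → p (x * y) by simpa using h 1 h1
  induction x using FreeAlgebra.induction with
  | grade0 r => intro y hy; rw [← Algebra.smul_def]; exact hsmul r y hy
  | grade1 i => intro y hy; exact hmul i y hy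
  | mul a b ha hb => intro y hy; rw [mul_assoc]; exact ha _ (hb _ hy)
  | add a b ha hb => intro y hy; rw [add_mul]; exact hadd _ _ (ha _ hy) (hb _ hy)

theorem negCoeff_ι_mul (i j : Fin θ) (x : TV k θ) :
    negCoeff k i (FreeAlgebra.ι k j * x) = if j = i then -braidedCounit k θ x else 0 := by
  have h : (TrivSqZeroExt.fstHom k k k).comp (FreeAlgebra.lift k fun j : Fin θ =>
      (TrivSqZeroExt.inr (if j = i then 1 else 0) : TrivSqZeroExt k k)) = braidedCounit k θ := by
    ext j; by_cases hj : j = i <;> simp [braidedCounit, hj]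
  have h' := DFunLike.congr_fun h x
  simp only [AlgHom.comp_apply, TrivSqZeroExt.fstHom_apply] at h'
  simp only [negCoeff, LinearMap.neg_apply, LinearMap.comp_apply, AlgHom.toLinearMap_apply,
    map_mul, FreeAlgebra.lift_ι_apply, TrivSqZeroExt.sndHom_apply, TrivSqZeroExt.snd_mul,
    TrivSqZeroExt.fst_inr, TrivSqZeroExt.snd_inr, h']
  split_ifs <;> simp

theorem form_ι_ι (χ : Bicharacter k θ) (i j : Fin θ) :
    form χ (FreeAlgebra.ι k i) (FreeAlgebra.ι k j) = if i = j then -1 else 0 := by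
  have := form_ι_mul χ i 1 (FreeAlgebra.ι k j)
  rw [mul_one, form_one] at this
  rw [this]
  have h0 : negCoeff k i (1 : TV k θ) = 0 := by simp [negCoeff]
  have h1 := negCoeff_ι_mul (k := k) i j 1
  rw [mul_one] at h1
  simp [skewDer, braidedComul, braidedMulLeft, h0, h1, eq_comm]
  split_ifs <;> simp

theorem braidedComul_one (χ : Bicharacter k θ) : braidedComul χ 1 = 1 ⊗ₜ 1 := by
  simp [braidedComul]

theorem braidedComul_ι_mul (χ : Bicharacter k θ) (i : Fin θ) (x : TV k θ) :
    braidedComul χ (FreeAlgebra.ι k i * x) =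
      TensorProduct.map (LinearMap.mulLeft k (FreeAlgebra.ι k i)) LinearMap.id
        (braidedComul χ x) +
      TensorProduct.map (kAct χ i).toLinearMap (LinearMap.mulLeft k (FreeAlgebra.ι k i))
        (braidedComul χ x) := by
  simp [braidedComul, braidedMulLeft]

theorem rid_counit_comul (χ : Bicharacter k θ) (x : TV k θ) :
    TensorProduct.rid k (TV k θ) (LinearMap.lTensor (TV k θ) (braidedCounit k θ).toLinearMap
      (braidedComul χ x)) = x := by
  induction x using tv_induction with
  | h1 => simp [braidedComul_one]
  | hadd a b ha hb => simp [ha, hb]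
  | hsmul c a ha => simp [ha]
  | hmul i a ha =>
    rw [braidedComul_ι_mul, map_add, map_add]
    conv_rhs => rw [← ha, ← add_zero (_ * _)]
    congr 1
    · generalize braidedComul χ a = t
      induction t with
      | zero => simp
      | add a b ha hb => simp only [map_add, mul_add, ha, hb]
      | tmul a b => simp
    · generalize braidedComul χ a = t
      induction t with
      | zero => simp
      | add a b ha hb => simp only [map_add, ha, hb, add_zero]
      | tmul a b => simp [braidedCounit]

theorem skewDer_ι_mul (χ : Bicharacter k θ) (i j : Fin θ) (x : TV k θ) :
    skewDer χ i (FreeAlgebra.ι k j * x) =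
      FreeAlgebra.ι k j * skewDer χ i x - if j = i then kAct χ j x else 0 := by
  rw [sub_eq_add_neg]
  simp only [skewDer, LinearMap.comp_apply, LinearEquiv.coe_coe, braidedComul_ι_mul, map_add]
  congr 1
  · generalize braidedComul χ x = t
    induction t with
    | zero => simp
    | add a b ha hb => simp only [map_add, mul_add, ha, hb]
    | tmul a b => simp
  · conv_rhs => rw [← rid_counit_comul χ x]
    generalize braidedComul χ x = t
    induction t with
    | zero => simp
    | add a b ha hb => simp only [map_add, ha, hb]; split_ifs <;> simp [add_comm]
    | tmul a b =>
      simp only [TensorProduct.map_tmul, LinearMap.lTensor_tmul, LinearMap.mulLeft_apply,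
        negCoeff_ι_mul, TensorProduct.rid_tmul, AlgHom.toLinearMap_apply]
      split_ifs <;> simp

theorem skewDer_one (χ : Bicharacter k θ) (i : Fin θ) : skewDer χ i 1 = 0 := by
  simp [skewDer, braidedComul_one, negCoeff]

theorem kAct_comm (χ : Bicharacter k θ) (i j : Fin θ) (x : TV k θ) :
    kAct χ i (kAct χ j x) = kAct χ j (kAct χ i x) := by
  have : (kAct χ i).comp (kAct χ j) = (kAct χ j).comp (kAct χ i) := by
    ext l; simp [kAct, smul_smul, mul_comm]
  exact DFunLike.congr_fun this x

theorem kAct_ι_mul (χ : Bicharacter k θ) (i j : Fin θ) (x : TV k θ) :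
    kAct χ i (FreeAlgebra.ι k j * x) = χ.q i j • (FreeAlgebra.ι k j * kAct χ i x) := by
  simp [kAct]

theorem skewDer_kAct (χ : Bicharacter k θ) (i j : Fin θ) (x : TV k θ) :
    skewDer χ j (kAct χ i x) = χ.q i j • kAct χ i (skewDer χ j x) := by
  induction x using tv_induction with
  | h1 => simp [skewDer_one]
  | hadd a b ha hb => simp [ha, hb]
  | hsmul c a ha => simp [ha, smul_comm c]
  | hmul l a ha =>
    rw [kAct_ι_mul, map_smul, skewDer_ι_mul, skewDer_ι_mul, map_sub, kAct_ι_mul, ha, smul_sub,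
      smul_sub, mul_smul_comm, smul_comm]
    congr 1
    split_ifs with h
    · rw [kAct_comm, h]
    · simp

theorem form_kAct (χ : Bicharacter k θ) (i : Fin θ) (x y : TV k θ) :
    form χ (kAct χ i x) y = form χ x (kAct χ i y) := by
  induction x using tv_induction generalizing y with
  | h1 =>
    have : (braidedCounit k θ).comp (kAct χ i) = braidedCounit k θ := by
      ext; simp [braidedCounit, kAct]
    have := DFunLike.congr_fun this y
    simp only [AlgHom.comp_apply] at this
    simp [form_one, this]
  | hadd a b ha hb => simp [ha, hb]
  | hsmul c a ha => simp [ha]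
  | hmul j a ha =>
    rw [kAct_ι_mul, map_smul, LinearMap.smul_apply, form_ι_mul, form_ι_mul, ha, skewDer_kAct,
      map_smul]

theorem form_mul_ι (χ : Bicharacter k θ) (j : Fin θ) (x z : TV k θ) :
    form χ x (FreeAlgebra.ι k j * z) = form χ (skewDer χ j x) z := by
  induction x using tv_induction generalizing z with
  | h1 => simp [form_one, skewDer_one, braidedCounit]
  | hadd a b ha hb => simp [ha, hb]
  | hsmul c a ha => simp [ha]
  | hmul i a ha =>
    rw [form_ι_mul, skewDer_ι_mul, skewDer_ι_mul, map_sub, ha, map_sub, LinearMap.sub_apply,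
      form_ι_mul]
    congr 1
    by_cases h : j = i
    · subst h; simp [form_kAct]
    · simp [h, Ne.symm h]

theorem form_symm (χ : Bicharacter k θ) (x y : TV k θ) : form χ x y = form χ y x := by
  induction x using tv_induction generalizing y with
  | h1 =>
    induction y using tv_induction with
    | h1 => rfl
    | hadd a b ha hb => simp [ha, hb]
    | hsmul c a ha => simp [ha]
    | hmul i a ha => simp [form_one, form_ι_mul, skewDer_one, braidedCounit]
  | hadd a b ha hb => simp [ha, hb]
  | hsmul c a ha => simp [ha]
  | hmul j a ha => rw [form_ι_mul, form_mul_ι, ha]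

theorem negCoeff_word (i : Fin θ) (l : List (Fin θ)) (hl : 2 ≤ l.length) :
    negCoeff k i (word k l) = 0 := by
  match l, hl with
  | a :: b :: l, _ => simp [word, negCoeff_ι_mul, braidedCounit]

theorem length_eq_sum_wdeg (l : List (Fin θ)) : l.length = ∑ i, wdeg l i := by
  simpa [wdeg] using (Multiset.sum_count_eq_card (s := Finset.univ) (m := (l : Multiset (Fin θ)))
    (by simp)).symm

theorem skewDer_idealPlus (χ : Bicharacter k θ) (i : Fin θ) :
    idealPlus χ ≤ (idealPlus χ).comap (skewDer χ i) := by
  refine sSup_le fun J hJ => ?_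
  have hJle : J ≤ idealPlus χ := le_sSup hJ
  have hc : ∀ x ∈ J, negCoeff k i x = 0 := by
    have : J ≤ LinearMap.ker (negCoeff k i) := hJ.2.trans <| iSup₂_le fun β hβ => by
      refine Submodule.span_le.2 ?_
      rintro _ ⟨l, rfl, rfl⟩
      exact negCoeff_word i l (by rw [length_eq_sum_wdeg]; exact hβ)
    exact fun x hx => this hx
  intro x hx
  have hle : LinearMap.range (TensorProduct.map J.subtype (LinearMap.id : TV k θ →ₗ[k] TV k θ)) ⊔
      LinearMap.range (TensorProduct.map (LinearMap.id : TV k θ →ₗ[k] TV k θ) J.subtype) ≤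
      (idealPlus χ).comap ((TensorProduct.rid k (TV k θ)).toLinearMap.comp
        (LinearMap.lTensor (TV k θ) (negCoeff k i))) := by
    refine sup_le ?_ ?_ <;> rintro _ ⟨t, rfl⟩
    · induction t with
      | zero => simp
      | add a b ha hb => rw [map_add]; exact add_mem ha hb
      | tmul a b => simpa using Submodule.smul_mem _ _ (hJle a.2)
    · induction t with
      | zero => simp
      | add a b ha hb => rw [map_add]; exact add_mem ha hb
      | tmul a b => simp [hc b b.2]
  exact hle (hJ.1.comul x hx)

theorem form_idealPlus_right (χ : Bicharacter k θ) (x y : TV k θ) (hy : y ∈ idealPlus χ) :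
    form χ x y = 0 := by
  induction x using tv_induction generalizing y with
  | h1 =>
    have : idealPlus χ ≤ LinearMap.ker (braidedCounit k θ).toLinearMap :=
      sSup_le fun J hJ x hx => hJ.1.counit x hx
    rw [form_one]; exact this hy
  | hadd a b ha hb => simp [ha y hy, hb y hy]
  | hsmul c a ha => simp [ha y hy]
  | hmul i a ha => rw [form_ι_mul]; exact ha _ (skewDer_idealPlus χ i hy)

theorem rev_rev (x : TV k θ) : rev k θ (rev k θ x) = x := by
  have h1 : ∀ a b : TV k θ, rev k θ (a * b) = rev k θ b * rev k θ a := by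
    intro a b; simp [rev]
  induction x using FreeAlgebra.induction with
  | grade0 r => simp [rev]
  | grade1 i => simp [rev, revOp]
  | mul a b ha hb => rw [h1, h1, ha, hb]
  | add a b ha hb => rw [map_add, map_add, ha, hb]

/-- The pairing `η : 𝓤⁺(χ) × 𝓤⁻(χ) → k`. -/
def etaFree (χ : Bicharacter k θ) : TV k θ →ₗ[k] TV k θ →ₗ[k] k :=
  (LinearMap.lcomp k k (rev k θ)).comp (form χ)

/-- The pairing `η : 𝔲⁺(χ) × 𝔲⁻(χ) → k`. -/
def eta (χ : Bicharacter k θ) : UPlus χ →ₗ[k] UMinus χ →ₗ[k] k :=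
  (idealPlus χ).liftQ
    ((idealMinus χ).liftQ (etaFree χ).flip (by
      rintro _ ⟨y, hy, rfl⟩
      ext x
      simp [etaFree, rev_rev, form_idealPlus_right χ _ y hy])).flip (by
    intro x hx
    ext y
    simp [etaFree, form_symm χ x, form_idealPlus_right χ _ x hx])

/-! ### The Hopf algebra `𝓤(χ)` -/

/-- The generators `E_i, F_i, K_i, K_i⁻¹, L_i, L_i⁻¹` of `𝓤(χ)`. -/
inductive Gen (θ : ℕ) : Type
  | E (i : Fin θ)
  | F (i : Fin θ)
  | K (i : Fin θ)
  | Kinv (i : Fin θ)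
  | L (i : Fin θ)
  | Linv (i : Fin θ)

/-- The generators `K_i^{±1}, L_i^{±1}`. -/
inductive Gen.IsTorus {θ : ℕ} : Gen θ → Prop
  | K (i : Fin θ) : IsTorus (Gen.K i)
  | Kinv (i : Fin θ) : IsTorus (Gen.Kinv i)
  | L (i : Fin θ) : IsTorus (Gen.L i)
  | Linv (i : Fin θ) : IsTorus (Gen.Linv i)

open FreeAlgebra in
/-- The defining relations of `𝓤(χ)`. -/
inductive Rel (χ : Bicharacter k θ) : FreeAlgebra k (Gen θ) → FreeAlgebra k (Gen θ) → Prop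
  | comm (g h : Gen θ) (hg : g.IsTorus) (hh : h.IsTorus) : Rel χ (ι k g * ι k h) (ι k h * ι k g)
  | K_inv (i : Fin θ) : Rel χ (ι k (.K i) * ι k (.Kinv i)) 1
  | L_inv (i : Fin θ) : Rel χ (ι k (.L i) * ι k (.Linv i)) 1
  | EF (i j : Fin θ) : Rel χ (ι k (.E i) * ι k (.F j) - ι k (.F j) * ι k (.E i))
      (if i = j then ι k (.K i) - ι k (.L i) else 0)
  | KE (i j : Fin θ) : Rel χ (ι k (.K i) * ι k (.E j) * ι k (.Kinv i)) (χ.q i j • ι k (.E j))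
  | LE (i j : Fin θ) : Rel χ (ι k (.L i) * ι k (.E j) * ι k (.Linv i)) ((χ.q j i)⁻¹ • ι k (.E j))
  | LF (i j : Fin θ) : Rel χ (ι k (.L i) * ι k (.F j) * ι k (.Linv i)) (χ.q j i • ι k (.F j))
  | KF (i j : Fin θ) : Rel χ (ι k (.K i) * ι k (.F j) * ι k (.Kinv i)) ((χ.q i j)⁻¹ • ι k (.F j))

/-- The algebra `𝓤(χ)`. -/
def BigU (χ : Bicharacter k θ) := RingQuot (Rel χ)

instance (χ : Bicharacter k θ) : Ring (BigU χ) := inferInstanceAs (Ring (RingQuot (Rel χ)))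

instance (χ : Bicharacter k θ) : Algebra k (BigU χ) :=
  inferInstanceAs (Algebra k (RingQuot (Rel χ)))

/-- The quotient map onto `𝓤(χ)`. -/
def mkBigU (χ : Bicharacter k θ) : FreeAlgebra k (Gen θ) →ₐ[k] BigU χ :=
  RingQuot.mkAlgHom k (Rel χ)

theorem mkBigU_rel (χ : Bicharacter k θ) {x y : FreeAlgebra k (Gen θ)} (h : Rel χ x y) :
    mkBigU χ x = mkBigU χ y :=
  RingQuot.mkAlgHom_rel k h

/-- The universal property of `𝓤(χ)`. -/
def liftBigU {A : Type*} [Semiring A] [Algebra k A] (χ : Bicharacter k θ) (f : Gen θ → A)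
    (h : ∀ x y, Rel χ x y → FreeAlgebra.lift k f x = FreeAlgebra.lift k f y) : BigU χ →ₐ[k] A :=
  RingQuot.liftAlgHom k ⟨FreeAlgebra.lift k f, fun x y => h x y⟩

/-- The generators as elements of `𝓤(χ)`. -/
def gen (χ : Bicharacter k θ) (g : Gen θ) : BigU χ :=
  mkBigU χ (FreeAlgebra.ι k g)

theorem liftBigU_gen {A : Type*} [Semiring A] [Algebra k A] (χ : Bicharacter k θ) (f : Gen θ → A)
    (h : ∀ x y, Rel χ x y → FreeAlgebra.lift k f x = FreeAlgebra.lift k f y) (g : Gen θ) :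
    liftBigU χ f h (gen χ g) = f g :=
  (RingQuot.liftAlgHom_mkAlgHom_apply k (FreeAlgebra.lift k f) (fun x y => h x y) _).trans
    (FreeAlgebra.lift_ι_apply f g)

theorem q_ne_zero (χ : Bicharacter k θ) (i j : Fin θ) : χ.q i j ≠ 0 := Units.ne_zero _

section relations

variable (χ : Bicharacter k θ) (i j : Fin θ)

theorem gen_comm (g h : Gen θ) (hg : g.IsTorus) (hh : h.IsTorus) :
    gen χ g * gen χ h = gen χ h * gen χ g := by
  simpa [gen] using mkBigU_rel χ (Rel.comm (χ := χ) g h hg hh)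

theorem K_Kinv : gen χ (.K i) * gen χ (.Kinv i) = 1 := by
  simpa [gen] using mkBigU_rel χ (Rel.K_inv (χ := χ) i)

theorem L_Linv : gen χ (.L i) * gen χ (.Linv i) = 1 := by
  simpa [gen] using mkBigU_rel χ (Rel.L_inv (χ := χ) i)

theorem Kinv_K : gen χ (.Kinv i) * gen χ (.K i) = 1 := by
  rw [gen_comm χ _ _ (.Kinv i) (.K i), K_Kinv]

theorem Linv_L : gen χ (.Linv i) * gen χ (.L i) = 1 := by
  rw [gen_comm χ _ _ (.Linv i) (.L i), L_Linv]

theorem E_F : gen χ (.E i) * gen χ (.F j) - gen χ (.F j) * gen χ (.E i) =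
    if i = j then gen χ (.K i) - gen χ (.L i) else 0 := by
  have := mkBigU_rel χ (Rel.EF (χ := χ) i j)
  split_ifs at this ⊢ with h
  · simpa [gen] using this
  · simpa [gen] using this

theorem K_E : gen χ (.K i) * gen χ (.E j) = χ.q i j • (gen χ (.E j) * gen χ (.K i)) := by
  have h := mkBigU_rel χ (Rel.KE (χ := χ) i j)
  simp only [map_mul, map_smul] at h
  calc _ = gen χ (.K i) * gen χ (.E j) * gen χ (.Kinv i) * gen χ (.K i) := by
        rw [mul_assoc _ (gen χ (.Kinv i)), Kinv_K, mul_one]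
    _ = _ := by unfold gen; rw [h, smul_mul_assoc]

theorem K_F : gen χ (.K i) * gen χ (.F j) = (χ.q i j)⁻¹ • (gen χ (.F j) * gen χ (.K i)) := by
  have h := mkBigU_rel χ (Rel.KF (χ := χ) i j)
  simp only [map_mul, map_smul] at h
  calc _ = gen χ (.K i) * gen χ (.F j) * gen χ (.Kinv i) * gen χ (.K i) := by
        rw [mul_assoc _ (gen χ (.Kinv i)), Kinv_K, mul_one]
    _ = _ := by unfold gen; rw [h, smul_mul_assoc]

theorem L_E : gen χ (.L i) * gen χ (.E j) = (χ.q j i)⁻¹ • (gen χ (.E j) * gen χ (.L i)) := by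
  have h := mkBigU_rel χ (Rel.LE (χ := χ) i j)
  simp only [map_mul, map_smul] at h
  calc _ = gen χ (.L i) * gen χ (.E j) * gen χ (.Linv i) * gen χ (.L i) := by
        rw [mul_assoc _ (gen χ (.Linv i)), Linv_L, mul_one]
    _ = _ := by unfold gen; rw [h, smul_mul_assoc]

theorem L_F : gen χ (.L i) * gen χ (.F j) = χ.q j i • (gen χ (.F j) * gen χ (.L i)) := by
  have h := mkBigU_rel χ (Rel.LF (χ := χ) i j)
  simp only [map_mul, map_smul] at h
  calc _ = gen χ (.L i) * gen χ (.F j) * gen χ (.Linv i) * gen χ (.L i) := by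
        rw [mul_assoc _ (gen χ (.Linv i)), Linv_L, mul_one]
    _ = _ := by unfold gen; rw [h, smul_mul_assoc]

theorem E_Kinv : gen χ (.E j) * gen χ (.Kinv i) =
    χ.q i j • (gen χ (.Kinv i) * gen χ (.E j)) := by
  calc _ = gen χ (.Kinv i) * (gen χ (.K i) * gen χ (.E j)) * gen χ (.Kinv i) := by
        rw [← mul_assoc, Kinv_K, one_mul]
    _ = _ := by
        rw [K_E, mul_smul_comm, smul_mul_assoc, mul_assoc, mul_assoc, K_Kinv, mul_one]

theorem F_Kinv : gen χ (.F j) * gen χ (.Kinv i) =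
    (χ.q i j)⁻¹ • (gen χ (.Kinv i) * gen χ (.F j)) := by
  calc _ = gen χ (.Kinv i) * (gen χ (.K i) * gen χ (.F j)) * gen χ (.Kinv i) := by
        rw [← mul_assoc, Kinv_K, one_mul]
    _ = _ := by
        rw [K_F, mul_smul_comm, smul_mul_assoc, mul_assoc, mul_assoc, K_Kinv, mul_one]

theorem Linv_E : gen χ (.Linv i) * gen χ (.E j) =
    χ.q j i • (gen χ (.E j) * gen χ (.Linv i)) := by
  have : gen χ (.E j) * gen χ (.Linv i) =
      (χ.q j i)⁻¹ • (gen χ (.Linv i) * gen χ (.E j)) := by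
    calc _ = gen χ (.Linv i) * (gen χ (.L i) * gen χ (.E j)) * gen χ (.Linv i) := by
          rw [← mul_assoc, Linv_L, one_mul]
      _ = _ := by
          rw [L_E, mul_smul_comm, smul_mul_assoc, mul_assoc, mul_assoc, L_Linv, mul_one]
  rw [this, smul_smul, mul_inv_cancel₀ (q_ne_zero χ j i), one_smul]

theorem Linv_F : gen χ (.Linv i) * gen χ (.F j) =
    (χ.q j i)⁻¹ • (gen χ (.F j) * gen χ (.Linv i)) := by
  have : gen χ (.F j) * gen χ (.Linv i) =
      χ.q j i • (gen χ (.Linv i) * gen χ (.F j)) := by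
    calc _ = gen χ (.Linv i) * (gen χ (.L i) * gen χ (.F j)) * gen χ (.Linv i) := by
          rw [← mul_assoc, Linv_L, one_mul]
      _ = _ := by
          rw [L_F, mul_smul_comm, smul_mul_assoc, mul_assoc, mul_assoc, L_Linv, mul_one]
  rw [this, smul_smul, inv_mul_cancel₀ (q_ne_zero χ j i), one_smul]

end relations

/-- The values of the comultiplication of `𝓤(χ)` on the generators. -/
def comulGen (χ : Bicharacter k θ) : Gen θ → BigU χ ⊗[k] BigU χ
  | .E i => gen χ (.E i) ⊗ₜ 1 + gen χ (.K i) ⊗ₜ gen χ (.E i)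
  | .F i => gen χ (.F i) ⊗ₜ gen χ (.L i) + 1 ⊗ₜ gen χ (.F i)
  | .K i => gen χ (.K i) ⊗ₜ gen χ (.K i)
  | .Kinv i => gen χ (.Kinv i) ⊗ₜ gen χ (.Kinv i)
  | .L i => gen χ (.L i) ⊗ₜ gen χ (.L i)
  | .Linv i => gen χ (.Linv i) ⊗ₜ gen χ (.Linv i)

theorem comulGen_torus (χ : Bicharacter k θ) (g : Gen θ) (hg : g.IsTorus) :
    comulGen χ g = gen χ g ⊗ₜ gen χ g := by
  cases hg <;> rfl

/-- The comultiplication `Δ` of `𝓤(χ)`. -/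
def comulBigU (χ : Bicharacter k θ) : BigU χ →ₐ[k] BigU χ ⊗[k] BigU χ :=
  liftBigU χ (comulGen χ) (by
    intro x y h
    cases h with
    | comm g h hg hh =>
      simp [comulGen_torus, hg, hh, gen_comm χ g h hg hh]
    | K_inv i => simp [comulGen, K_Kinv, Algebra.TensorProduct.one_def]
    | L_inv i => simp [comulGen, L_Linv, Algebra.TensorProduct.one_def]
    | EF i j =>
      have h := E_F χ i j
      have h1 : comulGen χ (.E i) * comulGen χ (.F j) - comulGen χ (.F j) * comulGen χ (.E i) =
          (gen χ (.E i) * gen χ (.F j) - gen χ (.F j) * gen χ (.E i)) ⊗ₜ gen χ (.L j) +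
          gen χ (.K i) ⊗ₜ (gen χ (.E i) * gen χ (.F j) - gen χ (.F j) * gen χ (.E i)) := by
        simp only [comulGen, mul_add, add_mul, Algebra.TensorProduct.tmul_mul_tmul, one_mul,
          mul_one, K_F, L_E, TensorProduct.tmul_sub, TensorProduct.sub_tmul,
          TensorProduct.smul_tmul, TensorProduct.tmul_smul]
        abel
      simp only [map_sub, map_mul, FreeAlgebra.lift_ι_apply]
      rw [h1, h]
      split_ifs with hij
      · subst hij
        simp [comulGen, TensorProduct.tmul_sub, TensorProduct.sub_tmul]
      · simp
    | KE i j =>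
      have h : gen χ (.K i) * gen χ (.K j) * gen χ (.Kinv i) = gen χ (.K j) := by
        rw [gen_comm χ _ _ (.K i) (.K j), mul_assoc, K_Kinv, mul_one]
      simp only [map_mul, map_smul, FreeAlgebra.lift_ι_apply, comulGen, mul_add, add_mul,
        Algebra.TensorProduct.tmul_mul_tmul, mul_one, K_E, h, K_Kinv, smul_add,
        smul_mul_assoc, mul_assoc (gen χ (.E j)), ← TensorProduct.smul_tmul',
        TensorProduct.tmul_smul]
    | LE i j =>
      have h : gen χ (.L i) * gen χ (.K j) * gen χ (.Linv i) = gen χ (.K j) := by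
        rw [gen_comm χ _ _ (.L i) (.K j), mul_assoc, L_Linv, mul_one]
      simp only [map_mul, map_smul, FreeAlgebra.lift_ι_apply, comulGen, mul_add, add_mul,
        Algebra.TensorProduct.tmul_mul_tmul, mul_one, L_E, h, L_Linv, smul_add,
        smul_mul_assoc, mul_assoc (gen χ (.E j)), ← TensorProduct.smul_tmul',
        TensorProduct.tmul_smul]
    | LF i j =>
      have h : gen χ (.L i) * gen χ (.L j) * gen χ (.Linv i) = gen χ (.L j) := by
        rw [gen_comm χ _ _ (.L i) (.L j), mul_assoc, L_Linv, mul_one]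
      simp only [map_mul, map_smul, FreeAlgebra.lift_ι_apply, comulGen, mul_add, add_mul,
        Algebra.TensorProduct.tmul_mul_tmul, mul_one, L_F, h, L_Linv, smul_add,
        smul_mul_assoc, mul_assoc (gen χ (.F j)), ← TensorProduct.smul_tmul',
        TensorProduct.tmul_smul]
    | KF i j =>
      have h : gen χ (.K i) * gen χ (.L j) * gen χ (.Kinv i) = gen χ (.L j) := by
        rw [gen_comm χ _ _ (.K i) (.L j), mul_assoc, K_Kinv, mul_one]
      simp only [map_mul, map_smul, FreeAlgebra.lift_ι_apply, comulGen, mul_add, add_mul,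
        Algebra.TensorProduct.tmul_mul_tmul, mul_one, K_F, h, K_Kinv, smul_add,
        smul_mul_assoc, mul_assoc (gen χ (.F j)), ← TensorProduct.smul_tmul',
        TensorProduct.tmul_smul])

theorem comulBigU_gen (χ : Bicharacter k θ) (g : Gen θ) :
    comulBigU χ (gen χ g) = comulGen χ g := by
  exact liftBigU_gen ..

/-- The values of the antipode of `𝓤(χ)` on the generators. -/
def antipodeGen (χ : Bicharacter k θ) : Gen θ → BigU χ
  | .E i => -(gen χ (.Kinv i) * gen χ (.E i))
  | .F i => -(gen χ (.F i) * gen χ (.Linv i))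
  | .K i => gen χ (.Kinv i)
  | .Kinv i => gen χ (.K i)
  | .L i => gen χ (.Linv i)
  | .Linv i => gen χ (.L i)

theorem antipodeGen_torus (χ : Bicharacter k θ) (g : Gen θ) (hg : g.IsTorus) :
    ∃ h : Gen θ, h.IsTorus ∧ antipodeGen χ g = gen χ h := by
  cases hg with
  | K i => exact ⟨_, .Kinv i, rfl⟩
  | Kinv i => exact ⟨_, .K i, rfl⟩
  | L i => exact ⟨_, .Linv i, rfl⟩
  | Linv i => exact ⟨_, .L i, rfl⟩

/-- The antipode of `𝓤(χ)` as an algebra map to the opposite algebra. -/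
def antipodeBigU (χ : Bicharacter k θ) : BigU χ →ₐ[k] (BigU χ)ᵐᵒᵖ :=
  liftBigU χ (fun g => MulOpposite.op (antipodeGen χ g)) (by
    intro x y h
    apply MulOpposite.unop_injective
    cases h with
    | comm g h hg hh =>
      obtain ⟨g', hg', eg⟩ := antipodeGen_torus χ g hg
      obtain ⟨h', hh', eh⟩ := antipodeGen_torus χ h hh
      simp [eg, eh, gen_comm χ g' h' hg' hh']
    | K_inv i => simp [antipodeGen, K_Kinv]
    | L_inv i => simp [antipodeGen, L_Linv]
    | EF i j =>
      have h := E_F χ i j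
      have h1 : antipodeGen χ (.F j) * antipodeGen χ (.E i) -
          antipodeGen χ (.E i) * antipodeGen χ (.F j) =
          -(gen χ (.Kinv i) * (gen χ (.E i) * gen χ (.F j) - gen χ (.F j) * gen χ (.E i)) *
            gen χ (.Linv j)) := by
        have h2 : gen χ (.F j) * gen χ (.Linv j) * (gen χ (.Kinv i) * gen χ (.E i)) =
            gen χ (.Kinv i) * (gen χ (.F j) * gen χ (.E i)) * gen χ (.Linv j) := by
          calc _ = gen χ (.F j) * (gen χ (.Linv j) * gen χ (.Kinv i)) * gen χ (.E i) := by
                simp only [mul_assoc]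
            _ = gen χ (.F j) * gen χ (.Kinv i) * (gen χ (.Linv j) * gen χ (.E i)) := by
                rw [gen_comm χ _ _ (.Linv j) (.Kinv i)]; simp only [mul_assoc]
            _ = _ := by
                rw [F_Kinv, Linv_E, smul_mul_assoc, mul_smul_comm, smul_smul,
                  inv_mul_cancel₀ (q_ne_zero χ i j), one_smul]; simp only [mul_assoc]
        simp only [antipodeGen, neg_mul_neg]
        rw [h2]; simp only [mul_sub, sub_mul, mul_assoc, neg_sub]
      simp only [map_sub, map_mul, FreeAlgebra.lift_ι_apply, MulOpposite.unop_sub,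
        MulOpposite.unop_mul, MulOpposite.unop_op]
      rw [h1, h]
      split_ifs with hij
      · subst hij
        simp only [map_sub, FreeAlgebra.lift_ι_apply, MulOpposite.unop_sub, MulOpposite.unop_op,
          antipodeGen, mul_sub, sub_mul, Kinv_K, one_mul, mul_assoc, L_Linv, mul_one, neg_sub]
      · simp
    | KE i j =>
      simp only [map_mul, map_smul, FreeAlgebra.lift_ι_apply, MulOpposite.unop_smul,
        MulOpposite.unop_mul, MulOpposite.unop_op, antipodeGen, neg_mul, mul_neg, smul_neg]
      rw [mul_assoc, E_Kinv, mul_smul_comm, mul_smul_comm, ← mul_assoc, ← mul_assoc,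
        gen_comm χ _ _ (.K i) (.Kinv j), mul_assoc (gen χ (.Kinv j)), K_Kinv, mul_one]
    | LE i j =>
      simp only [map_mul, map_smul, FreeAlgebra.lift_ι_apply, MulOpposite.unop_smul,
        MulOpposite.unop_mul, MulOpposite.unop_op, antipodeGen, neg_mul, mul_neg, smul_neg]
      rw [← mul_assoc, ← mul_assoc, gen_comm χ _ _ (.L i) (.Kinv j), mul_assoc (gen χ (.Kinv j)),
        L_E, mul_smul_comm, smul_mul_assoc, mul_assoc, mul_assoc, L_Linv, mul_one]
    | LF i j =>
      simp only [map_mul, map_smul, FreeAlgebra.lift_ι_apply, MulOpposite.unop_smul,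
        MulOpposite.unop_mul, MulOpposite.unop_op, antipodeGen, neg_mul, mul_neg, smul_neg]
      rw [← mul_assoc, ← mul_assoc, L_F, smul_mul_assoc, smul_mul_assoc, mul_assoc (gen χ (.F j)),
        gen_comm χ _ _ (.L i) (.Linv j), mul_assoc, mul_assoc, L_Linv, mul_one]
    | KF i j =>
      simp only [map_mul, map_smul, FreeAlgebra.lift_ι_apply, MulOpposite.unop_smul,
        MulOpposite.unop_mul, MulOpposite.unop_op, antipodeGen, neg_mul, mul_neg, smul_neg]
      rw [← mul_assoc, ← mul_assoc, K_F, smul_mul_assoc, smul_mul_assoc, mul_assoc (gen χ (.F j)),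
        gen_comm χ _ _ (.K i) (.Linv j), mul_assoc, mul_assoc, K_Kinv, mul_one])

theorem antipodeBigU_gen (χ : Bicharacter k θ) (g : Gen θ) :
    antipodeBigU χ (gen χ g) = MulOpposite.op (antipodeGen χ g) := by
  exact liftBigU_gen ..

/-- `K_i` as a unit. -/
def unitK (χ : Bicharacter k θ) (i : Fin θ) : (BigU χ)ˣ :=
  ⟨gen χ (.K i), gen χ (.Kinv i), K_Kinv χ i, Kinv_K χ i⟩

/-- `L_i` as a unit. -/
def unitL (χ : Bicharacter k θ) (i : Fin θ) : (BigU χ)ˣ :=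
  ⟨gen χ (.L i), gen χ (.Linv i), L_Linv χ i, Linv_L χ i⟩

theorem unitK_comm (χ : Bicharacter k θ) :
    Pairwise fun i j => ∀ x y : Multiplicative ℤ,
      Commute (zpowersHom _ (unitK χ i) x) (zpowersHom _ (unitK χ j) y) := by
  intro i j _ x y
  exact Commute.zpow_zpow (Units.ext (gen_comm χ _ _ (.K i) (.K j))) _ _

/-- `α ↦ K^α = ∏_i K_i^{α_i}`, for `α ∈ ℤ^θ`. -/
def powKHom (χ : Bicharacter k θ) : (Fin θ → Multiplicative ℤ) →* (BigU χ)ˣ :=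
  MonoidHom.noncommPiCoprod (fun i => zpowersHom _ (unitK χ i)) (unitK_comm χ)

theorem unitL_comm (χ : Bicharacter k θ) :
    Pairwise fun i j => ∀ x y : Multiplicative ℤ,
      Commute (zpowersHom _ (unitL χ i) x) (zpowersHom _ (unitL χ j) y) := by
  intro i j _ x y
  exact Commute.zpow_zpow (Units.ext (gen_comm χ _ _ (.L i) (.L j))) _ _

/-- `α ↦ L^α = ∏_i L_i^{α_i}`, for `α ∈ ℤ^θ`. -/
def powLHom (χ : Bicharacter k θ) : (Fin θ → Multiplicative ℤ) →* (BigU χ)ˣ :=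
  MonoidHom.noncommPiCoprod (fun i => zpowersHom _ (unitL χ i)) (unitL_comm χ)

/-- `K^α ∈ 𝓤(χ)`. -/
def powK (χ : Bicharacter k θ) (α : Fin θ → ℤ) : BigU χ :=
  (powKHom χ fun i => Multiplicative.ofAdd (α i) : (BigU χ)ˣ)

/-- `L^α ∈ 𝓤(χ)`. -/
def powL (χ : Bicharacter k θ) (α : Fin θ → ℤ) : BigU χ :=
  (powLHom χ fun i => Multiplicative.ofAdd (α i) : (BigU χ)ˣ)

theorem powK_add (χ : Bicharacter k θ) (α β : Fin θ → ℤ) :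
    powK χ (α + β) = powK χ α * powK χ β := by
  simp only [powK, ← Units.val_mul, ← map_mul]; rfl

theorem powL_add (χ : Bicharacter k θ) (α β : Fin θ → ℤ) :
    powL χ (α + β) = powL χ α * powL χ β := by
  simp only [powL, ← Units.val_mul, ← map_mul]; rfl

theorem powK_zero (χ : Bicharacter k θ) : powK χ 0 = 1 := by
  have : powKHom χ 1 = 1 := map_one _
  exact congrArg Units.val this

theorem powL_zero (χ : Bicharacter k θ) : powL χ 0 = 1 := by
  have : powLHom χ 1 = 1 := map_one _
  exact congrArg Units.val this

theorem ofAdd_single (i : Fin θ) (z : ℤ) :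
    (fun j => Multiplicative.ofAdd ((Pi.single i z : Fin θ → ℤ) j)) =
      (Pi.mulSingle i (Multiplicative.ofAdd z) : Fin θ → Multiplicative ℤ) := by
  funext j
  by_cases h : j = i
  · subst h; simp
  · simp [h]

theorem powK_single (χ : Bicharacter k θ) (i : Fin θ) (z : ℤ) :
    powK χ (Pi.single i z) = (unitK χ i ^ z : (BigU χ)ˣ) := by
  rw [powK, ofAdd_single, powKHom, MonoidHom.noncommPiCoprod_mulSingle]; rfl

theorem powL_single (χ : Bicharacter k θ) (i : Fin θ) (z : ℤ) :
    powL χ (Pi.single i z) = (unitL χ i ^ z : (BigU χ)ˣ) := by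
  rw [powL, ofAdd_single, powLHom, MonoidHom.noncommPiCoprod_mulSingle]; rfl

theorem toInt_wdeg_nil : toInt (wdeg ([] : List (Fin θ))) = 0 := by
  funext i; simp [toInt, wdeg]

theorem toInt_wdeg_cons (i : Fin θ) (l : List (Fin θ)) :
    toInt (wdeg (i :: l)) = Pi.single i 1 + toInt (wdeg l) := by
  funext j
  by_cases h : i = j
  · subst h; simp [toInt, wdeg, add_comm]
  · simp [toInt, wdeg, h]

theorem powK_cons (χ : Bicharacter k θ) (i : Fin θ) (l : List (Fin θ)) :
    powK χ (toInt (wdeg (i :: l))) = gen χ (.K i) * powK χ (toInt (wdeg l)) := by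
  rw [toInt_wdeg_cons, powK_add, powK_single, zpow_one]; rfl

theorem powL_cons (χ : Bicharacter k θ) (i : Fin θ) (l : List (Fin θ)) :
    powL χ (toInt (wdeg (i :: l))) = powL χ (toInt (wdeg l)) * gen χ (.L i) := by
  rw [toInt_wdeg_cons, add_comm, powL_add, powL_single, zpow_one]; rfl

theorem powK_neg_cons (χ : Bicharacter k θ) (i : Fin θ) (l : List (Fin θ)) :
    powK χ (-toInt (wdeg (i :: l))) = powK χ (-toInt (wdeg l)) * gen χ (.Kinv i) := by
  rw [toInt_wdeg_cons, neg_add, add_comm, powK_add, ← Pi.single_neg, powK_single, zpow_neg_one]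
  rfl

theorem powL_neg_cons (χ : Bicharacter k θ) (i : Fin θ) (l : List (Fin θ)) :
    powL χ (-toInt (wdeg (i :: l))) = gen χ (.Linv i) * powL χ (-toInt (wdeg l)) := by
  rw [toInt_wdeg_cons, neg_add, powL_add, ← Pi.single_neg, powL_single, zpow_neg_one]
  rfl

/-! ### The Hopf algebra `𝔲(χ)` -/

/-- The map `𝓤⁺(χ) → 𝓤(χ)`, `x_i ↦ E_i`. -/
def plusToBigU (χ : Bicharacter k θ) : TV k θ →ₐ[k] BigU χ :=
  FreeAlgebra.lift k fun i => gen χ (.E i)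

/-- The map `𝓤⁻(χ) → 𝓤(χ)`, `x_i ↦ F_i`. -/
def minusToBigU (χ : Bicharacter k θ) : TV k θ →ₐ[k] BigU χ :=
  FreeAlgebra.lift k fun i => gen χ (.F i)

/-- The relations `𝓘⁺(χ) = 0 = 𝓘⁻(χ)`. -/
inductive NicholsRel (χ : Bicharacter k θ) : BigU χ → BigU χ → Prop
  | plus (x : TV k θ) (hx : x ∈ idealPlus χ) : NicholsRel χ (plusToBigU χ x) 0
  | minus (x : TV k θ) (hx : x ∈ idealMinus χ) : NicholsRel χ (minusToBigU χ x) 0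

/-- The algebra `𝔲(χ) = 𝓤(χ) / (𝓘⁻(χ) + 𝓘⁺(χ))`. -/
def SmallU (χ : Bicharacter k θ) := RingQuot (NicholsRel χ)

instance (χ : Bicharacter k θ) : Ring (SmallU χ) :=
  inferInstanceAs (Ring (RingQuot (NicholsRel χ)))

instance (χ : Bicharacter k θ) : Algebra k (SmallU χ) :=
  inferInstanceAs (Algebra k (RingQuot (NicholsRel χ)))

/-- The quotient map `𝓤(χ) → 𝔲(χ)`. -/
def mkU (χ : Bicharacter k θ) : BigU χ →ₐ[k] SmallU χ := RingQuot.mkAlgHom k (NicholsRel χ)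

theorem mkU_plus (χ : Bicharacter k θ) (x : TV k θ) (hx : x ∈ idealPlus χ) :
    mkU χ (plusToBigU χ x) = 0 :=
  (RingQuot.mkAlgHom_rel k (NicholsRel.plus x hx)).trans (map_zero (mkU χ))

theorem mkU_minus (χ : Bicharacter k θ) (x : TV k θ) (hx : x ∈ idealMinus χ) :
    mkU χ (minusToBigU χ x) = 0 :=
  (RingQuot.mkAlgHom_rel k (NicholsRel.minus x hx)).trans (map_zero (mkU χ))

/-- The universal property of `𝔲(χ)`. -/
def liftU {A : Type*} [Semiring A] [Algebra k A] (χ : Bicharacter k θ) (f : BigU χ →ₐ[k] A)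
    (hp : ∀ x ∈ idealPlus χ, f (plusToBigU χ x) = 0)
    (hm : ∀ x ∈ idealPlus χ, f (minusToBigU χ (rev k θ x)) = 0) : SmallU χ →ₐ[k] A :=
  RingQuot.liftAlgHom k ⟨f, by
    intro x y h
    cases h with
    | plus x hx => rw [hp x hx, map_zero]
    | minus x hx =>
      obtain ⟨y, hy, rfl⟩ := hx
      rw [hm y hy, map_zero]⟩

/-- The map `𝔲⁺(χ) → 𝔲(χ)`. -/
def plusToU (χ : Bicharacter k θ) : UPlus χ →ₗ[k] SmallU χ :=
  (idealPlus χ).liftQ ((mkU χ).comp (plusToBigU χ)).toLinearMap (fun x hx => mkU_plus χ x hx)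

/-- The map `𝔲⁻(χ) → 𝔲(χ)`. -/
def minusToU (χ : Bicharacter k θ) : UMinus χ →ₗ[k] SmallU χ :=
  (idealMinus χ).liftQ ((mkU χ).comp (minusToBigU χ)).toLinearMap (fun x hx => mkU_minus χ x hx)

section coproduct

variable (χ : Bicharacter k θ)

theorem plus_kAct (i : Fin θ) (x : TV k θ) :
    plusToBigU χ (kAct χ i x) * gen χ (.K i) = gen χ (.K i) * plusToBigU χ x := by
  induction x using tv_induction with
  | h1 => simp
  | hadd a b ha hb => simp [add_mul, mul_add, ha, hb]
  | hsmul c a ha => simp [ha]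
  | hmul j a ha =>
    have hj : plusToBigU χ (FreeAlgebra.ι k j) = gen χ (.E j) := by simp [plusToBigU]
    rw [kAct_ι_mul, map_smul, map_mul, map_mul, hj, smul_mul_assoc, mul_assoc, ha, ← mul_assoc,
      ← mul_assoc, K_E, smul_mul_assoc]

theorem homog_ind {β : Fin θ → ℕ} {p : TV k θ → Prop} (h0 : p 0)
    (hadd : ∀ a b, p a → p b → p (a + b)) (hsmul : ∀ (c : k) a, p a → p (c • a))
    (hw : ∀ l : List (Fin θ), wdeg l = β → p (word k l)) (x : TV k θ) (hx : x ∈ homog k β) :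
    p x := by
  induction hx using Submodule.span_induction with
  | mem x h => obtain ⟨l, hl, rfl⟩ := h; exact hw l hl
  | zero => exact h0
  | add x y _ _ hx hy => exact hadd x y hx hy
  | smul a x _ hx => exact hsmul a x hx

/-- `b ↦ K^{deg b} ⊗ b`. -/
def coactPlus : TV k θ →ₐ[k] BigU χ ⊗[k] BigU χ :=
  FreeAlgebra.lift k fun i => gen χ (.K i) ⊗ₜ gen χ (.E i)

theorem coactPlus_homog {β : Fin θ → ℕ} (x : TV k θ) (hx : x ∈ homog k β) :
    coactPlus χ x = powK χ (toInt β) ⊗ₜ plusToBigU χ x := by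
  refine homog_ind (p := fun x => coactPlus χ x = powK χ (toInt β) ⊗ₜ plusToBigU χ x)
    (by simp) (fun a b ha hb => by simp [ha, hb, TensorProduct.tmul_add])
    (fun c a ha => by simp [ha]) (fun l hl => ?_) x hx
  clear hx
  subst hl
  induction l with
  | nil => simp [word, toInt_wdeg_nil, powK_zero, Algebra.TensorProduct.one_def]
  | cons i l ih =>
    have : word k (i :: l) = FreeAlgebra.ι k i * word k l := by simp [word]
    rw [this, map_mul, ih, map_mul, powK_cons]
    simp [coactPlus, plusToBigU]

/-- `a ⊗ b ↦ a K^{deg b} ⊗ b`. -/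
def bosonPlus : TV k θ ⊗[k] TV k θ →ₗ[k] BigU χ ⊗[k] BigU χ :=
  (LinearMap.mul' k (BigU χ ⊗[k] BigU χ)).comp
    (TensorProduct.map ((Algebra.TensorProduct.includeLeft (S := k)).comp
      (plusToBigU χ)).toLinearMap (coactPlus χ).toLinearMap)

theorem bosonPlus_tmul (a b : TV k θ) :
    bosonPlus χ (a ⊗ₜ b) = (plusToBigU χ a ⊗ₜ 1) * coactPlus χ b := by
  simp [bosonPlus]

theorem comul_plus (x : TV k θ) :
    comulBigU χ (plusToBigU χ x) = bosonPlus χ (braidedComul χ x) := by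
  induction x using tv_induction with
  | h1 => simp [braidedComul_one, bosonPlus_tmul, Algebra.TensorProduct.one_def]
  | hadd a b ha hb => simp [ha, hb]
  | hsmul c a ha => simp [ha]
  | hmul i a ha =>
    rw [map_mul, map_mul, ha, braidedComul_ι_mul]
    generalize braidedComul χ a = t
    have hi : plusToBigU χ (FreeAlgebra.ι k i) = gen χ (.E i) := by simp [plusToBigU]
    rw [hi, comulBigU_gen]
    induction t with
    | zero => simp
    | add a b ha hb => simp only [map_add, mul_add, ha, hb]; abel
    | tmul a b =>
      have hc : coactPlus χ (FreeAlgebra.ι k i) = gen χ (.K i) ⊗ₜ gen χ (.E i) := by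
        simp [coactPlus]
      simp only [TensorProduct.map_tmul, map_add, bosonPlus_tmul, LinearMap.mulLeft_apply,
        LinearMap.id_apply, AlgHom.toLinearMap_apply, map_mul, hi, hc, comulGen, add_mul, ← mul_assoc,
        Algebra.TensorProduct.tmul_mul_tmul, one_mul, mul_one, plus_kAct]

/-- `a ↦ Ω(a) ⊗ L^{deg a}`. -/
def coactMinus : TV k θ →ₐ[k] BigU χ ⊗[k] BigU χ :=
  FreeAlgebra.lift k fun i => gen χ (.F i) ⊗ₜ gen χ (.L i)

theorem rev_mul (a b : TV k θ) : rev k θ (a * b) = rev k θ b * rev k θ a := by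
  simp [rev]

theorem rev_one : rev k θ 1 = 1 := by simp [rev]

theorem rev_ι (i : Fin θ) : rev k θ (FreeAlgebra.ι k i) = FreeAlgebra.ι k i := by
  simp [rev, revOp]

theorem coactMinus_homog {β : Fin θ → ℕ} (x : TV k θ) (hx : x ∈ homog k β) :
    coactMinus χ (rev k θ x) = minusToBigU χ (rev k θ x) ⊗ₜ powL χ (toInt β) := by
  refine homog_ind
    (p := fun x => coactMinus χ (rev k θ x) = minusToBigU χ (rev k θ x) ⊗ₜ powL χ (toInt β))
    (by simp) (fun a b ha hb => by simp [ha, hb, TensorProduct.add_tmul])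
    (fun c a ha => by simp [ha, TensorProduct.smul_tmul']) (fun l hl => ?_) x hx
  clear hx
  subst hl
  induction l with
  | nil => simp [word, toInt_wdeg_nil, powL_zero, rev_one, Algebra.TensorProduct.one_def]
  | cons i l ih =>
    have : word k (i :: l) = FreeAlgebra.ι k i * word k l := by simp [word]
    rw [this, rev_mul, map_mul, ih, map_mul, powL_cons, rev_ι]
    simp [coactMinus, minusToBigU]

/-- `a ⊗ b ↦ Ω(a) ⊗ Ω(b) L^{deg a}`. -/
def bosonMinus : TV k θ ⊗[k] TV k θ →ₗ[k] BigU χ ⊗[k] BigU χ :=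
  (LinearMap.mul' k (BigU χ ⊗[k] BigU χ)).comp
    ((TensorProduct.map ((Algebra.TensorProduct.includeRight.comp
      (minusToBigU χ)).toLinearMap.comp (rev k θ)) ((coactMinus χ).toLinearMap.comp (rev k θ))).comp
    (TensorProduct.comm k (TV k θ) (TV k θ)).toLinearMap)

theorem bosonMinus_tmul (a b : TV k θ) : bosonMinus χ (a ⊗ₜ b) =
    (1 ⊗ₜ minusToBigU χ (rev k θ b)) * coactMinus χ (rev k θ a) := by
  simp [bosonMinus]

theorem coactMinus_kAct (i : Fin θ) (x : TV k θ) :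
    coactMinus χ (rev k θ x) * (1 ⊗ₜ gen χ (.F i)) =
      (1 ⊗ₜ gen χ (.F i)) * coactMinus χ (rev k θ (kAct χ i x)) := by
  induction x using tv_induction with
  | h1 => simp [rev_one]
  | hadd a b ha hb => simp [add_mul, mul_add, ha, hb]
  | hsmul c a ha => simp [ha]
  | hmul j a ha =>
    have hj : coactMinus χ (FreeAlgebra.ι k j) = gen χ (.F j) ⊗ₜ gen χ (.L j) := by
      simp [coactMinus]
    rw [kAct_ι_mul, map_smul, map_smul, rev_mul, rev_mul, map_mul, map_mul, rev_ι, hj,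
      mul_smul_comm, ← mul_assoc, ← ha, mul_assoc, mul_assoc,
      Algebra.TensorProduct.tmul_mul_tmul, Algebra.TensorProduct.tmul_mul_tmul, L_F, mul_one,
      one_mul, TensorProduct.tmul_smul, mul_smul_comm]

theorem comul_minus (x : TV k θ) :
    comulBigU χ (minusToBigU χ (rev k θ x)) = bosonMinus χ (braidedComul χ x) := by
  induction x using tv_induction with
  | h1 => simp [braidedComul_one, bosonMinus_tmul, rev_one, Algebra.TensorProduct.one_def]
  | hadd a b ha hb => simp [ha, hb]
  | hsmul c a ha => simp [ha]
  | hmul i a ha =>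
    rw [rev_mul, map_mul, map_mul, ha, braidedComul_ι_mul, rev_ι]
    generalize braidedComul χ a = t
    have hi : minusToBigU χ (FreeAlgebra.ι k i) = gen χ (.F i) := by simp [minusToBigU]
    rw [hi, comulBigU_gen]
    induction t with
    | zero => simp
    | add a b ha hb => simp only [map_add, add_mul, ha, hb]; abel
    | tmul a b =>
      have hc : coactMinus χ (FreeAlgebra.ι k i) = gen χ (.F i) ⊗ₜ gen χ (.L i) := by
        simp [coactMinus]
      simp only [TensorProduct.map_tmul, map_add, bosonMinus_tmul, LinearMap.mulLeft_apply,
        LinearMap.id_apply, AlgHom.toLinearMap_apply, rev_mul, rev_ι, map_mul, hi, hc, comulGen,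
        mul_add]
      rw [mul_assoc, mul_assoc, coactMinus_kAct, ← mul_assoc (_ ⊗ₜ[k] _) (_ ⊗ₜ[k] _)]
      simp only [Algebra.TensorProduct.tmul_mul_tmul, one_mul]

theorem map_comul_plus (x : TV k θ) (hx : x ∈ idealPlus χ) :
    (Algebra.TensorProduct.map (mkU χ) (mkU χ)) (comulBigU χ (plusToBigU χ x)) = 0 := by
  suffices h : idealPlus χ ≤ LinearMap.ker ((Algebra.TensorProduct.map (mkU χ) (mkU χ)).comp
      ((comulBigU χ).comp (plusToBigU χ))).toLinearMap from h hx
  refine sSup_le fun J hJ => ?_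
  have hJle : J ≤ idealPlus χ := le_sSup hJ
  have hco : ∀ b ∈ J, Algebra.TensorProduct.map (mkU χ) (mkU χ) (coactPlus χ b) = 0 := by
    suffices h : J ≤ LinearMap.ker ((Algebra.TensorProduct.map (mkU χ) (mkU χ)).comp
      (coactPlus χ)).toLinearMap from fun b hb => h hb
    refine hJ.1.graded.trans (iSup_le fun β b hb => ?_)
    simp [coactPlus_homog χ b hb.2, mkU_plus χ b (hJle hb.1)]
  have hle : LinearMap.range (TensorProduct.map J.subtype (LinearMap.id : TV k θ →ₗ[k] TV k θ)) ⊔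
      LinearMap.range (TensorProduct.map (LinearMap.id : TV k θ →ₗ[k] TV k θ) J.subtype) ≤
      LinearMap.ker ((Algebra.TensorProduct.map (mkU χ) (mkU χ)).toLinearMap.comp
        (bosonPlus χ)) := by
    refine sup_le ?_ ?_ <;> rintro _ ⟨t, rfl⟩
    · induction t with
      | zero => simp
      | add a b ha hb => rw [map_add]; exact add_mem ha hb
      | tmul a b =>
        change Algebra.TensorProduct.map (mkU χ) (mkU χ) (bosonPlus χ _) = 0
        rw [TensorProduct.map_tmul, bosonPlus_tmul, map_mul]
        simp [mkU_plus χ a (hJle a.2)]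
    · induction t with
      | zero => simp
      | add a b ha hb => rw [map_add]; exact add_mem ha hb
      | tmul a b =>
        change Algebra.TensorProduct.map (mkU χ) (mkU χ) (bosonPlus χ _) = 0
        rw [TensorProduct.map_tmul, bosonPlus_tmul, map_mul]
        simp [hco b b.2]
  intro y hy
  have := hle (hJ.1.comul y hy)
  simpa [comul_plus] using this

theorem mkU_rev (x : TV k θ) (hx : x ∈ idealPlus χ) :
    mkU χ (minusToBigU χ (rev k θ x)) = 0 :=
  mkU_minus χ _ (Submodule.mem_map_of_mem hx)

theorem map_comul_minus (x : TV k θ) (hx : x ∈ idealPlus χ) :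
    (Algebra.TensorProduct.map (mkU χ) (mkU χ)) (comulBigU χ (minusToBigU χ (rev k θ x))) = 0 := by
  suffices h : idealPlus χ ≤ LinearMap.ker (((Algebra.TensorProduct.map (mkU χ) (mkU χ)).comp
      ((comulBigU χ).comp (minusToBigU χ))).toLinearMap.comp (rev k θ)) from h hx
  refine sSup_le fun J hJ => ?_
  have hJle : J ≤ idealPlus χ := le_sSup hJ
  have hco : ∀ b ∈ J, Algebra.TensorProduct.map (mkU χ) (mkU χ) (coactMinus χ (rev k θ b)) = 0 := by
    suffices h : J ≤ LinearMap.ker (((Algebra.TensorProduct.map (mkU χ) (mkU χ)).comp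
      (coactMinus χ)).toLinearMap.comp (rev k θ)) from fun b hb => h hb
    refine hJ.1.graded.trans (iSup_le fun β b hb => ?_)
    simp [coactMinus_homog χ b hb.2, mkU_rev χ b (hJle hb.1)]
  have hle : LinearMap.range (TensorProduct.map J.subtype (LinearMap.id : TV k θ →ₗ[k] TV k θ)) ⊔
      LinearMap.range (TensorProduct.map (LinearMap.id : TV k θ →ₗ[k] TV k θ) J.subtype) ≤
      LinearMap.ker ((Algebra.TensorProduct.map (mkU χ) (mkU χ)).toLinearMap.comp
        (bosonMinus χ)) := by
    refine sup_le ?_ ?_ <;> rintro _ ⟨t, rfl⟩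
    · induction t with
      | zero => simp
      | add a b ha hb => rw [map_add]; exact add_mem ha hb
      | tmul a b =>
        change Algebra.TensorProduct.map (mkU χ) (mkU χ) (bosonMinus χ _) = 0
        rw [TensorProduct.map_tmul, bosonMinus_tmul, map_mul]
        simp [hco a a.2]
    · induction t with
      | zero => simp
      | add a b ha hb => rw [map_add]; exact add_mem ha hb
      | tmul a b =>
        change Algebra.TensorProduct.map (mkU χ) (mkU χ) (bosonMinus χ _) = 0
        rw [TensorProduct.map_tmul, bosonMinus_tmul, map_mul]
        simp [mkU_rev χ b (hJle b.2)]
  intro y hy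
  have := hle (hJ.1.comul y hy)
  simpa [comul_minus] using this

end coproduct

/-- The comultiplication `Δ` of `𝔲(χ)`. -/
def comulU (χ : Bicharacter k θ) : SmallU χ →ₐ[k] SmallU χ ⊗[k] SmallU χ :=
  liftU χ ((Algebra.TensorProduct.map (mkU χ) (mkU χ)).comp (comulBigU χ))
    (map_comul_plus χ) (map_comul_minus χ)

section antipode

variable (χ : Bicharacter k θ)

theorem toFun_zero_right (a : Fin θ → ℤ) : χ.toFun a 0 = 1 := by
  have := χ.map_add_right a 0 0
  rwa [add_zero, left_eq_mul] at this

theorem toFun_zero_left (a : Fin θ → ℤ) : χ.toFun 0 a = 1 := by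
  have := χ.map_add_left 0 0 a
  rwa [add_zero, left_eq_mul] at this

theorem word_cons (i : Fin θ) (l : List (Fin θ)) :
    word k (i :: l) = FreeAlgebra.ι k i * word k l := by
  simp [word]

theorem kAct_homog (i : Fin θ) {β : Fin θ → ℕ} (x : TV k θ) (hx : x ∈ homog k β) :
    kAct χ i x = (χ.toFun (simpleRoot i) (toInt β) : k) • x := by
  refine homog_ind (p := fun x => kAct χ i x = (χ.toFun (simpleRoot i) (toInt β) : k) • x)
    (by simp) (fun a b ha hb => by simp [ha, hb]) (fun c a ha => by simp [ha, smul_comm c])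
    (fun l hl => ?_) x hx
  clear hx
  subst hl
  induction l with
  | nil => simp [word, toInt_wdeg_nil, toFun_zero_right]
  | cons j l ih =>
    rw [word_cons, kAct_ι_mul, ih, toInt_wdeg_cons, χ.map_add_right, Units.val_mul,
      mul_smul_comm, smul_smul]
    rfl

theorem Linv_minus_homog (i : Fin θ) {β : Fin θ → ℕ} (x : TV k θ) (hx : x ∈ homog k β) :
    gen χ (.Linv i) * minusToBigU χ x =
      ((χ.toFun (toInt β) (simpleRoot i))⁻¹ : kˣ).val • (minusToBigU χ x * gen χ (.Linv i)) := by
  refine homog_ind (p := fun x => gen χ (.Linv i) * minusToBigU χ x =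
      ((χ.toFun (toInt β) (simpleRoot i))⁻¹ : kˣ).val • (minusToBigU χ x * gen χ (.Linv i)))
    (by simp) (fun a b ha hb => by simp only [map_add, mul_add, add_mul, ha, hb, smul_add])
    (fun c a ha => by
      simp only [map_smul, mul_smul_comm, smul_mul_assoc, ha]
      rw [smul_comm])
    (fun l hl => ?_) x hx
  clear hx
  subst hl
  induction l with
  | nil => simp [word, toInt_wdeg_nil, toFun_zero_left]
  | cons j l ih =>
    have hj : minusToBigU χ (FreeAlgebra.ι k j) = gen χ (.F j) := by simp [minusToBigU]
    have hq : ((χ.toFun (Pi.single j 1) (simpleRoot i))⁻¹ : kˣ).val = (χ.q j i)⁻¹ := by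
      simp [Bicharacter.q, simpleRoot]
    rw [word_cons, map_mul, hj, ← mul_assoc, Linv_F, smul_mul_assoc, mul_assoc, ih,
      toInt_wdeg_cons, χ.map_add_left, mul_inv, Units.val_mul, hq, mul_smul_comm, smul_smul,
      mul_assoc]

theorem homog_mul_ι (i : Fin θ) (l : List (Fin θ)) (x : TV k θ) (hx : x ∈ homog k (wdeg l)) :
    x * FreeAlgebra.ι k i ∈ homog k (wdeg (i :: l)) := by
  refine homog_ind (p := fun x => x * FreeAlgebra.ι k i ∈ homog k (wdeg (i :: l)))
    (by simp) (fun a b ha hb => by rw [add_mul]; exact add_mem ha hb)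
    (fun c a ha => by rw [smul_mul_assoc]; exact Submodule.smul_mem _ _ ha)
    (fun l' hl => ?_) x hx
  refine Submodule.subset_span ⟨l' ++ [i], ?_, by simp [word]⟩
  funext j
  have := congrFun hl j
  simp only [wdeg] at this
  simp [wdeg, List.count_cons, this]

theorem braidedAntipode_ι_mul (i : Fin θ) (x : TV k θ) :
    braidedAntipode χ (FreeAlgebra.ι k i * x) =
      -(kAct χ i (braidedAntipode χ x) * FreeAlgebra.ι k i) := by
  simp [braidedAntipode, braidedAntipodeAux]

theorem braidedAntipode_one : braidedAntipode χ 1 = 1 := by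
  simp [braidedAntipode]

theorem braidedAntipode_word (l : List (Fin θ)) :
    braidedAntipode χ (word k l) ∈ homog k (wdeg l) := by
  induction l with
  | nil => exact Submodule.subset_span ⟨[], rfl, by simp [word, braidedAntipode_one]⟩
  | cons i l ih =>
    rw [word_cons, braidedAntipode_ι_mul, kAct_homog χ i _ ih]
    exact neg_mem (homog_mul_ι i l _ (Submodule.smul_mem _ _ ih))

theorem rev_homog {β : Fin θ → ℕ} (x : TV k θ) (hx : x ∈ homog k β) : rev k θ x ∈ homog k β := by
  refine homog_ind (p := fun x => rev k θ x ∈ homog k β)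
    (by simp) (fun a b ha hb => by rw [map_add]; exact add_mem ha hb)
    (fun c a ha => by rw [map_smul]; exact Submodule.smul_mem _ _ ha)
    (fun l hl => ?_) x hx
  clear hx
  subst hl
  induction l with
  | nil => exact Submodule.subset_span ⟨[], rfl, by simp [word, rev_one]⟩
  | cons i l ih =>
    rw [word_cons, rev_mul, rev_ι]
    exact homog_mul_ι i l _ ih

theorem antipode_plus {β : Fin θ → ℕ} (x : TV k θ) (hx : x ∈ homog k β) :
    (antipodeBigU χ (plusToBigU χ x)).unop =
      powK χ (-toInt β) * plusToBigU χ (braidedAntipode χ x) := by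
  refine homog_ind (p := fun x => (antipodeBigU χ (plusToBigU χ x)).unop =
      powK χ (-toInt β) * plusToBigU χ (braidedAntipode χ x))
    (by simp) (fun a b ha hb => by simp [ha, hb, mul_add]) (fun c a ha => by simp [ha])
    (fun l hl => ?_) x hx
  clear hx
  subst hl
  induction l with
  | nil => simp [word, toInt_wdeg_nil, powK_zero, braidedAntipode_one]
  | cons i l ih =>
    have hi : plusToBigU χ (FreeAlgebra.ι k i) = gen χ (.E i) := by simp [plusToBigU]
    have hk : ∀ z, gen χ (.Kinv i) * plusToBigU χ (kAct χ i z) =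
        plusToBigU χ z * gen χ (.Kinv i) := by
      intro z
      have h := plus_kAct χ i z
      calc _ = gen χ (.Kinv i) * (plusToBigU χ (kAct χ i z) * gen χ (.K i)) * gen χ (.Kinv i) := by
            rw [mul_assoc, mul_assoc, K_Kinv, mul_one]
        _ = _ := by rw [h, ← mul_assoc, Kinv_K, one_mul]
    rw [word_cons, map_mul, map_mul, MulOpposite.unop_mul, ih, hi, antipodeBigU_gen,
      braidedAntipode_ι_mul, map_neg, map_mul, hi, powK_neg_cons, MulOpposite.unop_op]
    simp only [antipodeGen, mul_neg]
    rw [mul_assoc (powK χ _) (gen χ _), ← mul_assoc (gen χ _) (plusToBigU χ _), hk]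
    simp only [mul_assoc]

/-- The scalar `χ(β, β)⁻¹ ∏_i q_{ii}^{β_i}`. -/
def antipodeScalar (l : List (Fin θ)) : kˣ :=
  (χ.toFun (toInt (wdeg l)) (toInt (wdeg l)))⁻¹ *
    ∏ i, χ.toFun (simpleRoot i) (simpleRoot i) ^ wdeg l i

theorem antipodeScalar_cons (i : Fin θ) (l : List (Fin θ)) :
    antipodeScalar χ (i :: l) = antipodeScalar χ l *
      (χ.toFun (toInt (wdeg l)) (simpleRoot i))⁻¹ *
      (χ.toFun (simpleRoot i) (toInt (wdeg l)))⁻¹ := by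
  have h : ∏ j, χ.toFun (simpleRoot j) (simpleRoot j) ^ wdeg (i :: l) j =
      (∏ j, χ.toFun (simpleRoot j) (simpleRoot j) ^ wdeg l j) *
        χ.toFun (simpleRoot i) (simpleRoot i) := by
    have : ∀ j, χ.toFun (simpleRoot j) (simpleRoot j) ^ wdeg (i :: l) j =
        χ.toFun (simpleRoot j) (simpleRoot j) ^ wdeg l j *
          (if i = j then χ.toFun (simpleRoot j) (simpleRoot j) else 1) := by
      intro j
      by_cases hj : i = j
      · subst hj; simp [wdeg, pow_succ]
      · simp [wdeg, hj]
    simp only [this, Finset.prod_mul_distrib]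
    simp
  rw [antipodeScalar, antipodeScalar, h, toInt_wdeg_cons, ← simpleRoot, χ.map_add_left,
    χ.map_add_right, χ.map_add_right]
  simp only [mul_inv]
  generalize χ.toFun (simpleRoot i) (simpleRoot i) = a
  generalize χ.toFun (simpleRoot i) (toInt (wdeg l)) = b
  generalize χ.toFun (toInt (wdeg l)) (simpleRoot i) = c
  generalize χ.toFun (toInt (wdeg l)) (toInt (wdeg l)) = d
  generalize (∏ j, χ.toFun (simpleRoot j) (simpleRoot j) ^ wdeg l j) = e
  calc a⁻¹ * b⁻¹ * (c⁻¹ * d⁻¹) * (e * a) = a⁻¹ * a * (d⁻¹ * e * c⁻¹ * b⁻¹) := by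
        ac_rfl
    _ = _ := by simp

theorem antipode_minus_word (l : List (Fin θ)) :
    (antipodeBigU χ (minusToBigU χ (rev k θ (word k l)))).unop = (antipodeScalar χ l).val •
      (minusToBigU χ (rev k θ (braidedAntipode χ (word k l))) * powL χ (-toInt (wdeg l))) := by
  induction l with
  | nil =>
    have : antipodeScalar χ ([] : List (Fin θ)) = 1 := by
      simp [antipodeScalar, toInt_wdeg_nil, toFun_zero_left]; simp [wdeg]
    simp [word, this, toInt_wdeg_nil, powL_zero, rev_one, braidedAntipode_one]
  | cons i l ih =>
    have hi : minusToBigU χ (FreeAlgebra.ι k i) = gen χ (.F i) := by simp [minusToBigU]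
    have hz := braidedAntipode_word χ l
    have hL := Linv_minus_homog χ i _ (rev_homog _ hz)
    rw [word_cons, rev_mul, rev_ι, map_mul, map_mul, MulOpposite.unop_mul, ih, hi,
      antipodeBigU_gen, braidedAntipode_ι_mul, map_neg, rev_mul, rev_ι, map_neg, map_mul, hi,
      powL_neg_cons, MulOpposite.unop_op, kAct_homog χ i _ hz]
    simp only [antipodeGen, neg_mul, mul_smul_comm, smul_neg, map_smul, smul_mul_assoc]
    rw [mul_assoc, ← mul_assoc (gen χ (.Linv i)), hL, antipodeScalar_cons]
    simp only [smul_mul_assoc, mul_smul_comm, smul_smul, Units.val_mul, mul_assoc, Units.inv_mul,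
      mul_one]

theorem antipode_minus {β : Fin θ → ℕ} : ∃ c : k, ∀ x ∈ homog k β,
    (antipodeBigU χ (minusToBigU χ (rev k θ x))).unop =
      c • (minusToBigU χ (rev k θ (braidedAntipode χ x)) * powL χ (-toInt β)) := by
  by_cases h : ∃ l : List (Fin θ), wdeg l = β
  · obtain ⟨l₀, rfl⟩ := h
    refine ⟨(antipodeScalar χ l₀).val, fun x hx => ?_⟩
    refine homog_ind (p := fun x => (antipodeBigU χ (minusToBigU χ (rev k θ x))).unop =
      (antipodeScalar χ l₀).val •
        (minusToBigU χ (rev k θ (braidedAntipode χ x)) * powL χ (-toInt (wdeg l₀))))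
      (by simp) (fun a b ha hb => by simp [ha, hb, add_mul])
      (fun c a ha => by
        simp only [map_smul, MulOpposite.unop_smul, ha, smul_mul_assoc]
        rw [smul_comm]) (fun l hl => ?_) x hx
    rw [antipode_minus_word, antipodeScalar, antipodeScalar, hl]
  · refine ⟨0, fun x hx => ?_⟩
    have : homog k β = ⊥ := by
      rw [homog, Submodule.span_eq_bot]
      rintro _ ⟨l, hl, _⟩
      exact absurd ⟨l, hl⟩ h
    rw [this, Submodule.mem_bot] at hx
    simp [hx]

theorem map_antipode_plus (x : TV k θ) (hx : x ∈ idealPlus χ) :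
    (AlgHom.op (mkU χ)) (antipodeBigU χ (plusToBigU χ x)) = 0 := by
  suffices h : idealPlus χ ≤ LinearMap.ker ((AlgHom.op (mkU χ)).comp
      ((antipodeBigU χ).comp (plusToBigU χ))).toLinearMap from h hx
  refine sSup_le fun J hJ => ?_
  have hJle : J ≤ idealPlus χ := le_sSup hJ
  refine hJ.1.graded.trans (iSup_le fun β b hb => ?_)
  have := mkU_plus χ _ (hJle (hJ.1.antipode b hb.1))
  simp [antipode_plus χ b hb.2, this]

theorem map_antipode_minus (x : TV k θ) (hx : x ∈ idealPlus χ) :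
    (AlgHom.op (mkU χ)) (antipodeBigU χ (minusToBigU χ (rev k θ x))) = 0 := by
  suffices h : idealPlus χ ≤ LinearMap.ker (((AlgHom.op (mkU χ)).comp
      ((antipodeBigU χ).comp (minusToBigU χ))).toLinearMap.comp (rev k θ)) from h hx
  refine sSup_le fun J hJ => ?_
  have hJle : J ≤ idealPlus χ := le_sSup hJ
  refine hJ.1.graded.trans (iSup_le fun β b hb => ?_)
  have := mkU_rev χ _ (hJle (hJ.1.antipode b hb.1))
  obtain ⟨c, hc⟩ := antipode_minus χ (β := β)
  simp [hc b hb.2, this]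

end antipode

/-- The antipode of `𝔲(χ)`, as an algebra map to the opposite algebra. -/
def antipodeOpU (χ : Bicharacter k θ) : SmallU χ →ₐ[k] (SmallU χ)ᵐᵒᵖ :=
  liftU χ ((AlgHom.op (mkU χ)).comp (antipodeBigU χ)) (map_antipode_plus χ) (map_antipode_minus χ)

/-- The antipode `S : 𝔲(χ) → 𝔲(χ)`. -/
def antipodeU (χ : Bicharacter k θ) : SmallU χ →ₗ[k] SmallU χ :=
  (MulOpposite.opLinearEquiv k).symm.toLinearMap.comp (antipodeOpU χ).toLinearMap

/-! ### Highest weight modules, canonical elements and the operators on tensor products -/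

/-- The subalgebra `𝔲⁰(χ)` of `𝔲(χ)` generated by `K_i^{±1}, L_i^{±1}`. -/
def torusU (χ : Bicharacter k θ) : Subalgebra k (SmallU χ) :=
  Algebra.adjoin k {x | ∃ g : Gen θ, g.IsTorus ∧ x = mkU χ (gen χ g)}

theorem mkU_powK_mem (χ : Bicharacter k θ) (α : Fin θ → ℤ) : mkU χ (powK χ α) ∈ torusU χ := by
  have hg : ∀ g : Gen θ, g.IsTorus → mkU χ (gen χ g) ∈ torusU χ := fun g hg =>
    Algebra.subset_adjoin ⟨g, hg, rfl⟩
  have h1 : ∀ i (z : ℤ), mkU χ (powK χ (Pi.single i z)) ∈ torusU χ := by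
    intro i z
    rw [powK_single]
    obtain ⟨n, rfl | rfl⟩ := z.eq_nat_or_neg
    · rw [zpow_natCast, Units.val_pow_eq_pow_val, map_pow]
      exact pow_mem (hg _ (.K i)) n
    · rw [zpow_neg, zpow_natCast, ← inv_pow, Units.val_pow_eq_pow_val, map_pow]
      exact pow_mem (hg _ (.Kinv i)) n
  have h2 : ∀ s : Finset (Fin θ), mkU χ (powK χ (∑ i ∈ s, Pi.single i (α i))) ∈ torusU χ := by
    intro s
    induction s using Finset.induction_on with
    | empty => simp [powK_zero, one_mem]
    | insert i s hi ih => rw [Finset.sum_insert hi, powK_add, map_mul]; exact mul_mem (h1 _ _) ih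
  simpa [Finset.univ_sum_single] using h2 Finset.univ

theorem mkU_powL_mem (χ : Bicharacter k θ) (α : Fin θ → ℤ) : mkU χ (powL χ α) ∈ torusU χ := by
  have hg : ∀ g : Gen θ, g.IsTorus → mkU χ (gen χ g) ∈ torusU χ := fun g hg =>
    Algebra.subset_adjoin ⟨g, hg, rfl⟩
  have h1 : ∀ i (z : ℤ), mkU χ (powL χ (Pi.single i z)) ∈ torusU χ := by
    intro i z
    rw [powL_single]
    obtain ⟨n, rfl | rfl⟩ := z.eq_nat_or_neg
    · rw [zpow_natCast, Units.val_pow_eq_pow_val, map_pow]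
      exact pow_mem (hg _ (.L i)) n
    · rw [zpow_neg, zpow_natCast, ← inv_pow, Units.val_pow_eq_pow_val, map_pow]
      exact pow_mem (hg _ (.Linv i)) n
  have h2 : ∀ s : Finset (Fin θ), mkU χ (powL χ (∑ i ∈ s, Pi.single i (α i))) ∈ torusU χ := by
    intro s
    induction s using Finset.induction_on with
    | empty => simp [powL_zero, one_mem]
    | insert i s hi ih => rw [Finset.sum_insert hi, powL_add, map_mul]; exact mul_mem (h1 _ _) ih
  simpa [Finset.univ_sum_single] using h2 Finset.univ

/-- `K^α ∈ 𝔲⁰(χ)`. -/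
def torusK (χ : Bicharacter k θ) (α : Fin θ → ℤ) : torusU χ := ⟨mkU χ (powK χ α), mkU_powK_mem χ α⟩

/-- `L^α ∈ 𝔲⁰(χ)`. -/
def torusL (χ : Bicharacter k θ) (α : Fin θ → ℤ) : torusU χ := ⟨mkU χ (powL χ α), mkU_powL_mem χ α⟩

/-- A highest weight `𝔲(χ)`-module structure on `V`: a representation `ρ`, a vector `v` and a
character `Λ` of `𝔲⁰(χ)` with `X · v = Λ(X) v` for `X ∈ 𝔲⁰(χ)`, `V = 𝔲⁻(χ) · v` and
`E_i · v = 0`. -/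
structure HighestWeightModule (χ : Bicharacter k θ) (V : Type*) [AddCommGroup V] [Module k V] where
  /-- the representation -/
  ρ : SmallU χ →ₐ[k] Module.End k V
  /-- the highest weight vector -/
  v : V
  /-- the highest weight -/
  Λ : torusU χ →ₐ[k] k
  torus_smul : ∀ X : torusU χ, ρ (X : SmallU χ) v = Λ X • v
  generates : ∀ w : V, ∃ Y : UMinus χ, ρ (minusToU χ Y) v = w
  E_smul : ∀ i : Fin θ, ρ (mkU χ (gen χ (.E i))) v = 0

/-- Bases `(E^{(β)}_x)_x` of `𝔲⁺(χ)_β` and `(F^{(β)}_y)_y` of `𝔲⁻(χ)_{-β}`, for all `β ∈ ℕ^θ`,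
where `x` and `y` run over `m_β` indices. -/
structure HomogBases (χ : Bicharacter k θ) where
  /-- the common dimension -/
  m : (Fin θ → ℕ) → ℕ
  /-- the bases of the components of `𝔲⁺(χ)` -/
  E : ∀ β, Module.Basis (Fin (m β)) k (UPlusDeg χ β)
  /-- the bases of the components of `𝔲⁻(χ)` -/
  F : ∀ β, Module.Basis (Fin (m β)) k (UMinusDeg χ β)

/-- The matrix `[η(E^{(β)}_x, F^{(β)}_y)]_{x,y}`. -/
def gram {χ : Bicharacter k θ} (B : HomogBases χ) (β : Fin θ → ℕ) :
    Matrix (Fin (B.m β)) (Fin (B.m β)) k :=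
  Matrix.of fun x y => eta χ (B.E β x) (B.F β y)

/-- The canonical element `𝓒_β = ∑_{x,y} b_{yx} E^{(β)}_x ⊗ F^{(β)}_y`, where `b` is the inverse
of the matrix `gram B β`. -/
def canonical {χ : Bicharacter k θ} (B : HomogBases χ) (β : Fin θ → ℕ) :
    SmallU χ ⊗[k] SmallU χ :=
  ∑ x, ∑ y, (gram B β)⁻¹ y x • (plusToU χ (B.E β x) ⊗ₜ[k] minusToU χ (B.F β y))

/-- `𝓒'_β = (K^β ⊗ 1) (S ⊗ id)(𝓒_β)`. -/
def canonical' {χ : Bicharacter k θ} (B : HomogBases χ) (β : Fin θ → ℕ) :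
    SmallU χ ⊗[k] SmallU χ :=
  ((torusK χ (toInt β) : SmallU χ) ⊗ₜ[k] 1) *
    TensorProduct.map (antipodeU χ) LinearMap.id (canonical B β)

section operators

variable {χ : Bicharacter k θ}
  {V₁ : Type*} [AddCommGroup V₁] [Module k V₁] {V₂ : Type*} [AddCommGroup V₂] [Module k V₂]
  {V₃ : Type*} [AddCommGroup V₃] [Module k V₃]

/-- `ρ₁ ⊗ ρ₂ : 𝔲(χ) ⊗ 𝔲(χ) → End(V₁ ⊗ V₂)`. -/
def rep₂ (H₁ : HighestWeightModule χ V₁) (H₂ : HighestWeightModule χ V₂) :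
    SmallU χ ⊗[k] SmallU χ →ₐ[k] Module.End k (V₁ ⊗[k] V₂) :=
  Module.endTensorEndAlgHom.comp (Algebra.TensorProduct.map H₁.ρ H₂.ρ)

/-- `ρ₁ ⊗ ρ₂ ⊗ ρ₃ : 𝔲(χ) ⊗ 𝔲(χ) ⊗ 𝔲(χ) → End(V₁ ⊗ V₂ ⊗ V₃)`. -/
def rep₃ (H₁ : HighestWeightModule χ V₁) (H₂ : HighestWeightModule χ V₂)
    (H₃ : HighestWeightModule χ V₃) :
    SmallU χ ⊗[k] SmallU χ ⊗[k] SmallU χ →ₐ[k] Module.End k (V₁ ⊗[k] V₂ ⊗[k] V₃) :=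
  Module.endTensorEndAlgHom.comp (Algebra.TensorProduct.map (rep₂ H₁ H₂) H₃.ρ)

/-- `Δ ⊗ id`. -/
def comulLeft (χ : Bicharacter k θ) :
    SmallU χ ⊗[k] SmallU χ →ₗ[k] SmallU χ ⊗[k] SmallU χ ⊗[k] SmallU χ :=
  TensorProduct.map (comulU χ).toLinearMap LinearMap.id

/-- `id ⊗ Δ`. -/
def comulRight (χ : Bicharacter k θ) :
    SmallU χ ⊗[k] SmallU χ →ₗ[k] SmallU χ ⊗[k] SmallU χ ⊗[k] SmallU χ :=
  (TensorProduct.assoc k (SmallU χ) (SmallU χ) (SmallU χ)).symm.toLinearMap.comp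
    (TensorProduct.map LinearMap.id (comulU χ).toLinearMap)

/-- `F ↦ F^{(1,2)}`. -/
def leg₁₂ (V₃ : Type*) [AddCommGroup V₃] [Module k V₃] (F : Module.End k (V₁ ⊗[k] V₂)) :
    Module.End k (V₁ ⊗[k] V₂ ⊗[k] V₃) :=
  TensorProduct.map F LinearMap.id

/-- `F ↦ F^{(1,3)}`. -/
def leg₁₃ (V₂ : Type*) [AddCommGroup V₂] [Module k V₂] (F : Module.End k (V₁ ⊗[k] V₃)) :
    Module.End k (V₁ ⊗[k] V₂ ⊗[k] V₃) :=
  (TensorProduct.rightComm k V₁ V₂ V₃).symm.toLinearMap ∘ₗ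
    (TensorProduct.map F LinearMap.id : Module.End k (V₁ ⊗[k] V₃ ⊗[k] V₂)) ∘ₗ
    (TensorProduct.rightComm k V₁ V₂ V₃).toLinearMap

/-- `F ↦ F^{(2,3)}`. -/
def leg₂₃ (V₁ : Type*) [AddCommGroup V₁] [Module k V₁] (F : Module.End k (V₂ ⊗[k] V₃)) :
    Module.End k (V₁ ⊗[k] V₂ ⊗[k] V₃) :=
  (TensorProduct.assoc k V₁ V₂ V₃).symm.toLinearMap ∘ₗ
    (TensorProduct.map LinearMap.id F : Module.End k (V₁ ⊗[k] (V₂ ⊗[k] V₃))) ∘ₗ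
    (TensorProduct.assoc k V₁ V₂ V₃).toLinearMap

/-- The subspace `𝔲⁻(χ)_{-α} · v` of a highest weight module. -/
def weightPart (H₁ : HighestWeightModule χ V₁) (α : Fin θ → ℕ) : Submodule k V₁ :=
  (UMinusDeg χ α).map
    ((LinearMap.applyₗ H₁.v).comp (H₁.ρ.toLinearMap.comp (minusToU χ)))

/-- The linear map `f` is the diagonal operator `f₁₂`:
`f(X v₁ ⊗ Y v₂) = χ(β, α) Λ₁(K^{-β}) Λ₂(L^α) X v₁ ⊗ Y v₂` for all `α, β ∈ ℕ^θ`,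
`X ∈ 𝔲⁻(χ)_{-α}` and `Y ∈ 𝔲⁻(χ)_{-β}`. There is at most one such `f`. -/
def IsDiagonalOperator (H₁ : HighestWeightModule χ V₁) (H₂ : HighestWeightModule χ V₂)
    (f : Module.End k (V₁ ⊗[k] V₂)) : Prop :=
  ∀ α β : Fin θ → ℕ, ∀ X ∈ UMinusDeg χ α, ∀ Y ∈ UMinusDeg χ β,
    f (H₁.ρ (minusToU χ X) H₁.v ⊗ₜ[k] H₂.ρ (minusToU χ Y) H₂.v) =
      ((χ.toFun (toInt β) (toInt α) : k) * H₁.Λ (torusK χ (-toInt β)) *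
          H₂.Λ (torusL χ (toInt α))) •
        (H₁.ρ (minusToU χ X) H₁.v ⊗ₜ[k] H₂.ρ (minusToU χ Y) H₂.v)

/-- The operator `C₁₂ = ∑_β (ρ₁ ⊗ ρ₂)(𝓒_β)`, a sum over `ℕ^θ` with finitely many nonzero terms. -/
def opC (B : HomogBases χ) (H₁ : HighestWeightModule χ V₁) (H₂ : HighestWeightModule χ V₂) :
    Module.End k (V₁ ⊗[k] V₂) :=
  ∑ᶠ β : Fin θ → ℕ, rep₂ H₁ H₂ (canonical B β)

/-- The operator `∑_β (ρ₁ ⊗ ρ₂)((K^β ⊗ 1) (S ⊗ id)(𝓒_β))`. -/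
def opC' (B : HomogBases χ) (H₁ : HighestWeightModule χ V₁) (H₂ : HighestWeightModule χ V₂) :
    Module.End k (V₁ ⊗[k] V₂) :=
  ∑ᶠ β : Fin θ → ℕ, rep₂ H₁ H₂ (canonical' B β)

/-- The operator `R₁₂ = C₁₂ f₁₂⁻¹`. -/
def opR (B : HomogBases χ) (H₁ : HighestWeightModule χ V₁) (H₂ : HighestWeightModule χ V₂)
    (f : Module.End k (V₁ ⊗[k] V₂)) : Module.End k (V₁ ⊗[k] V₂) :=
  opC B H₁ H₂ * Ring.inverse f

end operators

end NicholsDouble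

end

open scoped TensorProduct

noncomputable section

namespace NicholsDouble

section

variable {k : Type*} [Field k] {θ : ℕ}

/-! ### Words and the grading of the tensor algebra -/

/-! Everything rests on nondegeneracy of `η`. The bilinear form `form` on `T(V)` is `η` with its
second argument transported by `rev`, and its radical is exactly `𝓘⁺` (`idealPlus_eq_ker_form`). The
form kills `𝓘⁺` because skew derivations preserve this ideal and the counit vanishes on it.
Conversely, the radical is itself a braided Hopf ideal, since multiplication by generators, the
coproduct and the antipode all have adjoints under the form, and it is trivial in degrees 0 and 1.
Hence the Gram matrices are invertible and `𝓒_β` is a tensor of dual bases: contracting its second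
factor with `η(X, ·)`, for `X` of degree `β`, returns `X` modulo `𝓘⁺`.

Consequently a tensor in `R ⊗ T(V)` is determined, once a map killing `𝓘⁻` is applied to the second
factor, by its contractions `X ↦ η(X, t)` (`pairOp_unique`). Identities for the canonical element
become identities of linear maps `T(V) → R`. Since each `E_i` lowers weights and the modules are
finite dimensional, long words in the `E_i` act by zero, so one may work with the truncation `canon
B N`.

In this dictionary a product of canonical elements is a convolution (`pairOp_mul`). The inverse of
`C` therefore comes from the braided antipode, and the factor `K^β` in the statement is what turns
the antipode of `𝔲(χ)` into the braided one (`K_mul_antipode`).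

An operator on one tensor factor may be replaced by its adjoint on the other (`pairOp_adjoint`).
Commutators of `E_i` with `𝔲⁻` and of `F_i` with `𝔲⁺` are skew derivations, whose adjoints are
multiplications by generators. This gives `C (E_i ⊗ L_i + 1 ⊗ E_i) = (E_i ⊗ K_i + 1 ⊗ E_i) C` and a
similar rule for `F_i`. The diagonal operator `f` conjugates `Δ(E_i)` into the bracket on the left,
so `R = C f⁻¹` intertwines `Δ` and `τ ∘ Δ` (`pairOp_intertwine`).

From `Δ(x) = x₁ K^{deg x₂} ⊗ x₂` one gets `(Δ ⊗ id)(𝓒)` as `C₁₃` times a copy of `C₂₃` with `K^β`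
inserted in the first leg. Both factors of `𝓒_β` have degree `β` up to sign, so `K^β` may be
attached to the `F` side instead (`pairOp_twist`), where it is produced by conjugation with `f₁₃`.
The other coproduct formula is dual.

For the Yang–Baxter equation, `R₁₂` carries `(Δ ⊗ id)(𝓒)` to its version with legs 1 and 2
exchanged. Both are known products, and the leftover diagonal factors cancel because `R₁₂` commutes
with `f₁₃ f₂₃` (`IsTriple.commute_canonOp`, `IsTriple.yangBaxter`). -/

theorem span_range_word : Submodule.span k (Set.range (word k (θ := θ))) = ⊤ := by
  refine eq_top_iff.2 fun x _ => ?_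
  induction x using tv_induction with
  | h1 => exact Submodule.subset_span ⟨[], by simp [word]⟩
  | hadd a b ha hb => exact add_mem (ha trivial) (hb trivial)
  | hsmul c a ha => exact Submodule.smul_mem _ _ (ha trivial)
  | hmul i a ha =>
    have : Submodule.span k (Set.range (word k (θ := θ))) ≤
        (Submodule.span k (Set.range (word k (θ := θ)))).comap
          (LinearMap.mulLeft k (FreeAlgebra.ι k i)) := by
      refine Submodule.span_le.2 ?_
      rintro _ ⟨l, rfl⟩
      exact Submodule.subset_span ⟨i :: l, by simp [word_cons]⟩
    exact this (ha trivial)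

theorem linearMap_ext_word {M : Type*} [AddCommGroup M] [Module k M] {f g : TV k θ →ₗ[k] M}
    (h : ∀ l, f (word k l) = g (word k l)) : f = g :=
  LinearMap.ext_on_range span_range_word h

theorem word_mem_homog (l : List (Fin θ)) : word k l ∈ homog k (wdeg l) :=
  Submodule.subset_span ⟨l, rfl, rfl⟩

theorem wdeg_cons (i : Fin θ) (l : List (Fin θ)) : wdeg (i :: l) = wdeg l + Pi.single i 1 := by
  funext j
  by_cases h : i = j
  · subst h; simp [wdeg]
  · simp [wdeg, h]

theorem ι_mul_homog (i : Fin θ) {β : Fin θ → ℕ} {x : TV k θ} (hx : x ∈ homog k β) :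
    FreeAlgebra.ι k i * x ∈ homog k (β + Pi.single i 1) := by
  suffices h : homog k β ≤ (homog k (β + Pi.single i 1)).comap
      (LinearMap.mulLeft k (FreeAlgebra.ι k i)) from h hx
  refine Submodule.span_le.2 ?_
  rintro _ ⟨l, rfl, rfl⟩
  have := word_mem_homog (k := k) (i :: l)
  rwa [wdeg_cons, word_cons] at this

/-- The projection of `T(V)` onto its homogeneous component of degree `β`. -/
def homogProj (k : Type*) [Field k] {θ : ℕ} (β : Fin θ → ℕ) : TV k θ →ₗ[k] TV k θ :=
  (FreeAlgebra.basisFreeMonoid k (Fin θ)).constr k fun l =>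
    if wdeg l.toList = β then word k l.toList else 0

theorem basisFreeMonoid_apply (l : List (Fin θ)) :
    FreeAlgebra.basisFreeMonoid k (Fin θ) (FreeMonoid.ofList l) = word k l := by
  simp [FreeAlgebra.basisFreeMonoid, FreeAlgebra.equivMonoidAlgebraFreeMonoid, word,
    MonoidAlgebra.coeffLinearEquiv]

theorem homogProj_word (β : Fin θ → ℕ) (l : List (Fin θ)) :
    homogProj k β (word k l) = if wdeg l = β then word k l else 0 := by
  rw [homogProj, ← basisFreeMonoid_apply, Module.Basis.constr_basis]
  simp only [basisFreeMonoid_apply, FreeMonoid.toList_ofList]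
  congr

theorem homogProj_mem (β : Fin θ → ℕ) (x : TV k θ) : homogProj k β x ∈ homog k β := by
  suffices h : (⊤ : Submodule k (TV k θ)) ≤ (homog k β).comap (homogProj k β) from h trivial
  rw [← span_range_word, Submodule.span_le]
  rintro _ ⟨l, rfl⟩
  simp only [Submodule.comap_coe, Set.mem_preimage, homogProj_word]
  split_ifs with h
  · rw [← h]; exact word_mem_homog l
  · exact zero_mem _

/-- Allowing every larger index set makes the condition stable under sums: the sets of two summands
are merged into their union. -/
theorem exists_sum_homogProj (x : TV k θ) :
    ∃ s : Finset (Fin θ → ℕ), ∀ t, s ⊆ t → ∑ β ∈ t, homogProj k β x = x := by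
  classical
  have hx : x ∈ Submodule.span k (Set.range (word k (θ := θ))) := by
    rw [span_range_word]; trivial
  induction hx using Submodule.span_induction with
  | mem x h =>
    obtain ⟨l, rfl⟩ := h
    refine ⟨{wdeg l}, fun t ht => ?_⟩
    have : wdeg l ∈ t := ht (by simp)
    simp [homogProj_word, this]
  | zero => exact ⟨∅, by simp⟩
  | add x y _ _ hx hy =>
    obtain ⟨s, hs⟩ := hx
    obtain ⟨t, ht⟩ := hy
    refine ⟨s ∪ t, fun u hu => ?_⟩
    simp only [map_add, Finset.sum_add_distrib]
    rw [hs u (Finset.union_subset_left hu), ht u (Finset.union_subset_right hu)]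
  | smul c x _ hx =>
    obtain ⟨s, hs⟩ := hx
    exact ⟨s, fun u hu => by simp only [map_smul, ← Finset.smul_sum, hs u hu]⟩

/-! ### Compatibilities of the braided coproduct and antipode -/

variable (χ : Bicharacter k θ)

theorem counit_kAct (i : Fin θ) (x : TV k θ) :
    braidedCounit k θ (kAct χ i x) = braidedCounit k θ x := by
  have : (braidedCounit k θ).comp (kAct χ i) = braidedCounit k θ := by
    ext; simp [braidedCounit, kAct]
  exact DFunLike.congr_fun this x

theorem counit_ι_mul (i : Fin θ) (x : TV k θ) :
    braidedCounit k θ (FreeAlgebra.ι k i * x) = 0 := by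
  simp [braidedCounit]

theorem lid_counit_comul (x : TV k θ) :
    TensorProduct.lid k (TV k θ) (LinearMap.rTensor (TV k θ) (braidedCounit k θ).toLinearMap
      (braidedComul χ x)) = x := by
  induction x using tv_induction with
  | h1 => simp [braidedComul_one]
  | hadd a b ha hb => simp [ha, hb]
  | hsmul c a ha => simp [ha]
  | hmul i a ha =>
    rw [braidedComul_ι_mul, map_add, map_add]
    conv_rhs => rw [← ha, ← zero_add (_ * _)]
    congr 1
    · generalize braidedComul χ a = t
      induction t with
      | zero => simp
      | add a b ha hb => simp only [map_add, ha, hb, add_zero]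
      | tmul a b => simp [braidedCounit]
    · generalize braidedComul χ a = t
      induction t with
      | zero => simp
      | add a b ha hb => simp only [map_add, mul_add, ha, hb]
      | tmul a b => simp [counit_kAct]

theorem negCoeff_kAct (i j : Fin θ) (x : TV k θ) :
    negCoeff k i (kAct χ j x) = χ.q j i * negCoeff k i x := by
  induction x using tv_induction with
  | h1 => simp [negCoeff]
  | hadd a b ha hb => simp [ha, hb, mul_add]
  | hsmul c a ha => simp [ha, mul_left_comm]
  | hmul l a ha =>
    rw [kAct_ι_mul, map_smul, negCoeff_ι_mul, negCoeff_ι_mul, counit_kAct]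
    split_ifs with h
    · rw [h]; simp
    · simp

/-- The skew derivation `y ↦ η(E_i, y₁) · y₂`, where `y₁ ⊗ y₂` is the braided coproduct. -/
def leftSkewDer (i : Fin θ) : TV k θ →ₗ[k] TV k θ :=
  (TensorProduct.lid k (TV k θ)).toLinearMap.comp
    ((LinearMap.rTensor (TV k θ) (negCoeff k i)).comp (braidedComul χ))

theorem leftSkewDer_one (i : Fin θ) : leftSkewDer χ i 1 = 0 := by
  simp [leftSkewDer, braidedComul_one, negCoeff]

theorem leftSkewDer_ι_mul (i j : Fin θ) (x : TV k θ) :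
    leftSkewDer χ i (FreeAlgebra.ι k j * x) =
      χ.q j i • (FreeAlgebra.ι k j * leftSkewDer χ i x) - if j = i then x else 0 := by
  rw [sub_eq_neg_add]
  simp only [leftSkewDer, LinearMap.comp_apply, LinearEquiv.coe_coe, braidedComul_ι_mul, map_add]
  congr 1
  · conv_rhs => rw [← lid_counit_comul χ x]
    generalize braidedComul χ x = t
    induction t with
    | zero => simp
    | add a b ha hb => simp only [map_add, ha, hb]; split_ifs <;> simp [add_comm]
    | tmul a b =>
      simp only [TensorProduct.map_tmul, LinearMap.rTensor_tmul, LinearMap.mulLeft_apply,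
        negCoeff_ι_mul, TensorProduct.lid_tmul, AlgHom.toLinearMap_apply, LinearMap.id_apply]
      split_ifs <;> simp
  · generalize braidedComul χ x = t
    induction t with
    | zero => simp
    | add a b ha hb => simp only [map_add, mul_add, ha, hb, smul_add]
    | tmul a b => simp [negCoeff_kAct, mul_smul]

theorem leftSkewDer_kAct (i j : Fin θ) (x : TV k θ) :
    leftSkewDer χ j (kAct χ i x) = χ.q i j • kAct χ i (leftSkewDer χ j x) := by
  induction x using tv_induction with
  | h1 => simp [leftSkewDer_one]
  | hadd a b ha hb => simp [ha, hb]
  | hsmul c a ha => simp [ha, smul_comm c]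
  | hmul l a ha =>
    rw [kAct_ι_mul, map_smul, leftSkewDer_ι_mul, leftSkewDer_ι_mul, map_sub, map_smul,
      kAct_ι_mul, ha, smul_sub, smul_sub, mul_smul_comm]
    congr 1
    · simp only [smul_smul]; congr 1; ring
    · split_ifs with h
      · rw [h]
      · simp

/-- Coassociativity in infinitesimal form: one operator pairs off the right leg of the coproduct,
the other the left leg. It lets `form_mul_ι_left` be proved by an induction that peels letters only
from the left. -/
theorem skewDer_leftSkewDer (i j : Fin θ) (x : TV k θ) :
    skewDer χ i (leftSkewDer χ j x) = leftSkewDer χ j (skewDer χ i x) := by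
  induction x using tv_induction with
  | h1 => simp [leftSkewDer_one, skewDer_one]
  | hadd a b ha hb => simp [ha, hb]
  | hsmul c a ha => simp [ha]
  | hmul l a ha =>
    rw [leftSkewDer_ι_mul, skewDer_ι_mul, map_sub, map_sub, map_smul, skewDer_ι_mul,
      leftSkewDer_ι_mul, ha, smul_sub]
    rw [apply_ite (skewDer χ i), apply_ite (leftSkewDer χ j), leftSkewDer_kAct, map_zero, map_zero]
    split_ifs with h1 h2 h2
    · subst h1; abel
    · subst h1; simp
    · simp
    · simp

/-- Both sides are minus the coefficient of `x_i`; this is the base case of `form_mul_ι_left`. -/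
theorem counit_skewDer (i : Fin θ) (x : TV k θ) :
    braidedCounit k θ (skewDer χ i x) = braidedCounit k θ (leftSkewDer χ i x) := by
  induction x using tv_induction with
  | h1 => simp [leftSkewDer_one, skewDer_one]
  | hadd a b ha hb => simp [ha, hb]
  | hsmul c a ha => simp [ha]
  | hmul l a ha =>
    rw [leftSkewDer_ι_mul, skewDer_ι_mul, map_sub, map_sub, map_smul, counit_ι_mul, counit_ι_mul]
    split_ifs <;> simp [counit_kAct]

theorem form_mul_ι_left (i : Fin θ) (x y : TV k θ) :
    form χ (x * FreeAlgebra.ι k i) y = form χ x (leftSkewDer χ i y) := by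
  induction x using tv_induction generalizing y with
  | h1 =>
    have := form_ι_mul χ i 1 y
    rw [mul_one] at this
    rw [one_mul, this, form_one, form_one, counit_skewDer]
  | hadd a b ha hb => simp [ha, hb, add_mul]
  | hsmul c a ha => simp [ha]
  | hmul j a ha => rw [mul_assoc, form_ι_mul, ha, form_ι_mul, skewDer_leftSkewDer]

theorem comul_kAct (i : Fin θ) (x : TV k θ) : braidedComul χ (kAct χ i x) =
    TensorProduct.map (kAct χ i).toLinearMap (kAct χ i).toLinearMap (braidedComul χ x) := by
  induction x using tv_induction with
  | h1 => simp [braidedComul_one]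
  | hadd a b ha hb => simp [ha, hb]
  | hsmul c a ha => simp [ha]
  | hmul j a ha =>
    rw [kAct_ι_mul, map_smul, braidedComul_ι_mul, braidedComul_ι_mul, ha, map_add, smul_add]
    generalize braidedComul χ a = t
    congr 1
    · induction t with
      | zero => simp
      | add a b ha hb => simp only [map_add, smul_add, ha, hb]
      | tmul a b => simp [kAct_ι_mul, TensorProduct.smul_tmul']
    · induction t with
      | zero => simp
      | add a b ha hb => simp only [map_add, smul_add, ha, hb]
      | tmul a b => simp [kAct_ι_mul, kAct_comm χ i j]

/-- Coassociativity with the last of three legs paired with `E_i`, the only consequence of it needed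
in `form_mul`. -/
theorem comul_skewDer (i : Fin θ) (x : TV k θ) : braidedComul χ (skewDer χ i x) =
    LinearMap.lTensor (TV k θ) (skewDer χ i) (braidedComul χ x) := by
  induction x using tv_induction with
  | h1 => simp [braidedComul_one, skewDer_one]
  | hadd a b ha hb => simp [ha, hb]
  | hsmul c a ha => simp [ha]
  | hmul j a ha =>
    rw [skewDer_ι_mul, map_sub, braidedComul_ι_mul, braidedComul_ι_mul, ha, map_add, add_sub_assoc]
    congr 1
    · generalize braidedComul χ a = t
      induction t with
      | zero => simp
      | add a b ha hb => simp only [map_add, ha, hb]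
      | tmul a b => simp
    · have : braidedComul χ (if j = i then kAct χ j a else 0) = if j = i then
        TensorProduct.map (kAct χ j).toLinearMap (kAct χ j).toLinearMap (braidedComul χ a)
          else 0 := by
        split_ifs <;> simp [comul_kAct]
      rw [this]
      generalize braidedComul χ a = t
      induction t with
      | zero => simp
      | add a b ha hb =>
        simp only [map_add, ← ha, ← hb]
        split_ifs
        · abel
        · simp
      | tmul a b =>
        simp [skewDer_ι_mul, TensorProduct.tmul_sub]
        split_ifs <;> simp

/-- The functional `a ⊗ b ↦ B(x, a) B(y, b)` on `T(V) ⊗ T(V)`. -/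
def formTensor (x y : TV k θ) : TV k θ ⊗[k] TV k θ →ₗ[k] k :=
  (LinearMap.mul' k k).comp (TensorProduct.map (form χ x) (form χ y))

@[simp]
theorem formTensor_tmul (x y a b : TV k θ) :
    formTensor χ x y (a ⊗ₜ b) = form χ x a * form χ y b := by
  simp [formTensor]

/-- The skew pairing rule for all `x`; the form was defined by its special case of a generator. The
order of `x` and `x'` is reversed because the leftmost letter is paired with the rightmost leg. -/
theorem form_mul (x x' y : TV k θ) :
    form χ (x * x') y = formTensor χ x' x (braidedComul χ y) := by
  induction x using tv_induction generalizing y with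
  | h1 =>
    rw [one_mul]
    conv_lhs => rw [← rid_counit_comul χ y]
    generalize braidedComul χ y = t
    induction t with
    | zero => simp
    | add a b ha hb => simp only [map_add, ha, hb]
    | tmul a b => simp [form_one, mul_comm]
  | hadd a b ha hb =>
    rw [add_mul, map_add, LinearMap.add_apply, ha, hb]
    generalize braidedComul χ y = t
    induction t with
    | zero => simp
    | add a b ha hb => simp only [map_add, ← ha, ← hb]; abel
    | tmul a b => simp [mul_add]
  | hsmul c a ha =>
    rw [smul_mul_assoc, map_smul, LinearMap.smul_apply, ha]
    generalize braidedComul χ y = t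
    induction t with
    | zero => simp
    | add a b ha hb => simp only [map_add, ← ha, ← hb, smul_add]
    | tmul a b => simp [mul_left_comm]
  | hmul j a ha =>
    rw [mul_assoc, form_ι_mul, ha, comul_skewDer]
    generalize braidedComul χ y = t
    induction t with
    | zero => simp
    | add a b ha hb => simp only [map_add, ha, hb]
    | tmul a b => simp [form_ι_mul]

/-! ### Self-adjointness of the braided antipode -/

theorem skewDer_mul_ι (i j : Fin θ) (x : TV k θ) :
    skewDer χ i (x * FreeAlgebra.ι k j) =
      χ.q i j • (skewDer χ i x * FreeAlgebra.ι k j) - if j = i then x else 0 := by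
  induction x using tv_induction with
  | h1 =>
    have := skewDer_ι_mul χ i j 1
    rw [mul_one] at this
    simp [this, skewDer_one]
  | hadd a b ha hb => 
    simp only [add_mul, map_add, ha, hb, smul_add]
    split_ifs
    · abel
    · simp
  | hsmul c a ha =>
    simp only [smul_mul_assoc, map_smul, ha, smul_sub]
    rw [smul_comm]; split_ifs <;> simp
  | hmul l a ha =>
    have hk : kAct χ l (a * FreeAlgebra.ι k j) = χ.q l j • (kAct χ l a * FreeAlgebra.ι k j) := by
      simp [kAct]
    rw [mul_assoc, skewDer_ι_mul, ha, skewDer_ι_mul, sub_mul, hk]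
    by_cases h1 : l = i <;> by_cases h2 : j = i <;>
      simp [h1, h2, mul_sub, smul_sub, mul_assoc]; abel

theorem braidedAntipode_kAct (i : Fin θ) (x : TV k θ) :
    braidedAntipode χ (kAct χ i x) = kAct χ i (braidedAntipode χ x) := by
  induction x using tv_induction with
  | h1 => simp [braidedAntipode_one]
  | hadd a b ha hb => simp [ha, hb]
  | hsmul c a ha => simp [ha]
  | hmul j a ha =>
    have hk : kAct χ i (FreeAlgebra.ι k j) = χ.q i j • FreeAlgebra.ι k j := by simp [kAct]
    rw [kAct_ι_mul, map_smul, braidedAntipode_ι_mul, braidedAntipode_ι_mul, ha, map_neg, map_mul,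
      hk, mul_smul_comm, smul_neg, kAct_comm]

/-- The antipode reverses words, so it exchanges removal of a letter on the right with removal on
the left; `K_i` comes from the braiding and the sign from `S(x_i) = -x_i`. -/
theorem skewDer_braidedAntipode (i : Fin θ) (x : TV k θ) :
    skewDer χ i (braidedAntipode χ x) =
      -braidedAntipode χ (kAct χ i (leftSkewDer χ i x)) := by
  induction x using tv_induction with
  | h1 => simp [braidedAntipode_one, skewDer_one, leftSkewDer_one]
  | hadd a b ha hb => simp [ha, hb, add_comm]
  | hsmul c a ha => simp [ha]
  | hmul j a ha =>
    rw [braidedAntipode_ι_mul, map_neg, skewDer_mul_ι, skewDer_kAct, ha, leftSkewDer_ι_mul]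
    simp only [map_sub, map_smul, kAct_ι_mul, braidedAntipode_ι_mul, map_neg, smul_neg, neg_mul,
      smul_mul_assoc, neg_sub, sub_neg_eq_add]
    by_cases h : j = i
    · subst h; simp [braidedAntipode_kAct]
    · simp [h, smul_smul, mul_comm]

theorem counit_braidedAntipode (x : TV k θ) :
    braidedCounit k θ (braidedAntipode χ x) = braidedCounit k θ x := by
  induction x using tv_induction with
  | h1 => simp [braidedAntipode_one]
  | hadd a b ha hb => simp [ha, hb]
  | hsmul c a ha => simp [ha]
  | hmul j a ha => rw [braidedAntipode_ι_mul]; simp [braidedCounit]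

theorem form_braidedAntipode (x y : TV k θ) :
    form χ (braidedAntipode χ x) y = form χ x (braidedAntipode χ y) := by
  induction x using tv_induction generalizing y with
  | h1 => simp [braidedAntipode_one, form_one, counit_braidedAntipode]
  | hadd a b ha hb => simp [ha, hb]
  | hsmul c a ha => simp [ha]
  | hmul j a ha =>
    rw [braidedAntipode_ι_mul, map_neg, LinearMap.neg_apply, form_mul_ι_left, form_kAct, ha,
      form_ι_mul, skewDer_braidedAntipode, map_neg]

end

section

variable {k : Type*} [Field k] {θ : ℕ}

/-! ### Contraction of tensors -/

section contract

variable {A N N' : Type*} [AddCommGroup A] [Module k A] [AddCommGroup N] [Module k N]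
  [AddCommGroup N'] [Module k N']

/-- The contraction `a ⊗ n ↦ φ(n) a`. -/
def contract (A : Type*) [AddCommGroup A] [Module k A] (φ : N →ₗ[k] k) : A ⊗[k] N →ₗ[k] A :=
  (TensorProduct.rid k A).toLinearMap.comp (LinearMap.lTensor A φ)

@[simp]
theorem contract_tmul (φ : N →ₗ[k] k) (a : A) (n : N) : contract A φ (a ⊗ₜ n) = φ n • a := by
  simp [contract]

/-- Expanding `t` along a basis of `A`, the contractions vanish coefficient by coefficient, so each
coefficient lies in the common kernel of the `P i`. This is the form in which nondegeneracy of `η`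
is applied to tensors: the second factor is controlled only modulo that common kernel. -/
theorem lTensor_eq_zero_of_contract {ι : Type*} (P : ι → N →ₗ[k] k) (g : N →ₗ[k] N')
    (hP : ∀ n, (∀ i, P i n = 0) → g n = 0) (t : A ⊗[k] N) (ht : ∀ i, contract A (P i) t = 0) :
    LinearMap.lTensor A g t = 0 := by
  let b := Module.Basis.ofVectorSpace k A
  obtain ⟨c, rfl⟩ := TensorProduct.eq_repr_basis_left b t
  have hc : ∀ j ∈ c.support, g (c j) = 0 := by
    intro j hj
    refine hP _ fun i => ?_
    have h := ht i
    simp only [Finsupp.sum, map_sum, contract_tmul] at h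
    exact linearIndependent_iff'.1 b.linearIndependent c.support (fun j => P i (c j)) h j hj
  simp only [Finsupp.sum, map_sum, LinearMap.lTensor_tmul]
  exact Finset.sum_eq_zero fun j hj => by rw [hc j hj, TensorProduct.tmul_zero]

end contract

/-! ### The radical of the form -/

/-- The span of the words that become words of degree `β` when the letter `i` is added. -/
def homogPred (k : Type*) [Field k] {θ : ℕ} (i : Fin θ) (β : Fin θ → ℕ) : Submodule k (TV k θ) :=
  Submodule.span k {x | ∃ l : List (Fin θ), wdeg (i :: l) = β ∧ x = word k l}

theorem ι_mul_homogPred (i j : Fin θ) (l : List (Fin θ)) {x : TV k θ}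
    (hx : x ∈ homogPred k i (wdeg l)) :
    FreeAlgebra.ι k j * x ∈ homogPred k i (wdeg (j :: l)) := by
  suffices h : homogPred k i (wdeg l) ≤ (homogPred k i (wdeg (j :: l))).comap
      (LinearMap.mulLeft k (FreeAlgebra.ι k j)) from h hx
  refine Submodule.span_le.2 ?_
  rintro _ ⟨l', hl, rfl⟩
  refine Submodule.subset_span ⟨j :: l', ?_, by simp [word_cons]⟩
  rw [wdeg_cons j l, ← hl]
  simp only [wdeg_cons]
  abel

theorem homogPred_le (i : Fin θ) (β : Fin θ → ℕ) :
    homogPred k i (β + Pi.single i 1) ≤ homog k β := by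
  refine Submodule.span_le.2 ?_
  rintro _ ⟨l, hl, rfl⟩
  rw [wdeg_cons] at hl
  exact Submodule.subset_span ⟨l, add_right_cancel hl, rfl⟩

/-- The condition on `i :: l` replaces the truncated difference `β - α_i`, which would give a
nonzero space here. A skew derivation by a letter absent from `β` then vanishes for degree reasons.
-/
theorem homogPred_eq_bot (i : Fin θ) {β : Fin θ → ℕ} (h : β i = 0) : homogPred k i β = ⊥ := by
  rw [homogPred, Submodule.span_eq_bot]
  rintro _ ⟨l, rfl, _⟩
  simp [wdeg] at h

variable (χ : Bicharacter k θ)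

theorem skewDer_word_mem (i : Fin θ) (l : List (Fin θ)) :
    skewDer χ i (word k l) ∈ homogPred k i (wdeg l) := by
  induction l with
  | nil => simp [word, skewDer_one]
  | cons j l ih =>
    rw [word_cons, skewDer_ι_mul]
    refine sub_mem (ι_mul_homogPred i j l ih) ?_
    split_ifs with h
    · subst h
      rw [kAct_homog χ j _ (word_mem_homog l)]
      exact Submodule.smul_mem _ _ (Submodule.subset_span ⟨l, rfl, rfl⟩)
    · exact zero_mem _

theorem leftSkewDer_word_mem (i : Fin θ) (l : List (Fin θ)) :
    leftSkewDer χ i (word k l) ∈ homogPred k i (wdeg l) := by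
  induction l with
  | nil => simp [word, leftSkewDer_one]
  | cons j l ih =>
    rw [word_cons, leftSkewDer_ι_mul]
    refine sub_mem (Submodule.smul_mem _ _ (ι_mul_homogPred i j l ih)) ?_
    split_ifs with h
    · subst h
      exact Submodule.subset_span ⟨l, rfl, rfl⟩
    · exact zero_mem _

theorem skewDer_mem_homogPred (i : Fin θ) {β : Fin θ → ℕ} {x : TV k θ} (hx : x ∈ homog k β) :
    skewDer χ i x ∈ homogPred k i β := by
  suffices h : homog k β ≤ (homogPred k i β).comap (skewDer χ i) from h hx
  refine Submodule.span_le.2 ?_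
  rintro _ ⟨l, rfl, rfl⟩
  exact skewDer_word_mem χ i l

theorem leftSkewDer_mem_homogPred (i : Fin θ) {β : Fin θ → ℕ} {x : TV k θ} (hx : x ∈ homog k β) :
    leftSkewDer χ i x ∈ homogPred k i β := by
  suffices h : homog k β ≤ (homogPred k i β).comap (leftSkewDer χ i) from h hx
  refine Submodule.span_le.2 ?_
  rintro _ ⟨l, rfl, rfl⟩
  exact leftSkewDer_word_mem χ i l

/-! ### Orthogonality of the homogeneous components -/

theorem form_word_of_wdeg_ne (l l' : List (Fin θ)) (h : wdeg l ≠ wdeg l') :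
    form χ (word k l) (word k l') = 0 := by
  induction l generalizing l' with
  | nil =>
    match l', h with
    | [], h => exact absurd rfl h
    | j :: l', _ => simp [word, form_one, braidedCounit]
  | cons i l ih =>
    rw [word_cons, form_ι_mul]
    suffices hle : homogPred k i (wdeg l') ≤ LinearMap.ker (form χ (word k l)) from
      hle (skewDer_word_mem χ i l')
    refine Submodule.span_le.2 ?_
    rintro _ ⟨l'', hl, rfl⟩
    refine ih l'' fun h' => h ?_
    rw [← hl, wdeg_cons, wdeg_cons, h']

theorem form_homog_of_ne {β γ : Fin θ → ℕ} (h : β ≠ γ) {x y : TV k θ} (hx : x ∈ homog k β)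
    (hy : y ∈ homog k γ) : form χ x y = 0 := by
  have h1 : ∀ l, wdeg l = β → homog k γ ≤ LinearMap.ker (form χ (word k l)) := by
    rintro l rfl
    refine Submodule.span_le.2 ?_
    rintro _ ⟨l', rfl, rfl⟩
    exact form_word_of_wdeg_ne χ l l' h
  suffices h2 : homog k β ≤ LinearMap.ker ((form χ).flip y) from h2 hx
  refine Submodule.span_le.2 ?_
  rintro _ ⟨l, hl, rfl⟩
  exact h1 l hl hy

/-- Self-adjoint projections preserve the radical, which is therefore graded. -/
theorem form_homogProj (β : Fin θ → ℕ) (x y : TV k θ) :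
    form χ (homogProj k β x) y = form χ x (homogProj k β y) := by
  suffices h : (form χ).comp (homogProj k β) = (form χ).compl₂ (homogProj k β) from
    LinearMap.congr_fun₂ h x y
  refine linearMap_ext_word fun l => linearMap_ext_word fun l' => ?_
  simp only [LinearMap.comp_apply, LinearMap.compl₂_apply, homogProj_word]
  by_cases h : wdeg l = wdeg l'
  · rw [h]; split_ifs <;> simp
  · split_ifs <;> simp [form_word_of_wdeg_ne χ l l' h]

theorem exists_smul_word_of_mem_homog {β : Fin θ → ℕ} {l : List (Fin θ)}
    (hβ : ∀ l', wdeg l' = β → l' = l) {x : TV k θ} (hx : x ∈ homog k β) :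
    ∃ c : k, c • word k l = x := by
  refine Submodule.mem_span_singleton.1 (Submodule.span_mono ?_ hx)
  rintro _ ⟨l', hl, rfl⟩
  rw [hβ l' hl]; rfl

/-- In total degree below two there is at most one word of each multidegree, and it pairs with
itself to `1` or `-1`. This secures the degree condition that the definition of `𝓘⁺` imposes on its
competitors. -/
theorem eq_zero_of_mem_ker_form {β : Fin θ → ℕ} (hβ : ∑ i, β i < 2) {x : TV k θ}
    (hx : x ∈ LinearMap.ker (form χ)) (hx' : x ∈ homog k β) : x = 0 := by
  by_cases h : ∃ l : List (Fin θ), wdeg l = β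
  · obtain ⟨l, rfl⟩ := h
    rw [← length_eq_sum_wdeg] at hβ
    match l, hβ with
    | [], _ =>
      obtain ⟨c, rfl⟩ := exists_smul_word_of_mem_homog (l := []) (fun l' hl => by
        have := length_eq_sum_wdeg l'
        rw [hl, ← length_eq_sum_wdeg] at this
        exact List.eq_nil_of_length_eq_zero this) hx'
      have := LinearMap.congr_fun (LinearMap.mem_ker.1 hx) 1
      simp only [word, List.map_nil, List.prod_nil, map_smul, LinearMap.smul_apply, form_one,
        map_one, LinearMap.zero_apply, smul_eq_mul, mul_one] at this
      rw [this, zero_smul]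
    | [i], _ =>
      obtain ⟨c, rfl⟩ := exists_smul_word_of_mem_homog (l := [i]) (fun l' hl => by
        have h1 : l'.Perm [i] := List.perm_iff_count.2 fun j => congrFun hl j
        exact List.perm_singleton.1 h1) hx'
      have := LinearMap.congr_fun (LinearMap.mem_ker.1 hx) (FreeAlgebra.ι k i)
      simp only [word, List.map_cons, List.map_nil, List.prod_cons, List.prod_nil, mul_one,
        map_smul, LinearMap.smul_apply, form_ι_ι, if_true,
        LinearMap.zero_apply, smul_eq_mul, mul_neg, neg_eq_zero] at this
      rw [this, zero_smul]
  · have : homog k β = ⊥ := by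
      rw [homog, Submodule.span_eq_bot]
      rintro _ ⟨l, hl, _⟩
      exact absurd ⟨l, hl⟩ h
    rwa [this, Submodule.mem_bot] at hx'

theorem ker_form_graded :
    LinearMap.ker (form χ) ≤ ⨆ β : Fin θ → ℕ, LinearMap.ker (form χ) ⊓ homog k β := by
  intro x hx
  obtain ⟨s, hs⟩ := exists_sum_homogProj x
  rw [← hs s subset_rfl]
  refine sum_mem fun β _ => Submodule.mem_iSup_of_mem β ⟨?_, homogProj_mem β x⟩
  ext1 y
  rw [form_homogProj, LinearMap.mem_ker.1 hx]
  rfl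

theorem ker_form_isBraidedHopfIdeal : IsBraidedHopfIdeal χ (LinearMap.ker (form χ)) where
  mul_left a x hx := by
    induction a using tv_induction with
    | h1 => simpa using hx
    | hadd a b ha hb => rw [add_mul]; exact add_mem ha hb
    | hsmul c a ha => rw [smul_mul_assoc]; exact Submodule.smul_mem _ _ ha
    | hmul i a ha =>
      ext1 y
      rw [mul_assoc, form_ι_mul, LinearMap.mem_ker.1 ha]
      rfl
  mul_right a x hx := by
    suffices h : ∀ x ∈ LinearMap.ker (form χ), x * a ∈ LinearMap.ker (form χ) from h x hx
    clear x hx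
    induction a using FreeAlgebra.induction with
    | grade0 r =>
      intro x hx
      rw [← Algebra.commutes, ← Algebra.smul_def]
      exact Submodule.smul_mem _ _ hx
    | grade1 i =>
      intro x hx
      ext1 y
      rw [form_mul_ι_left, LinearMap.mem_ker.1 hx]
      rfl
    | mul a b ha hb => intro x hx; rw [← mul_assoc]; exact hb _ (ha _ hx)
    | add a b ha hb => intro x hx; rw [mul_add]; exact add_mem (ha _ hx) (hb _ hx)
  graded := ker_form_graded χ
  counit x hx := by rw [← form_one χ, form_symm, LinearMap.mem_ker.1 hx]; rfl
  comul x hx := by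
    -- With `π` the quotient by the radical, the required subspace is the kernel of `π ⊗ π`, so it
    -- remains to see that contractions of `(π ⊗ π)(Δ x)` vanish.
    have hker := TensorProduct.map_ker
      (LinearMap.exact_subtype_mkQ (LinearMap.ker (form χ))) (Submodule.mkQ_surjective _)
      (LinearMap.exact_subtype_mkQ (LinearMap.ker (form χ))) (Submodule.mkQ_surjective _)
    rw [sup_comm]
    change _ ∈ LinearMap.range (LinearMap.lTensor _ _) ⊔ LinearMap.range (LinearMap.rTensor _ _)
    rw [← hker, LinearMap.mem_ker]
    have h1 : ∀ a, contract _ (form χ a) (LinearMap.rTensor (TV k θ)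
        (LinearMap.ker (form χ)).mkQ (braidedComul χ x)) = 0 := by
      intro a
      have h2 : contract _ (form χ a) (LinearMap.rTensor (TV k θ)
        (LinearMap.ker (form χ)).mkQ (braidedComul χ x)) =
          (LinearMap.ker (form χ)).mkQ (contract _ (form χ a) (braidedComul χ x)) := by
        generalize braidedComul χ x = t
        induction t with
        | zero => simp
        | add a b ha hb => simp only [map_add, ha, hb]
        | tmul a b => simp
      rw [h2, Submodule.mkQ_apply, Submodule.Quotient.mk_eq_zero]
      ext1 b
      -- Contracting the second leg of `Δ x` against `a` and then pairing with `b` gives `B(ab, x)`,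
      -- which is zero.
      have h3 := form_mul χ a b x
      rw [form_symm, LinearMap.mem_ker.1 hx, LinearMap.zero_apply] at h3
      rw [LinearMap.zero_apply, form_symm, h3]
      generalize braidedComul χ x = t
      induction t with
      | zero => simp
      | add a b ha hb => simp only [map_add, ha, hb]
      | tmul a b => simp [mul_comm]
    have := lTensor_eq_zero_of_contract (fun a => form χ a) (LinearMap.ker (form χ)).mkQ
      (fun n hn => by
        rw [Submodule.mkQ_apply, Submodule.Quotient.mk_eq_zero]
        ext1 b
        rw [form_symm, hn]; rfl) _ h1
    rwa [← LinearMap.comp_apply, LinearMap.lTensor_comp_rTensor] at this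
  antipode x hx := by
    ext1 y
    rw [form_braidedAntipode, LinearMap.mem_ker.1 hx]
    rfl

/-- The ideal `𝓘⁺(χ)` is the radical of the form. -/
theorem idealPlus_eq_ker_form : idealPlus χ = LinearMap.ker (form χ) := by
  -- The second inclusion is maximality of `𝓘⁺`: the radical is a braided Hopf ideal whose nonzero
  -- components have total degree at least two.
  refine le_antisymm (fun x hx => ?_) (le_sSup ⟨ker_form_isBraidedHopfIdeal χ, ?_⟩)
  · ext1 y
    rw [form_symm, form_idealPlus_right χ y x hx]; rfl
  · refine (ker_form_graded χ).trans (iSup_le fun β => ?_)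
    by_cases h : 2 ≤ ∑ i, β i
    · exact inf_le_right.trans (le_iSup₂_of_le β h le_rfl)
    · intro x hx
      rw [eq_zero_of_mem_ker_form χ (not_le.1 h) hx.1 hx.2]
      exact zero_mem _

theorem mem_idealPlus_iff {x : TV k θ} : x ∈ idealPlus χ ↔ ∀ y, form χ x y = 0 := by
  rw [idealPlus_eq_ker_form, LinearMap.mem_ker, LinearMap.ext_iff]; rfl

theorem etaFree_apply (x y : TV k θ) : etaFree χ x y = form χ x (rev k θ y) := rfl

theorem mem_idealMinus_iff {y : TV k θ} : y ∈ idealMinus χ ↔ ∀ x, etaFree χ x y = 0 := by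
  constructor
  · rintro ⟨z, hz, rfl⟩ x
    rw [etaFree_apply, rev_rev, form_idealPlus_right χ x z hz]
  · intro h
    refine ⟨rev k θ y, (mem_idealPlus_iff χ).2 fun x => ?_, rev_rev y⟩
    rw [form_symm]; exact h x

theorem eta_mk (x y : TV k θ) :
    eta χ ((idealPlus χ).mkQ x) ((idealMinus χ).mkQ y) = etaFree χ x y := rfl

theorem etaFree_homog_of_ne {β γ : Fin θ → ℕ} (h : β ≠ γ) {x y : TV k θ} (hx : x ∈ homog k β)
    (hy : y ∈ homog k γ) : etaFree χ x y = 0 :=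
  form_homog_of_ne χ h hx (rev_homog y hy)

/-- A vector in the left kernel yields an element of `𝔲⁺_β` orthogonal to `𝔲⁻_{-β}`, hence to
everything by orthogonality of degrees. A lift of it lies in the radical, so the element is zero.
Injectivity suffices because both bases are indexed by the same finite set. -/
theorem isUnit_gram {χ : Bicharacter k θ} (B : HomogBases χ) (β : Fin θ → ℕ) :
    IsUnit (gram B β) := by
  rw [← Matrix.vecMul_injective_iff_isUnit]
  refine (injective_iff_map_eq_zero (Matrix.vecMulLinear (gram B β))).2 fun v hv => ?_
  have hX : ∑ x, v x • B.E β x = 0 := by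
    obtain ⟨a, ha, haX⟩ := (∑ x, v x • B.E β x).2
    have h1 : ∀ y : UMinusDeg χ β, eta χ (∑ x, v x • B.E β x : UPlusDeg χ β) y = 0 := by
      intro y
      have h2 : ((eta χ (∑ x, v x • B.E β x : UPlusDeg χ β)).comp
          (UMinusDeg χ β).subtype) = 0 := by
        refine (B.F β).ext fun j => ?_
        have := congrFun hv j
        simpa [Matrix.vecMul, dotProduct, gram] using this
      exact LinearMap.congr_fun h2 y
    have h3 : a ∈ idealPlus χ := by
      refine (mem_idealPlus_iff χ).2 fun z => ?_
      obtain ⟨s, hs⟩ := exists_sum_homogProj z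
      rw [← hs s subset_rfl, map_sum]
      refine Finset.sum_eq_zero fun γ _ => ?_
      by_cases h : β = γ
      · subst h
        have := h1 ⟨_, Submodule.mem_map_of_mem (rev_homog _ (homogProj_mem β z))⟩
        rw [← haX] at this
        rw [← rev_rev (homogProj k β z)]
        exact this
      · exact form_homog_of_ne χ h ha (homogProj_mem γ z)
    apply Subtype.ext
    rw [← haX]
    exact (Submodule.Quotient.mk_eq_zero _).2 h3
  funext x
  exact linearIndependent_iff'.1 (B.E β).linearIndependent Finset.univ v hX x (Finset.mem_univ _)

/-! ### Braided antipode axioms -/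

theorem mul_id_antipode_comul (x : TV k θ) :
    LinearMap.mul' k (TV k θ) (TensorProduct.map LinearMap.id (braidedAntipode χ)
      (braidedComul χ x)) = algebraMap k _ (braidedCounit k θ x) := by
  induction x using tv_induction with
  | h1 => simp [braidedComul_one, braidedAntipode_one]
  | hadd a b ha hb => simp [ha, hb]
  | hsmul c a ha =>
    rw [map_smul, map_smul, map_smul, ha, map_smul, smul_eq_mul, map_mul, Algebra.smul_def]
  | hmul i a ha =>
    -- If `m` denotes the value attached to `t`, the two terms of the coproduct contribute `x_i m -
    -- (K_i · m) x_i`. By induction `m` is a scalar, and the difference vanishes.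
    have h1 : ∀ t : TV k θ ⊗[k] TV k θ,
        LinearMap.mul' k (TV k θ) (TensorProduct.map LinearMap.id (braidedAntipode χ)
          (TensorProduct.map (LinearMap.mulLeft k (FreeAlgebra.ι k i)) LinearMap.id t +
          TensorProduct.map (kAct χ i).toLinearMap (LinearMap.mulLeft k (FreeAlgebra.ι k i)) t)) =
        FreeAlgebra.ι k i * LinearMap.mul' k (TV k θ) (TensorProduct.map LinearMap.id
          (braidedAntipode χ) t) - kAct χ i (LinearMap.mul' k (TV k θ)
          (TensorProduct.map LinearMap.id (braidedAntipode χ) t)) * FreeAlgebra.ι k i := by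
      intro t
      induction t with
      | zero => simp
      | add a b ha hb =>
        simp only [map_add, mul_add, add_mul] at ha hb ⊢
        rw [add_sub_add_comm, ← ha, ← hb]; abel
      | tmul a b => simp [braidedAntipode_ι_mul, mul_assoc, sub_eq_add_neg]
    rw [braidedComul_ι_mul, h1, ha, counit_ι_mul]
    simp [Algebra.commutes]

/-- Unlike for the other axiom, the two terms of the coproduct of `x_i a` cancel already on each
simple tensor, so the value at `a` plays no role. -/
theorem mul_antipode_id_comul (x : TV k θ) :
    LinearMap.mul' k (TV k θ) (TensorProduct.map (braidedAntipode χ) LinearMap.id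
      (braidedComul χ x)) = algebraMap k _ (braidedCounit k θ x) := by
  induction x using tv_induction with
  | h1 => simp [braidedComul_one, braidedAntipode_one]
  | hadd a b ha hb => simp [ha, hb]
  | hsmul c a ha =>
    rw [map_smul, map_smul, map_smul, ha, map_smul, smul_eq_mul, map_mul, Algebra.smul_def]
  | hmul i a ha =>
    rw [braidedComul_ι_mul, counit_ι_mul]
    generalize braidedComul χ a = t
    induction t with
    | zero => simp
    | add a b ha hb =>
      simp only [map_add, map_zero] at ha hb ⊢
      rw [add_add_add_comm, ha, hb, add_zero]
    | tmul a b => simp [braidedAntipode_ι_mul, braidedAntipode_kAct, mul_assoc]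

end

section

variable {k : Type*} [Field k] {θ : ℕ} {χ : Bicharacter k θ}

/-! ### Lifts of the canonical elements to the tensor algebra -/

section lifts

variable (B : HomogBases χ) (β : Fin θ → ℕ)

/-- A homogeneous lift of `E^{(β)}_x` to `T(V)`. -/
def liftE (x : Fin (B.m β)) : TV k θ := (B.E β x).2.choose

theorem liftE_mem (x : Fin (B.m β)) : liftE B β x ∈ homog k β := (B.E β x).2.choose_spec.1

theorem mkQ_liftE (x : Fin (B.m β)) : (idealPlus χ).mkQ (liftE B β x) = B.E β x :=
  (B.E β x).2.choose_spec.2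

/-- A homogeneous lift of `F^{(β)}_y` to `T(V)`. -/
def liftF (y : Fin (B.m β)) : TV k θ := (B.F β y).2.choose

theorem liftF_mem (y : Fin (B.m β)) : liftF B β y ∈ homog k β := (B.F β y).2.choose_spec.1

theorem mkQ_liftF (y : Fin (B.m β)) : (idealMinus χ).mkQ (liftF B β y) = B.F β y :=
  (B.F β y).2.choose_spec.2

/-- A lift of `𝓒_β` to `T(V) ⊗ T(V)`. -/
def canonDeg : TV k θ ⊗[k] TV k θ :=
  ∑ x, ∑ y, (gram B β)⁻¹ y x • (liftE B β x ⊗ₜ[k] liftF B β y)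

/-- The algebra map `𝓤⁺(χ) → 𝔲(χ)`. -/
def plusHom (χ : Bicharacter k θ) : TV k θ →ₐ[k] SmallU χ := (mkU χ).comp (plusToBigU χ)

/-- The algebra map `𝓤⁻(χ) → 𝔲(χ)`. -/
def minusHom (χ : Bicharacter k θ) : TV k θ →ₐ[k] SmallU χ := (mkU χ).comp (minusToBigU χ)

theorem canonical_eq : canonical B β =
    TensorProduct.map (plusHom χ).toLinearMap (minusHom χ).toLinearMap (canonDeg B β) := by
  simp only [canonical, canonDeg, map_sum, map_smul, TensorProduct.map_tmul, ← mkQ_liftE,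
    ← mkQ_liftF]
  rfl

/-- The reproducing property of dual bases, checked on the basis vectors `E^{(β)}_x`. -/
theorem mkQ_contract_canonDeg {X : TV k θ} (hX : X ∈ homog k β) :
    (idealPlus χ).mkQ (contract _ (etaFree χ X) (canonDeg B β)) = (idealPlus χ).mkQ X := by
  let G : UPlusDeg χ β →ₗ[k] UPlus χ := ∑ x, ∑ y, (gram B β)⁻¹ y x •
    ((((eta χ).flip (B.F β y)).comp (UPlusDeg χ β).subtype).smulRight (B.E β x : UPlus χ))
  have hG : G = (UPlusDeg χ β).subtype := by
    refine (B.E β).ext fun x' => ?_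
    -- Invertibility is essential: the inverse of a singular matrix is zero by convention.
    have hu : gram B β * (gram B β)⁻¹ = 1 :=
      Matrix.mul_nonsing_inv _ ((Matrix.isUnit_iff_isUnit_det _).1 (isUnit_gram B β))
    have h1 : ∀ x, ∑ y, (gram B β)⁻¹ y x • (eta χ (B.E β x') (B.F β y) • (B.E β x : UPlus χ)) =
        (if x' = x then (1 : k) else 0) • (B.E β x : UPlus χ) := by
      intro x
      rw [← Matrix.one_apply, ← hu, Matrix.mul_apply, Finset.sum_smul]
      refine Finset.sum_congr rfl fun y _ => ?_
      rw [smul_smul, mul_comm]; rfl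
    simp [G, h1]
  have := LinearMap.congr_fun hG ⟨_, Submodule.mem_map_of_mem hX⟩
  change _ = (idealPlus χ).mkQ X at this
  rw [← this]
  simp only [canonDeg, map_sum, map_smul, contract_tmul, G, LinearMap.sum_apply,
    LinearMap.smul_apply, LinearMap.smulRight_apply, LinearMap.comp_apply, LinearMap.flip_apply,
    Submodule.subtype_apply, ← mkQ_liftF, mkQ_liftE, eta_mk]

theorem contract_canonDeg_of_ne {γ : Fin θ → ℕ} (h : γ ≠ β) {X : TV k θ} (hX : X ∈ homog k γ) :
    contract _ (etaFree χ X) (canonDeg B β) = 0 := by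
  simp [canonDeg, etaFree_homog_of_ne χ h hX (liftF_mem B β _)]

end lifts

/-! ### Truncated canonical elements and maps vanishing in high degree -/

theorem finite_setOf_sum_le (N : ℕ) : {β : Fin θ → ℕ | ∑ i, β i ≤ N}.Finite := by
  refine (Set.finite_Iic (fun _ : Fin θ => N)).subset fun β hβ i => ?_
  exact (Finset.single_le_sum (fun _ _ => Nat.zero_le _) (Finset.mem_univ i)).trans hβ

/-- The sum of the lifts of the `𝓒_β` with `|β| ≤ N`. -/
def canon (B : HomogBases χ) (N : ℕ) : TV k θ ⊗[k] TV k θ :=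
  ∑ β ∈ (finite_setOf_sum_le N).toFinset, canonDeg B β

variable {R : Type*} [Ring R] [Algebra k R]

/-- A linear map on `T(V)` that factors through `𝔲⁺(χ)` and vanishes in degrees above `N`. -/
structure IsAdmissible (χ : Bicharacter k θ) (N : ℕ) (e : TV k θ →ₗ[k] R) : Prop where
  ideal : ∀ x ∈ idealPlus χ, e x = 0
  nil : ∀ l : List (Fin θ), N < l.length → e (word k l) = 0

theorem IsAdmissible.homog {N : ℕ} {e : TV k θ →ₗ[k] R} (he : IsAdmissible χ N e)
    {β : Fin θ → ℕ} (hβ : N < ∑ i, β i) {x : TV k θ} (hx : x ∈ homog k β) : e x = 0 := by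
  suffices h : NicholsDouble.homog k β ≤ LinearMap.ker e from h hx
  refine Submodule.span_le.2 ?_
  rintro _ ⟨l, rfl, rfl⟩
  exact he.nil l (by rwa [length_eq_sum_wdeg])

theorem IsAdmissible.mono {N N' : ℕ} (h : N ≤ N') {e : TV k θ →ₗ[k] R}
    (he : IsAdmissible χ N e) : IsAdmissible χ N' e :=
  ⟨he.ideal, fun l hl => he.nil l (h.trans_lt hl)⟩

theorem IsAdmissible.map_canonDeg {N : ℕ} {e : TV k θ →ₗ[k] R} (he : IsAdmissible χ N e)
    {M : Type*} [AddCommGroup M] [Module k M] (f : TV k θ →ₗ[k] M)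
    (B : HomogBases χ) {β : Fin θ → ℕ} (hβ : N < ∑ i, β i) :
    TensorProduct.map e f (canonDeg B β) = 0 := by
  simp [canonDeg, he.homog hβ (liftE_mem B β _)]

/-- The linear map `X ↦ η(X, y) a` attached to `a ⊗ y`. -/
def etaContract (χ : Bicharacter k θ) (R : Type*) [AddCommGroup R] [Module k R] :
    R ⊗[k] TV k θ →ₗ[k] TV k θ →ₗ[k] R :=
  TensorProduct.lift (LinearMap.mk₂ k (fun a y => ((etaFree χ).flip y).smulRight a)
    (fun a b y => by ext1 X; simp) (fun c a y => by
      ext1 X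
      simp only [LinearMap.smulRight_apply, LinearMap.smul_apply]
      exact smul_comm _ _ _)
    (fun a y z => by ext1 X; simp [add_smul]) (fun c a y => by ext1 X; simp [mul_smul]))

@[simp]
theorem etaContract_tmul (a : R) (y X : TV k θ) :
    etaContract χ R (a ⊗ₜ y) X = etaFree χ X y • a := by
  simp [etaContract]

theorem etaContract_apply (t : R ⊗[k] TV k θ) (X : TV k θ) :
    etaContract χ R t X = contract R (etaFree χ X) t := by
  induction t with
  | zero => simp
  | add a b ha hb => simp only [map_add, LinearMap.add_apply, ha, hb]
  | tmul a b => simp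

theorem etaContract_map (e : TV k θ →ₗ[k] R) (t : TV k θ ⊗[k] TV k θ) (X : TV k θ) :
    etaContract χ R (TensorProduct.map e LinearMap.id t) X = e (contract _ (etaFree χ X) t) := by
  induction t with
  | zero => simp
  | add a b ha hb => simp only [map_add, LinearMap.add_apply, ha, hb]
  | tmul a b => simp

/-- On a word `l` only the component of degree `wdeg l` contributes, and it reproduces the word
modulo `𝓘⁺`, which `e` kills. Truncation loses nothing because `e` vanishes on words longer than
`N`. -/
theorem etaContract_canon (B : HomogBases χ) {N : ℕ} {e : TV k θ →ₗ[k] R}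
    (he : IsAdmissible χ N e) :
    etaContract χ R (TensorProduct.map e LinearMap.id (canon B N)) = e := by
  refine linearMap_ext_word fun l => ?_
  rw [etaContract_map, canon, map_sum, map_sum]
  have h0 : ∀ β, β ≠ wdeg l →
      e (contract _ (etaFree χ (word k l)) (canonDeg B β)) = 0 := fun β h => by
    rw [contract_canonDeg_of_ne B β h.symm (word_mem_homog l), map_zero]
  have h1 : e (contract _ (etaFree χ (word k l)) (canonDeg B (wdeg l))) = e (word k l) := by
    have := (Submodule.Quotient.eq _).1 (mkQ_contract_canonDeg B _ (word_mem_homog (k := k) l))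
    rw [← sub_eq_zero, ← map_sub, he.ideal _ this]
  by_cases hl : l.length ≤ N
  · rw [Finset.sum_eq_single (wdeg l) (fun β _ h => h0 β h), h1]
    intro h
    simp [← length_eq_sum_wdeg, hl] at h
  · rw [he.nil l (not_le.1 hl)]
    refine Finset.sum_eq_zero fun β hβ => h0 β ?_
    rintro rfl
    simp [← length_eq_sum_wdeg, hl] at hβ

/-! ### Operators defined by the canonical element -/

/-- The image of the canonical element under `a ⊗ b ↦ e(a) f(b)`. -/
def pairOp (B : HomogBases χ) (N : ℕ) (e f : TV k θ →ₗ[k] R) : R :=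
  LinearMap.mul' k R (TensorProduct.map e f (canon B N))

/-- Components with `|β| > N` contribute zero. The support is thus finite, so `finsum` does not take
its default value. -/
theorem finsum_canonDeg (B : HomogBases χ) {N : ℕ} {e : TV k θ →ₗ[k] R}
    (he : IsAdmissible χ N e) (f : TV k θ →ₗ[k] R) :
    ∑ᶠ β, LinearMap.mul' k R (TensorProduct.map e f (canonDeg B β)) = pairOp B N e f := by
  rw [pairOp, canon, map_sum, map_sum]
  refine finsum_eq_sum_of_support_subset _ fun β hβ => ?_
  by_contra h
  refine hβ ?_
  dsimp only
  rw [he.map_canonDeg f B (by simpa using h), map_zero]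

/-- Two tensors with the same contractions differ by an element of `R ⊗ 𝓘⁻`, which `f` kills. The
convolution, adjoint and counit rules follow by exhibiting a tensor `t` with the right contraction.
-/
theorem pairOp_unique (B : HomogBases χ) {N : ℕ} {e f : TV k θ →ₗ[k] R}
    (he : IsAdmissible χ N e) (hf : ∀ y ∈ idealMinus χ, f y = 0) {t : R ⊗[k] TV k θ}
    (ht : etaContract χ R t = e) :
    LinearMap.mul' k R (LinearMap.lTensor R f t) = pairOp B N e f := by
  have h : LinearMap.lTensor R f (t - TensorProduct.map e LinearMap.id (canon B N)) = 0 := by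
    refine lTensor_eq_zero_of_contract (fun X => etaFree χ X) f
      (fun y hy => hf y ((mem_idealMinus_iff χ).2 hy)) _ fun X => ?_
    rw [← etaContract_apply, map_sub, etaContract_canon B he, ht, sub_self, LinearMap.zero_apply]
  rw [map_sub, sub_eq_zero] at h
  rw [h, pairOp, ← LinearMap.comp_apply (LinearMap.lTensor R f), LinearMap.lTensor_comp_map]
  rfl

/-! ### Products of canonical elements -/

theorem etaFree_mul (X y y' : TV k θ) : etaFree χ X (y * y') =
    formTensor χ (rev k θ y) (rev k θ y') (braidedComul χ X) := by
  rw [etaFree_apply, rev_mul, form_symm, form_mul]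

theorem etaContract_mul (s t : R ⊗[k] TV k θ) (X : TV k θ) :
    etaContract χ R (s * t) X = LinearMap.mul' k R
      (TensorProduct.map (etaContract χ R s) (etaContract χ R t) (braidedComul χ X)) := by
  induction s with
  | zero => simp
  | add a b ha hb =>
    simp only [add_mul, map_add, LinearMap.add_apply, ha, hb, TensorProduct.map_add_left]
  | tmul a y =>
    induction t with
    | zero => simp
    | add a b ha hb =>
      simp only [mul_add, map_add, LinearMap.add_apply, ha, hb, TensorProduct.map_add_right]
    | tmul a' y' =>
      rw [Algebra.TensorProduct.tmul_mul_tmul, etaContract_tmul, etaFree_mul]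
      generalize braidedComul χ X = u
      induction u with
      | zero => simp
      | add a b ha hb => simp only [map_add, add_smul, ha, hb]
      | tmul u v =>
        simp [etaFree_apply, smul_smul, form_symm χ u, form_symm χ v, mul_comm]

theorem mul'_lTensor_mul (f : TV k θ →ₐ[k] R) (s : R ⊗[k] TV k θ) (e : TV k θ →ₗ[k] R)
    (hc : ∀ x y, Commute (e x) (f y)) (t : TV k θ ⊗[k] TV k θ) :
    LinearMap.mul' k R (LinearMap.lTensor R f.toLinearMap
        (s * TensorProduct.map e LinearMap.id t)) =
      LinearMap.mul' k R (LinearMap.lTensor R f.toLinearMap s) *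
        LinearMap.mul' k R (TensorProduct.map e f.toLinearMap t) := by
  induction s with
  | zero => simp
  | add a b ha hb => simp only [map_add, add_mul, ha, hb]
  | tmul a y =>
    induction t with
    | zero => simp
    | add a b ha hb => simp only [map_add, mul_add, ha, hb]
    | tmul x y' =>
      simp only [TensorProduct.map_tmul, Algebra.TensorProduct.tmul_mul_tmul, LinearMap.id_apply,
        LinearMap.lTensor_tmul, AlgHom.toLinearMap_apply, map_mul, LinearMap.mul'_apply]
      rw [mul_assoc a, ← mul_assoc (e x), (hc x y).eq]
      simp only [mul_assoc]

/-- The product of the canonical elements in the second tensor factor is given by convolution. -/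
theorem pairOp_mul (B : HomogBases χ) {N : ℕ} {e e' e'' : TV k θ →ₗ[k] R} (f : TV k θ →ₐ[k] R)
    (he : IsAdmissible χ N e) (he' : IsAdmissible χ N e') (he'' : IsAdmissible χ N e'')
    (hf : ∀ y ∈ idealMinus χ, f y = 0) (hc : ∀ x y, Commute (e' x) (f y))
    (h : ∀ X, LinearMap.mul' k R (TensorProduct.map e e' (braidedComul χ X)) = e'' X) :
    pairOp B N e f.toLinearMap * pairOp B N e' f.toLinearMap = pairOp B N e'' f.toLinearMap := by
  -- The representing tensor is the product taken in `R ⊗ T(V)`. Its contraction is a convolution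
  -- because `η(X, y y') = η(X₁, y) η(X₂, y')`.
  rw [← pairOp_unique B he'' hf (t := TensorProduct.map e LinearMap.id (canon B N) *
    TensorProduct.map e' LinearMap.id (canon B N)), mul'_lTensor_mul f _ e' hc]
  · rw [← LinearMap.comp_apply (LinearMap.lTensor R _), LinearMap.lTensor_comp_map]
    rfl
  · ext1 X
    rw [etaContract_mul, etaContract_canon B he, etaContract_canon B he', h]

/-- Applying `P` to the second factor changes the contraction at `X` from `e(X)` to `e(Q X)`. This
is how derivations on one side become multiplications on the other. -/
theorem pairOp_adjoint (B : HomogBases χ) {N : ℕ} {e f : TV k θ →ₗ[k] R}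
    {P Q : TV k θ →ₗ[k] TV k θ} (he : IsAdmissible χ N e) (heQ : IsAdmissible χ N (e.comp Q))
    (hf : ∀ y ∈ idealMinus χ, f y = 0) (h : ∀ X y, etaFree χ X (P y) = etaFree χ (Q X) y) :
    pairOp B N e (f.comp P) = pairOp B N (e.comp Q) f := by
  rw [← pairOp_unique B heQ hf (t := TensorProduct.map e P (canon B N))]
  · rw [← LinearMap.comp_apply (LinearMap.lTensor R _), LinearMap.lTensor_comp_map]
    rfl
  · ext1 X
    have : ∀ t, etaContract χ R (TensorProduct.map e P t) X =
        etaContract χ R (TensorProduct.map e LinearMap.id t) (Q X) := by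
      intro t
      induction t with
      | zero => simp
      | add a b ha hb => simp only [map_add, LinearMap.add_apply, ha, hb]
      | tmul a b => simp [h]
    rw [this, etaContract_canon B he]
    rfl

/-- The functional `a ⊗ b ↦ η(X, a) η(X', b)`. -/
def etaTensor (χ : Bicharacter k θ) (X X' : TV k θ) : TV k θ ⊗[k] TV k θ →ₗ[k] k :=
  (LinearMap.mul' k k).comp (TensorProduct.map (etaFree χ X) (etaFree χ X'))

@[simp]
theorem etaTensor_tmul (X X' a b : TV k θ) :
    etaTensor χ X X' (a ⊗ₜ b) = etaFree χ X a * etaFree χ X' b := by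
  simp [etaTensor]

/-- Nondegeneracy for two factors at once: the one-factor statement is applied to the second leg,
and then to the first. -/
theorem map_eq_zero_of_etaTensor {f f' : TV k θ →ₗ[k] R} (hf : ∀ y ∈ idealMinus χ, f y = 0)
    (hf' : ∀ y ∈ idealMinus χ, f' y = 0) (t : TV k θ ⊗[k] TV k θ)
    (ht : ∀ X X', etaTensor χ X X' t = 0) : TensorProduct.map f f' t = 0 := by
  rw [← LinearMap.lTensor_comp_rTensor, LinearMap.comp_apply]
  refine lTensor_eq_zero_of_contract (fun X => etaFree χ X) f'
      (fun y hy => hf' y ((mem_idealMinus_iff χ).2 hy)) _ fun X' => ?_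
  have h1 : contract R (etaFree χ X') (LinearMap.rTensor _ f t) =
      f (contract _ (etaFree χ X') t) := by
    generalize t = t
    induction t with
    | zero => simp
    | add a b ha hb => simp only [map_add, ha, hb]
    | tmul a b => simp
  rw [h1]
  refine hf _ ((mem_idealMinus_iff χ).2 fun X => ?_)
  rw [← ht X X']
  generalize t = t
  induction t with
  | zero => simp
  | add a b ha hb => simp only [map_add, ha, hb]
  | tmul a b => simp [mul_comm]

/-- The braided coproduct `y ↦ y₂ ⊗ y₁` of `𝓤⁻(χ)`. -/
def comulRev (χ : Bicharacter k θ) : TV k θ →ₗ[k] TV k θ ⊗[k] TV k θ :=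
  (TensorProduct.map (rev k θ) (rev k θ)).comp
    ((TensorProduct.comm k _ _).toLinearMap.comp ((braidedComul χ).comp (rev k θ)))

theorem etaTensor_comulRev (X X' y : TV k θ) :
    etaTensor χ X X' (comulRev χ y) = etaFree χ (X * X') y := by
  rw [etaFree_apply, form_mul]
  simp only [comulRev, LinearMap.comp_apply, LinearEquiv.coe_coe]
  generalize braidedComul χ (rev k θ y) = t
  induction t with
  | zero => simp
  | add a b ha hb => simp only [map_add, ha, hb]
  | tmul a b => simp [etaFree_apply, rev_rev, mul_comm]

/-- The product of the canonical elements in the first tensor factor is given by the coproduct of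
the second one. -/
theorem pairOp_mul_comulRev (B : HomogBases χ) {N : ℕ} (e : TV k θ →ₐ[k] R)
    {f f' : TV k θ →ₗ[k] R} (he : IsAdmissible χ N e.toLinearMap)
    (hf : ∀ y ∈ idealMinus χ, f y = 0) (hf' : ∀ y ∈ idealMinus χ, f' y = 0)
    (hc : ∀ x y, Commute (f y) (e x)) :
    pairOp B N e.toLinearMap f * pairOp B N e.toLinearMap f' =
      pairOp B N e.toLinearMap
        ((LinearMap.mul' k R).comp ((TensorProduct.map f f').comp (comulRev χ))) := by
  let w : (TV k θ ⊗[k] TV k θ) ⊗[k] (TV k θ ⊗[k] TV k θ) →ₗ[k] R ⊗[k] (TV k θ ⊗[k] TV k θ) :=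
    (TensorProduct.map ((LinearMap.mul' k R).comp (TensorProduct.map e.toLinearMap e.toLinearMap))
      LinearMap.id).comp (TensorProduct.tensorTensorTensorComm k _ _ _ _).toLinearMap
  let c : TV k θ ⊗[k] TV k θ →ₗ[k] R ⊗[k] (TV k θ ⊗[k] TV k θ) :=
    TensorProduct.map e.toLinearMap (comulRev χ)
  let m : R ⊗[k] (TV k θ ⊗[k] TV k θ) →ₗ[k] R :=
    (LinearMap.mul' k R).comp (LinearMap.lTensor R
      ((LinearMap.mul' k R).comp (TensorProduct.map f f')))
  -- Both sides come from `R ⊗ T(V) ⊗ T(V)`. Contraction with `η(X, ·) η(X', ·)` gives `e(X) e(X')`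
  -- for one and `e(X X')` for the other, and `e` is multiplicative.
  have h0 : m (w (canon B N ⊗ₜ canon B N) - c (canon B N)) = 0 := by
    have := lTensor_eq_zero_of_contract (fun X : TV k θ × TV k θ => etaTensor χ X.1 X.2)
      ((LinearMap.mul' k R).comp (TensorProduct.map f f'))
      (fun t ht => by
        rw [LinearMap.comp_apply, map_eq_zero_of_etaTensor hf hf' t fun X X' => ht (X, X'),
          map_zero]) (w (canon B N ⊗ₜ canon B N) - c (canon B N)) (fun ⟨X, X'⟩ => ?_)
    · simp only [m, LinearMap.comp_apply] at this ⊢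
      rw [this, map_zero]
    have h1 : ∀ s t, contract R (etaTensor χ X X') (w (s ⊗ₜ t)) =
        etaContract χ R (TensorProduct.map e.toLinearMap LinearMap.id s) X *
          etaContract χ R (TensorProduct.map e.toLinearMap LinearMap.id t) X' := by
      intro s t
      induction s with
      | zero => simp
      | add a b ha hb => simp only [map_add, TensorProduct.add_tmul, add_mul, LinearMap.add_apply, ha, hb]
      | tmul x y =>
        induction t with
        | zero => simp
        | add a b ha hb => simp only [map_add, TensorProduct.tmul_add, mul_add, LinearMap.add_apply, ha, hb]
        | tmul x' y' => simp [w, smul_smul, mul_comm]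
    have h2 : ∀ t, contract R (etaTensor χ X X') (c t) =
        etaContract χ R (TensorProduct.map e.toLinearMap LinearMap.id t) (X * X') := by
      intro t
      induction t with
      | zero => simp
      | add a b ha hb => simp only [map_add, LinearMap.add_apply, ha, hb]
      | tmul x y => simp [c, etaTensor_comulRev]
    rw [map_sub, h1, h2, etaContract_canon B he]
    simp
  have h3 : ∀ s t, m (w (s ⊗ₜ t)) = LinearMap.mul' k R (TensorProduct.map e.toLinearMap f s) *
      LinearMap.mul' k R (TensorProduct.map e.toLinearMap f' t) := by
    intro s t
    induction s with
    | zero => simp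
    | add a b ha hb => simp only [map_add, TensorProduct.add_tmul, add_mul, ha, hb]
    | tmul x y =>
      induction t with
      | zero => simp
      | add a b ha hb => simp only [map_add, TensorProduct.tmul_add, mul_add, ha, hb]
      | tmul x' y' =>
        simp only [w, m, TensorProduct.map_tmul, AlgHom.toLinearMap_apply, LinearMap.comp_apply,
          LinearEquiv.coe_coe, TensorProduct.tensorTensorTensorComm_tmul, LinearMap.id_apply,
          LinearMap.lTensor_tmul, LinearMap.mul'_apply]
        rw [mul_assoc (e x), ← mul_assoc (e x'), ← (hc x' y).eq]
        simp only [mul_assoc]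
  rw [map_sub, sub_eq_zero, h3] at h0
  simp only [pairOp]
  rw [h0]
  simp only [m, c, LinearMap.comp_apply]
  rw [← LinearMap.comp_apply (LinearMap.lTensor R _), LinearMap.lTensor_comp_map]
  rfl

/-! ### Conjugating and twisting canonical elements -/

theorem algHom_mul_eq_mul {e e' : TV k θ →ₐ[k] R} {g : R}
    (h : ∀ i, e (FreeAlgebra.ι k i) * g = g * e' (FreeAlgebra.ι k i)) (x : TV k θ) :
    e x * g = g * e' x := by
  induction x using tv_induction with
  | h1 => simp
  | hadd a b ha hb => simp [add_mul, mul_add, ha, hb]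
  | hsmul c a ha => simp [ha]
  | hmul i a ha => rw [map_mul, map_mul, mul_assoc, ha, ← mul_assoc, h, mul_assoc]

theorem algHom_commute {e : TV k θ →ₐ[k] R} {g : R}
    (h : ∀ i, Commute (e (FreeAlgebra.ι k i)) g) (x : TV k θ) : Commute (e x) g :=
  algHom_mul_eq_mul (e' := e) (fun i => (h i).eq) x

theorem pairOp_conj (B : HomogBases χ) (N : ℕ) {e e' f f' : TV k θ →ₐ[k] R} {g : R}
    (he : ∀ i, e (FreeAlgebra.ι k i) * g = g * e' (FreeAlgebra.ι k i))
    (hf : ∀ i, f (FreeAlgebra.ι k i) * g = g * f' (FreeAlgebra.ι k i)) :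
    pairOp B N e.toLinearMap f.toLinearMap * g =
      g * pairOp B N e'.toLinearMap f'.toLinearMap := by
  simp only [pairOp]
  generalize canon B N = t
  induction t with
  | zero => simp
  | add a b ha hb => simp only [map_add, add_mul, mul_add, ha, hb]
  | tmul a b =>
    simp only [TensorProduct.map_tmul, AlgHom.toLinearMap_apply, LinearMap.mul'_apply]
    rw [mul_assoc, algHom_mul_eq_mul hf, ← mul_assoc, algHom_mul_eq_mul he, mul_assoc]

theorem algHom_word_eq_prod_mul {e e' : TV k θ →ₐ[k] R} {z : Fin θ → R}
    (he : ∀ i, e' (FreeAlgebra.ι k i) = z i * e (FreeAlgebra.ι k i))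
    (hz : ∀ i j, Commute (z i) (e (FreeAlgebra.ι k j))) (l : List (Fin θ)) :
    e' (word k l) = (l.map z).prod * e (word k l) := by
  induction l with
  | nil => simp [word]
  | cons i l ih =>
    have : Commute (l.map z).prod (e (FreeAlgebra.ι k i)) := by
      refine Commute.list_prod_left _ _ fun x hx => ?_
      obtain ⟨j, _, rfl⟩ := List.mem_map.1 hx
      exact hz j i
    rw [word_cons, map_mul, map_mul, ih, he, List.map_cons, List.prod_cons, mul_assoc,
      ← mul_assoc (e _), ← this.eq]
    simp only [mul_assoc]

/-- Commuting factors can be moved from one tensor factor of the canonical element to the other. -/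
theorem pairOp_twist (B : HomogBases χ) (N : ℕ) {e e' f f' : TV k θ →ₐ[k] R} {z : Fin θ → R}
    (hz : ∀ i j, Commute (z i) (z j)) (hze : ∀ i j, Commute (z i) (e (FreeAlgebra.ι k j)))
    (hzf : ∀ i j, Commute (z i) (f (FreeAlgebra.ι k j)))
    (he : ∀ i, e' (FreeAlgebra.ι k i) = z i * e (FreeAlgebra.ι k i))
    (hf : ∀ i, f' (FreeAlgebra.ι k i) = z i * f (FreeAlgebra.ι k i)) :
    pairOp B N e'.toLinearMap f.toLinearMap = pairOp B N e.toLinearMap f'.toLinearMap := by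
  -- The two factors of `canonDeg` have equal degree. One factor `z i` per letter therefore gives
  -- the same product on either side, up to a reordering that is harmless since the `z i` commute.
  have h1 : ∀ l l' : List (Fin θ), wdeg l = wdeg l' →
      e' (word k l) * f (word k l') = e (word k l) * f' (word k l') := by
    intro l l' h
    have hp : l.Perm l' := List.perm_iff_count.2 fun j => congrFun h j
    have hprod : (l.map z).prod = (l'.map z).prod := by
      refine (hp.map z).prod_eq' ?_
      refine List.pairwise_of_forall_mem_list fun a ha b hb => ?_
      obtain ⟨i, _, rfl⟩ := List.mem_map.1 ha
      obtain ⟨j, _, rfl⟩ := List.mem_map.1 hb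
      exact hz i j
    have hcomm : Commute (l'.map z).prod (e (word k l)) := by
      refine Commute.list_prod_left _ _ fun x hx => ?_
      obtain ⟨j, _, rfl⟩ := List.mem_map.1 hx
      exact (algHom_commute (fun i => (hze j i).symm) _).symm
    rw [algHom_word_eq_prod_mul he hze, algHom_word_eq_prod_mul hf hzf, hprod, hcomm.eq, mul_assoc]
  have h2 : ∀ (β : Fin θ → ℕ) (x y : TV k θ), x ∈ homog k β → y ∈ homog k β →
      e' x * f y = e x * f' y := by
    intro β x y hx hy
    refine homog_ind (p := fun x => e' x * f y = e x * f' y) (by simp)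
      (fun a b ha hb => by simp [add_mul, ha, hb]) (fun c a ha => by simp [ha])
      (fun l hl => ?_) x hx
    refine homog_ind (p := fun y => e' (word k l) * f y = e (word k l) * f' y) (by simp)
      (fun a b ha hb => by simp [mul_add, ha, hb]) (fun c a ha => by simp [ha])
      (fun l' hl' => h1 l l' (hl.trans hl'.symm)) y hy
  simp only [pairOp, canon, canonDeg, map_sum, map_smul, TensorProduct.map_tmul,
    AlgHom.toLinearMap_apply, LinearMap.mul'_apply, h2 _ _ _ (liftE_mem B _ _) (liftF_mem B _ _)]

end

section

variable {k : Type*} [Field k] {θ : ℕ} {χ : Bicharacter k θ}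

/-! ### Commutators with the canonical element -/

section commutators

variable {R : Type*} [Ring R] [Algebra k R]

theorem IsAdmissible.comp {N : ℕ} {e : TV k θ →ₗ[k] R} (he : IsAdmissible χ N e) {R' : Type*}
    [Ring R'] [Algebra k R'] (φ : R →ₗ[k] R') : IsAdmissible χ N (φ.comp e) :=
  ⟨fun x hx => by simp [he.ideal x hx], fun l hl => by simp [he.nil l hl]⟩

theorem idealPlus_isBraidedHopfIdeal : IsBraidedHopfIdeal χ (idealPlus χ) := by
  rw [idealPlus_eq_ker_form]; exact ker_form_isBraidedHopfIdeal χ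

/-- Since `𝓘⁺` is the radical, it is preserved by the adjoint of any operator, here of right
multiplication by `x_i`. -/
theorem leftSkewDer_mem_idealPlus (i : Fin θ) {x : TV k θ} (hx : x ∈ idealPlus χ) :
    leftSkewDer χ i x ∈ idealPlus χ := by
  refine (mem_idealPlus_iff χ).2 fun y => ?_
  rw [form_symm, ← form_mul_ι_left, form_idealPlus_right χ _ x hx]

theorem word_append_singleton (l : List (Fin θ)) (i : Fin θ) :
    word k (l ++ [i]) = word k l * FreeAlgebra.ι k i := by
  simp [word]

theorem IsAdmissible.mulLeft {N : ℕ} {e : TV k θ →ₗ[k] R} (he : IsAdmissible χ N e) (i : Fin θ) :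
    IsAdmissible χ N (e.comp (LinearMap.mulLeft k (FreeAlgebra.ι k i))) :=
  ⟨fun x hx => he.ideal _ (idealPlus_isBraidedHopfIdeal.mul_left _ x hx), fun l hl => by
    have := he.nil (i :: l) (by simp; lia)
    simpa [word_cons] using this⟩

theorem IsAdmissible.mulRight {N : ℕ} {e : TV k θ →ₗ[k] R} (he : IsAdmissible χ N e) (i : Fin θ) :
    IsAdmissible χ N (e.comp (LinearMap.mulRight k (FreeAlgebra.ι k i))) :=
  ⟨fun x hx => he.ideal _ (idealPlus_isBraidedHopfIdeal.mul_right _ x hx), fun l hl => by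
    have := he.nil (l ++ [i]) (by simp; lia)
    simpa [word_append_singleton] using this⟩

theorem IsAdmissible.homogPred {N : ℕ} {e : TV k θ →ₗ[k] R} (he : IsAdmissible χ N e)
    (i : Fin θ) {l : List (Fin θ)} (hl : N + 1 < l.length) {x : TV k θ}
    (hx : x ∈ homogPred k i (wdeg l)) : e x = 0 := by
  suffices h : NicholsDouble.homogPred k i (wdeg l) ≤ LinearMap.ker e from h hx
  refine Submodule.span_le.2 ?_
  rintro _ ⟨l', hl', rfl⟩
  refine he.nil l' ?_
  have : (i :: l').length = l.length := by rw [length_eq_sum_wdeg, hl', length_eq_sum_wdeg]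
  simp only [List.length_cons] at this
  lia

/-- The bound grows by one: a word of length `N + 1` is sent into the span of words of length `N`,
on which `e` need not vanish. -/
theorem IsAdmissible.skewDer {N : ℕ} {e : TV k θ →ₗ[k] R} (he : IsAdmissible χ N e) (i : Fin θ) :
    IsAdmissible χ (N + 1) (e.comp (skewDer χ i)) :=
  ⟨fun _ hx => he.ideal _ (skewDer_idealPlus χ i hx),
    fun l hl => he.homogPred i hl (skewDer_word_mem χ i l)⟩

theorem IsAdmissible.leftSkewDer {N : ℕ} {e : TV k θ →ₗ[k] R} (he : IsAdmissible χ N e)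
    (i : Fin θ) : IsAdmissible χ (N + 1) (e.comp (leftSkewDer χ i)) :=
  ⟨fun _ hx => he.ideal _ (leftSkewDer_mem_idealPlus i hx),
    fun l hl => he.homogPred i hl (leftSkewDer_word_mem χ i l)⟩

/-- Commuting `g` past the `F` side produces the two skew derivations. Their adjoints are left and
right multiplication by `x_i` on the `E` side, which put `e(x_i)` to the left and to the right of
the canonical operator. It is used with `g = 1 ⊗ E_i`, `κ = 1 ⊗ K_i`, `l = 1 ⊗ L_i`. -/
theorem pairOp_commutator_left (B : HomogBases χ) {N : ℕ} (e f : TV k θ →ₐ[k] R) (i : Fin θ)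
    {g κ l : R} (he : IsAdmissible χ N e.toLinearMap) (hf : ∀ y ∈ idealMinus χ, f y = 0)
    (hge : ∀ x, Commute (e x) g) (hκe : ∀ x, Commute (e x) κ)
    (hef : ∀ y, Commute (e (FreeAlgebra.ι k i)) (f y))
    (h : ∀ y, g * f y = f y * g - κ * f (rev k θ (skewDer χ i (rev k θ y))) +
      f (rev k θ (leftSkewDer χ i (rev k θ y))) * l) :
    g * pairOp B N e.toLinearMap f.toLinearMap =
      pairOp B N e.toLinearMap f.toLinearMap * g -
        κ * e (FreeAlgebra.ι k i) * pairOp B N e.toLinearMap f.toLinearMap +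
        pairOp B N e.toLinearMap f.toLinearMap * e (FreeAlgebra.ι k i) * l := by
  have h1 : g * pairOp B N e.toLinearMap f.toLinearMap =
      pairOp B N e.toLinearMap f.toLinearMap * g -
      κ * pairOp B N e.toLinearMap
        (f.toLinearMap.comp ((rev k θ).comp ((skewDer χ i).comp (rev k θ)))) +
      pairOp B N e.toLinearMap
        (f.toLinearMap.comp ((rev k θ).comp ((leftSkewDer χ i).comp (rev k θ)))) * l := by
    simp only [pairOp]
    generalize canon B N = t
    induction t with
    | zero => simp
    | add a b ha hb => simp only [map_add, add_mul, mul_add, ha, hb]; abel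
    | tmul a b =>
      simp only [TensorProduct.map_tmul, AlgHom.toLinearMap_apply, LinearMap.mul'_apply,
        LinearMap.comp_apply]
      rw [← mul_assoc, ← (hge a).eq, mul_assoc, h, ← mul_assoc κ, ← (hκe a).eq]
      simp only [mul_add, mul_sub, mul_assoc]
  have h2 : pairOp B N (e.toLinearMap.comp (LinearMap.mulLeft k (FreeAlgebra.ι k i)))
      f.toLinearMap = e (FreeAlgebra.ι k i) * pairOp B N e.toLinearMap f.toLinearMap := by
    simp only [pairOp]
    generalize canon B N = t
    induction t with
    | zero => simp
    | add a b ha hb => simp only [map_add, mul_add, ha, hb]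
    | tmul a b => simp [mul_assoc]
  have h3 : pairOp B N (e.toLinearMap.comp (LinearMap.mulRight k (FreeAlgebra.ι k i)))
      f.toLinearMap = pairOp B N e.toLinearMap f.toLinearMap * e (FreeAlgebra.ι k i) := by
    simp only [pairOp]
    generalize canon B N = t
    induction t with
    | zero => simp
    | add a b ha hb => simp only [map_add, add_mul, ha, hb]
    | tmul a b => simp [mul_assoc, (hef b).eq]
  rw [h1, pairOp_adjoint B he (he.mulLeft i) hf, pairOp_adjoint B he (he.mulRight i) hf, h2, h3,
    mul_assoc κ]
  · intro X y
    simp [etaFree_apply, rev_rev, form_mul_ι_left]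
  · intro X y
    simp [etaFree_apply, rev_rev, form_ι_mul]

/-- Mirror image of `pairOp_commutator_left`: derivations on the `E` side are traded for
multiplications on the `F` side. The truncation is at `N + 1` because composing with a derivation
raises the vanishing bound by one. -/
theorem pairOp_commutator_right (B : HomogBases χ) {N : ℕ} (e f : TV k θ →ₐ[k] R) (i : Fin θ)
    {g κ l : R} (he : IsAdmissible χ N e.toLinearMap) (hf : ∀ y ∈ idealMinus χ, f y = 0)
    (hgf : ∀ y, Commute (f y) g) (hκf : ∀ y, Commute (f y) κ)
    (hef : ∀ x, Commute (e x) (f (FreeAlgebra.ι k i)))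
    (h : ∀ x, e x * g = g * e x - e (skewDer χ i x) * κ + l * e (leftSkewDer χ i x)) :
    pairOp B (N + 1) e.toLinearMap f.toLinearMap * g =
      g * pairOp B (N + 1) e.toLinearMap f.toLinearMap -
        pairOp B (N + 1) e.toLinearMap f.toLinearMap * f (FreeAlgebra.ι k i) * κ +
        l * f (FreeAlgebra.ι k i) * pairOp B (N + 1) e.toLinearMap f.toLinearMap := by
  have h1 : pairOp B (N + 1) e.toLinearMap f.toLinearMap * g =
      g * pairOp B (N + 1) e.toLinearMap f.toLinearMap -
      pairOp B (N + 1) (e.toLinearMap.comp (skewDer χ i)) f.toLinearMap * κ +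
      l * pairOp B (N + 1) (e.toLinearMap.comp (leftSkewDer χ i)) f.toLinearMap := by
    simp only [pairOp]
    generalize canon B (N + 1) = t
    induction t with
    | zero => simp
    | add a b ha hb => simp only [map_add, add_mul, mul_add, ha, hb]; abel
    | tmul a b =>
      simp only [TensorProduct.map_tmul, AlgHom.toLinearMap_apply, LinearMap.mul'_apply,
        LinearMap.comp_apply]
      rw [mul_assoc, (hgf b).eq, ← mul_assoc, h, mul_assoc _ _ κ, (hκf b).eq]
      simp only [add_mul, sub_mul, mul_assoc]
  have h2 : pairOp B (N + 1) e.toLinearMap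
      (f.toLinearMap.comp (LinearMap.mulRight k (FreeAlgebra.ι k i))) =
      pairOp B (N + 1) e.toLinearMap f.toLinearMap * f (FreeAlgebra.ι k i) := by
    simp only [pairOp]
    generalize canon B (N + 1) = t
    induction t with
    | zero => simp
    | add a b ha hb => simp only [map_add, add_mul, ha, hb]
    | tmul a b => simp [mul_assoc]
  have h3 : pairOp B (N + 1) e.toLinearMap
      (f.toLinearMap.comp (LinearMap.mulLeft k (FreeAlgebra.ι k i))) =
      f (FreeAlgebra.ι k i) * pairOp B (N + 1) e.toLinearMap f.toLinearMap := by
    simp only [pairOp]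
    generalize canon B (N + 1) = t
    induction t with
    | zero => simp
    | add a b ha hb => simp only [map_add, mul_add, ha, hb]
    | tmul a b => simp [← mul_assoc, (hef a).eq]
  rw [h1, ← pairOp_adjoint B (he.mono N.le_succ) (he.skewDer i) hf
    (P := LinearMap.mulRight k (FreeAlgebra.ι k i)), ← pairOp_adjoint B (he.mono N.le_succ)
    (he.leftSkewDer i) hf (P := LinearMap.mulLeft k (FreeAlgebra.ι k i)), h2, h3, mul_assoc l]
  · intro X y
    simp only [etaFree_apply, LinearMap.mulLeft_apply, rev_mul, rev_ι]
    rw [form_symm, form_mul_ι_left, form_symm]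
  · intro X y
    simp only [etaFree_apply, LinearMap.mulRight_apply, rev_mul, rev_ι, form_mul_ι]

end commutators

/-! ### Commutation relations in `𝓤(χ)` -/

section relations

variable (χ)

theorem plusToBigU_ι (i : Fin θ) : plusToBigU χ (FreeAlgebra.ι k i) = gen χ (.E i) := by
  simp [plusToBigU]

theorem minusToBigU_ι (i : Fin θ) : minusToBigU χ (FreeAlgebra.ι k i) = gen χ (.F i) := by
  simp [minusToBigU]

theorem F_K (i j : Fin θ) :
    gen χ (.F j) * gen χ (.K i) = χ.q i j • (gen χ (.K i) * gen χ (.F j)) := by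
  rw [K_F, smul_smul, mul_inv_cancel₀ (q_ne_zero χ i j), one_smul]

theorem E_L (i j : Fin θ) :
    gen χ (.E j) * gen χ (.L i) = χ.q j i • (gen χ (.L i) * gen χ (.E j)) := by
  rw [L_E, smul_smul, mul_inv_cancel₀ (q_ne_zero χ j i), one_smul]

theorem minus_K (i : Fin θ) (x : TV k θ) : minusToBigU χ (rev k θ x) * gen χ (.K i) =
    gen χ (.K i) * minusToBigU χ (rev k θ (kAct χ i x)) := by
  induction x using tv_induction with
  | h1 => simp [rev_one]
  | hadd a b ha hb => simp [add_mul, mul_add, ha, hb]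
  | hsmul c a ha => simp [ha]
  | hmul j a ha =>
    rw [kAct_ι_mul, map_smul, map_smul, rev_mul, rev_mul, map_mul, map_mul, rev_ι, minusToBigU_ι,
      mul_assoc, F_K, mul_smul_comm, ← mul_assoc, ha, mul_smul_comm, mul_assoc]

/-- Moving `E_i` through the letters leaves `K_i - L_i` at each `F_i`. Collecting `K_i` on the far
left and `L_i` on the far right turns the accumulated scalars into the two skew derivations. -/
theorem E_mul_minus (i : Fin θ) (x : TV k θ) :
    gen χ (.E i) * minusToBigU χ (rev k θ x) = minusToBigU χ (rev k θ x) * gen χ (.E i) -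
      gen χ (.K i) * minusToBigU χ (rev k θ (skewDer χ i x)) +
      minusToBigU χ (rev k θ (leftSkewDer χ i x)) * gen χ (.L i) := by
  induction x using tv_induction with
  | h1 => simp [rev_one, skewDer_one, leftSkewDer_one]
  | hadd a b ha hb => simp only [map_add, add_mul, mul_add, ha, hb]; abel
  | hsmul c a ha => simp only [map_smul, smul_mul_assoc, mul_smul_comm, ha, smul_add, smul_sub]
  | hmul j a ha =>
    have hEF : gen χ (.E i) * gen χ (.F j) = gen χ (.F j) * gen χ (.E i) +
        if i = j then gen χ (.K i) - gen χ (.L i) else 0 := by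
      rw [← E_F]; abel
    rw [skewDer_ι_mul, leftSkewDer_ι_mul]
    simp only [map_sub, map_smul, rev_mul, rev_ι, map_mul, minusToBigU_ι]
    rw [← mul_assoc, ha, add_mul, sub_mul, mul_assoc _ (gen χ (.L i)), L_F, mul_assoc _ _ (gen χ (.F j)),
      hEF]
    by_cases h : i = j
    · subst h
      simp only [if_true, mul_add, mul_sub, sub_mul, minus_K, mul_smul_comm, smul_mul_assoc,
        mul_assoc]
      abel
    · simp [h, Ne.symm h, mul_assoc]

theorem plus_mul_F (i : Fin θ) (x : TV k θ) :
    plusToBigU χ x * gen χ (.F i) = gen χ (.F i) * plusToBigU χ x -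
      plusToBigU χ (skewDer χ i x) * gen χ (.K i) +
      gen χ (.L i) * plusToBigU χ (leftSkewDer χ i x) := by
  induction x using tv_induction with
  | h1 => simp [skewDer_one, leftSkewDer_one]
  | hadd a b ha hb => simp only [map_add, add_mul, mul_add, ha, hb]; abel
  | hsmul c a ha => simp only [map_smul, smul_mul_assoc, mul_smul_comm, ha, smul_add, smul_sub]
  | hmul j a ha =>
    have hEF : gen χ (.E j) * gen χ (.F i) = gen χ (.F i) * gen χ (.E j) +
        if j = i then gen χ (.K j) - gen χ (.L j) else 0 := by
      rw [← E_F]; abel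
    rw [skewDer_ι_mul, leftSkewDer_ι_mul]
    simp only [map_sub, map_smul, map_mul, plusToBigU_ι]
    rw [mul_assoc, ha, mul_add, mul_sub, ← mul_assoc _ (gen χ (.L i)), E_L,
      ← mul_assoc _ (gen χ (.F i)), hEF]
    by_cases h : j = i
    · subst h
      simp only [if_true, add_mul, mul_sub, sub_mul, plus_kAct, mul_smul_comm, smul_mul_assoc,
        mul_assoc]
      abel
    · simp [h, mul_assoc]

theorem K_minus_homog (i : Fin θ) {β : Fin θ → ℕ} (x : TV k θ) (hx : x ∈ homog k β) :
    gen χ (.K i) * minusToBigU χ x =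
      ((χ.toFun (simpleRoot i) (toInt β))⁻¹ : kˣ).val • (minusToBigU χ x * gen χ (.K i)) := by
  have h := minus_K χ i (rev k θ x)
  rw [kAct_homog χ i _ (rev_homog x hx), map_smul, rev_rev, map_smul, mul_smul_comm] at h
  rw [h, smul_smul, Units.inv_mul, one_smul]

theorem L_minus_homog (i : Fin θ) {β : Fin θ → ℕ} (x : TV k θ) (hx : x ∈ homog k β) :
    gen χ (.L i) * minusToBigU χ x =
      (χ.toFun (toInt β) (simpleRoot i)).val • (minusToBigU χ x * gen χ (.L i)) := by
  have h := congrArg (fun z => gen χ (.L i) * z * gen χ (.L i)) (Linv_minus_homog χ i x hx)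
  simp only [mul_smul_comm, smul_mul_assoc] at h
  rw [← mul_assoc, L_Linv, one_mul, ← mul_assoc, mul_assoc (_ * _) _ (gen χ (.L i)), Linv_L,
    mul_one] at h
  rw [h, smul_smul, Units.mul_inv, one_smul]

end relations

end

section

variable {k : Type*} [Field k] {θ : ℕ} {χ : Bicharacter k θ}

/-! ### Highest weight modules -/

theorem comulU_mkU (x : BigU χ) :
    comulU χ (mkU χ x) = Algebra.TensorProduct.map (mkU χ) (mkU χ) (comulBigU χ x) :=
  RingQuot.liftAlgHom_mkAlgHom_apply ..

theorem antipodeU_mkU (x : BigU χ) :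
    antipodeU χ (mkU χ x) = mkU χ (antipodeBigU χ x).unop :=
  congrArg MulOpposite.unop (RingQuot.liftAlgHom_mkAlgHom_apply ..)

theorem mkU_surjective : Function.Surjective (mkU χ) := RingQuot.mkAlgHom_surjective k _

theorem mkBigU_surjective : Function.Surjective (mkBigU χ) := RingQuot.mkAlgHom_surjective k _

theorem gen_K_eq (i : Fin θ) : gen χ (.K i) = powK χ (simpleRoot i) := by
  rw [simpleRoot, powK_single, zpow_one]; rfl

theorem gen_L_eq (i : Fin θ) : gen χ (.L i) = powL χ (simpleRoot i) := by
  rw [simpleRoot, powL_single, zpow_one]; rfl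

theorem torusK_add (α β : Fin θ → ℤ) : torusK χ (α + β) = torusK χ α * torusK χ β := by
  apply Subtype.ext
  simp [torusK, powK_add]

theorem torusL_add (α β : Fin θ → ℤ) : torusL χ (α + β) = torusL χ α * torusL χ β := by
  apply Subtype.ext
  simp [torusL, powL_add]

theorem torusK_zero : torusK χ 0 = 1 := by
  apply Subtype.ext
  simp [torusK, powK_zero]

theorem torusL_zero : torusL χ 0 = 1 := by
  apply Subtype.ext
  simp [torusL, powL_zero]

theorem toInt_add_single (α : Fin θ → ℕ) (i : Fin θ) :
    toInt (α + Pi.single i 1) = toInt α + simpleRoot i := by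
  funext j
  by_cases h : j = i
  · subst h; simp [toInt, simpleRoot]
  · simp [toInt, simpleRoot, h]

section module

variable {V₁ : Type*} [AddCommGroup V₁] [Module k V₁] {V₂ : Type*} [AddCommGroup V₂] [Module k V₂]
  (H : HighestWeightModule χ V₁) (H₂ : HighestWeightModule χ V₂)

/-- The action of `𝓤⁺(χ)` on a module. -/
def actPlus : TV k θ →ₐ[k] Module.End k V₁ := H.ρ.comp (plusHom χ)

/-- The action of `𝓤⁻(χ)` on a module. -/
def actMinus : TV k θ →ₐ[k] Module.End k V₁ := H.ρ.comp (minusHom χ)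

/-- The action of a generator of `𝓤(χ)` on a module. -/
def actGen (g : Gen θ) : Module.End k V₁ := H.ρ (mkU χ (gen χ g))

theorem actPlus_ι (i : Fin θ) : actPlus H (FreeAlgebra.ι k i) = actGen H (.E i) := by
  simp [actPlus, plusHom, actGen, plusToBigU_ι]

theorem actMinus_ι (i : Fin θ) : actMinus H (FreeAlgebra.ι k i) = actGen H (.F i) := by
  simp [actMinus, minusHom, actGen, minusToBigU_ι]

theorem mem_weightPart {α : Fin θ → ℕ} {u : V₁} :
    u ∈ weightPart H α ↔ ∃ y ∈ homog k α, actMinus H y H.v = u := by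
  simp only [weightPart, UMinusDeg, Submodule.mem_map]
  constructor
  · rintro ⟨_, ⟨y, hy, rfl⟩, rfl⟩
    exact ⟨y, hy, rfl⟩
  · rintro ⟨y, hy, rfl⟩
    exact ⟨_, ⟨y, hy, rfl⟩, rfl⟩

theorem iSup_weightPart : ⨆ α, weightPart H α = ⊤ := by
  refine eq_top_iff.2 fun w _ => ?_
  obtain ⟨Y, rfl⟩ := H.generates w
  obtain ⟨y, rfl⟩ := (idealMinus χ).mkQ_surjective Y
  change actMinus H y H.v ∈ _
  obtain ⟨s, hs⟩ := exists_sum_homogProj y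
  rw [← hs s subset_rfl, map_sum, LinearMap.sum_apply]
  exact sum_mem fun β _ => Submodule.mem_iSup_of_mem β
    ((mem_weightPart H).2 ⟨_, homogProj_mem β y, rfl⟩)

theorem actGen_K_v (i : Fin θ) :
    actGen H (.K i) H.v = H.Λ (torusK χ (simpleRoot i)) • H.v := by
  rw [actGen, gen_K_eq]; exact H.torus_smul (torusK χ _)

theorem actGen_L_v (i : Fin θ) :
    actGen H (.L i) H.v = H.Λ (torusL χ (simpleRoot i)) • H.v := by
  rw [actGen, gen_L_eq]; exact H.torus_smul (torusL χ _)

/-- The eigenvalue of `K_i` on `𝔲⁻(χ)_{-α} v`. -/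
def weightK (i : Fin θ) (α : Fin θ → ℕ) : k :=
  ((χ.toFun (simpleRoot i) (toInt α))⁻¹ : kˣ).val * H.Λ (torusK χ (simpleRoot i))

/-- The eigenvalue of `L_i` on `𝔲⁻(χ)_{-α} v`. -/
def weightL (i : Fin θ) (α : Fin θ → ℕ) : k :=
  (χ.toFun (toInt α) (simpleRoot i)).val * H.Λ (torusL χ (simpleRoot i))

theorem actGen_K_weightPart (i : Fin θ) {α : Fin θ → ℕ} {u : V₁} (hu : u ∈ weightPart H α) :
    actGen H (.K i) u = weightK H i α • u := by
  obtain ⟨y, hy, rfl⟩ := (mem_weightPart H).1 hu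
  have h := congrArg (fun z => H.ρ (mkU χ z) H.v) (K_minus_homog χ i y hy)
  simp only [map_mul, map_smul, LinearMap.smul_apply, Module.End.mul_apply] at h
  have hv := actGen_K_v H i
  simp only [actGen] at hv
  rw [hv, map_smul, smul_smul] at h
  exact h

theorem actGen_L_weightPart (i : Fin θ) {α : Fin θ → ℕ} {u : V₁} (hu : u ∈ weightPart H α) :
    actGen H (.L i) u = weightL H i α • u := by
  obtain ⟨y, hy, rfl⟩ := (mem_weightPart H).1 hu
  have h := congrArg (fun z => H.ρ (mkU χ z) H.v) (L_minus_homog χ i y hy)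
  simp only [map_mul, map_smul, LinearMap.smul_apply, Module.End.mul_apply] at h
  have hv := actGen_L_v H i
  simp only [actGen] at hv
  rw [hv, map_smul, smul_smul] at h
  exact h

theorem actGen_F_weightPart (i : Fin θ) {α : Fin θ → ℕ} {u : V₁} (hu : u ∈ weightPart H α) :
    actGen H (.F i) u ∈ weightPart H (α + Pi.single i 1) := by
  obtain ⟨y, hy, rfl⟩ := (mem_weightPart H).1 hu
  refine (mem_weightPart H).2 ⟨_, ι_mul_homog i hy, ?_⟩
  rw [map_mul, actMinus_ι]; rfl

theorem actMinus_rev_mem {α : Fin θ → ℕ} {x : TV k θ} (hx : x ∈ homog k α) :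
    actMinus H (rev k θ x) H.v ∈ weightPart H α :=
  (mem_weightPart H).2 ⟨_, rev_homog x hx, rfl⟩

/-- `E_i` kills the highest weight vector, so only the skew derivation terms survive. Degree
lowering is thereby checked in `T(V)`, with no need for the weight parts to be independent. -/
theorem actGen_E_apply (i : Fin θ) (y : TV k θ) :
    actGen H (.E i) (actMinus H (rev k θ y) H.v) =
      -actGen H (.K i) (actMinus H (rev k θ (skewDer χ i y)) H.v) +
      H.Λ (torusL χ (simpleRoot i)) • actMinus H (rev k θ (leftSkewDer χ i y)) H.v := by
  have h := congrArg (fun z => H.ρ (mkU χ z) H.v) (E_mul_minus χ i y)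
  simp only [map_mul, map_add, map_sub, LinearMap.add_apply, LinearMap.sub_apply,
    Module.End.mul_apply, H.E_smul, map_zero, zero_sub] at h
  have hv := actGen_L_v H i
  simp only [actGen] at hv
  rw [hv, map_smul] at h
  exact h

theorem actGen_E_weightPart (i : Fin θ) {α : Fin θ → ℕ} {u : V₁}
    (hu : u ∈ weightPart H (α + Pi.single i 1)) : actGen H (.E i) u ∈ weightPart H α := by
  obtain ⟨y, hy, rfl⟩ := (mem_weightPart H).1 hu
  rw [← rev_rev y, actGen_E_apply, actGen_K_weightPart H i (actMinus_rev_mem H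
    (homogPred_le i α (skewDer_mem_homogPred χ i (rev_homog y hy))))]
  exact add_mem (neg_mem (Submodule.smul_mem _ _ (actMinus_rev_mem H
    (homogPred_le i α (skewDer_mem_homogPred χ i (rev_homog y hy))))))
    (Submodule.smul_mem _ _ (actMinus_rev_mem H
    (homogPred_le i α (leftSkewDer_mem_homogPred χ i (rev_homog y hy)))))

theorem actGen_E_eq_zero (i : Fin θ) {α : Fin θ → ℕ} (hα : α i = 0) {u : V₁}
    (hu : u ∈ weightPart H α) : actGen H (.E i) u = 0 := by
  obtain ⟨y, hy, rfl⟩ := (mem_weightPart H).1 hu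
  have h1 := skewDer_mem_homogPred χ i (rev_homog y hy)
  have h2 := leftSkewDer_mem_homogPred χ i (rev_homog y hy)
  rw [homogPred_eq_bot i hα, Submodule.mem_bot] at h1 h2
  rw [← rev_rev y, actGen_E_apply, h1, h2]
  simp

theorem exists_eq_add_single {α : Fin θ → ℕ} {i : Fin θ} (h : α i ≠ 0) :
    ∃ β : Fin θ → ℕ, α = β + Pi.single i 1 := by
  refine ⟨α - Pi.single i 1, ?_⟩
  funext j
  by_cases hj : j = i
  · subst hj; simp; lia
  · simp [hj]

theorem sum_add_single (α : Fin θ → ℕ) (i : Fin θ) :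
    ∑ j, (α + Pi.single i 1 : Fin θ → ℕ) j = ∑ j, α j + 1 := by
  simp [Finset.sum_add_distrib]

/-! ### Nilpotency of `𝔲⁺(χ)` -/

theorem exists_forall_word_eq_zero {M : Type*} [AddCommGroup M] [Module k M]
    [FiniteDimensional k M] (e : TV k θ →ₐ[k] Module.End k M) (S : Set M)
    (hS : Submodule.span k S = ⊤)
    (h : ∀ u ∈ S, ∃ n, ∀ l : List (Fin θ), n < l.length → e (word k l) u = 0) :
    ∃ n, ∀ l : List (Fin θ), n < l.length → e (word k l) = 0 := by
  have h1 : ∀ u : M, ∃ n, ∀ l : List (Fin θ), n < l.length → e (word k l) u = 0 := by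
    intro u
    have hu : u ∈ Submodule.span k S := by rw [hS]; trivial
    induction hu using Submodule.span_induction with
    | mem u hu => exact h u hu
    | zero => exact ⟨0, fun l _ => map_zero _⟩
    | add x y _ _ hx hy =>
      obtain ⟨m, hm⟩ := hx
      obtain ⟨n, hn⟩ := hy
      exact ⟨max m n, fun l hl => by rw [map_add, hm l (by lia), hn l (by lia), add_zero]⟩
    | smul c x _ hx =>
      obtain ⟨n, hn⟩ := hx
      exact ⟨n, fun l hl => by rw [map_smul, hn l hl, smul_zero]⟩
  let b := Module.finBasis k M
  choose n hn using fun i => h1 (b i)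
  -- The sum dominates the bound `n i` of each vector in a finite basis.
  refine ⟨∑ i, n i, fun l hl => b.ext fun i => ?_⟩
  rw [LinearMap.zero_apply]
  exact hn i l ((Finset.single_le_sum (fun _ _ => Nat.zero_le _) (Finset.mem_univ i)).trans_lt hl)

/-- Each letter either kills the vector or lowers `|α|` by one, so no more than `|α|` letters can
survive. -/
theorem actPlus_word_weightPart (l : List (Fin θ)) {α : Fin θ → ℕ} {u : V₁}
    (hu : u ∈ weightPart H α) (hl : ∑ i, α i < l.length) : actPlus H (word k l) u = 0 := by
  -- The last letter of the word acts first.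
  induction l using List.reverseRecOn generalizing α u with
  | nil => simp at hl
  | append_singleton l i ih =>
    rw [word_append_singleton, map_mul, actPlus_ι, Module.End.mul_apply]
    by_cases h : α i = 0
    · rw [actGen_E_eq_zero H i h hu, map_zero]
    · obtain ⟨β, rfl⟩ := exists_eq_add_single h
      refine ih (actGen_E_weightPart H i hu) ?_
      rw [sum_add_single] at hl
      simp at hl; lia

theorem span_weightPart : Submodule.span k {u | ∃ α, u ∈ weightPart H α} = ⊤ := by
  rw [eq_top_iff, ← iSup_weightPart H]
  exact iSup_le fun α u hu => Submodule.subset_span ⟨α, hu⟩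

theorem span_weightPart_tmul : Submodule.span k {t : V₁ ⊗[k] V₂ |
    ∃ α β, ∃ u ∈ weightPart H α, ∃ w ∈ weightPart H₂ β, u ⊗ₜ w = t} = ⊤ := by
  rw [eq_top_iff, ← TensorProduct.map₂_mk_top_top_eq_top, ← span_weightPart H, ← span_weightPart H₂,
    Submodule.map₂_span_span]
  refine Submodule.span_mono ?_
  rintro _ ⟨u, ⟨α, hu⟩, w, ⟨β, hw⟩, rfl⟩
  exact ⟨α, β, u, hu, w, hw, rfl⟩

theorem tensor_ext_weightPart {M : Type*} [AddCommGroup M] [Module k M]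
    {f g : V₁ ⊗[k] V₂ →ₗ[k] M}
    (h : ∀ α β, ∀ u ∈ weightPart H α, ∀ w ∈ weightPart H₂ β, f (u ⊗ₜ w) = g (u ⊗ₜ w)) : f = g := by
  refine LinearMap.ext_on (span_weightPart_tmul H H₂) ?_
  rintro _ ⟨α, β, u, hu, w, hw, rfl⟩
  exact h α β u hu w hw

theorem exists_isAdmissible_actPlus [FiniteDimensional k V₁] :
    ∃ N, IsAdmissible χ N (actPlus H).toLinearMap := by
  obtain ⟨N, hN⟩ := exists_forall_word_eq_zero (actPlus H) _ (span_weightPart H) (by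
    rintro u ⟨α, hu⟩
    exact ⟨_, fun l hl => actPlus_word_weightPart H l hu hl⟩)
  exact ⟨N, fun x hx => by simp [actPlus, plusHom, mkU_plus χ x hx], hN⟩

/-! ### The positive part acting on a tensor product -/

theorem rep₂_tmul (a b : SmallU χ) : rep₂ H H₂ (a ⊗ₜ b) = TensorProduct.map (H.ρ a) (H₂.ρ b) := by
  simp only [rep₂, AlgHom.comp_apply, Algebra.TensorProduct.map_tmul,
    Module.endTensorEndAlgHom_apply]
  rfl

/-- The action of `𝓤⁺(χ)` on a tensor product, through the coproduct. -/
def actPlusTensor : TV k θ →ₐ[k] Module.End k (V₁ ⊗[k] V₂) :=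
  (rep₂ H H₂).comp ((comulU χ).comp (plusHom χ))

theorem actPlusTensor_ι (i : Fin θ) : actPlusTensor H H₂ (FreeAlgebra.ι k i) =
    TensorProduct.map (actGen H (.E i)) 1 +
      TensorProduct.map (actGen H (.K i)) (actGen H₂ (.E i)) := by
  simp [actPlusTensor, plusHom, plusToBigU_ι, comulU_mkU, comulBigU_gen, comulGen, rep₂_tmul,
    actGen]

/-- In either summand of `Δ(E_i)` the total `|α| + |β|` drops by one or the vector dies, `K_i`
acting by a scalar. -/
theorem actPlusTensor_word (l : List (Fin θ)) {α β : Fin θ → ℕ} {u : V₁} {w : V₂}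
    (hu : u ∈ weightPart H α) (hw : w ∈ weightPart H₂ β)
    (hl : ∑ i, α i + ∑ i, β i < l.length) : actPlusTensor H H₂ (word k l) (u ⊗ₜ w) = 0 := by
  induction l using List.reverseRecOn generalizing α β u w with
  | nil => simp at hl
  | append_singleton l i ih =>
    rw [word_append_singleton, map_mul, actPlusTensor_ι, Module.End.mul_apply, LinearMap.add_apply,
      TensorProduct.map_tmul, TensorProduct.map_tmul, map_add, Module.End.one_apply,
      actGen_K_weightPart H i hu, ← TensorProduct.smul_tmul', map_smul]
    have h1 : actPlusTensor H H₂ (word k l) (actGen H (.E i) u ⊗ₜ w) = 0 := by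
      by_cases h : α i = 0
      · rw [actGen_E_eq_zero H i h hu, TensorProduct.zero_tmul, map_zero]
      · obtain ⟨γ, rfl⟩ := exists_eq_add_single h
        refine ih (actGen_E_weightPart H i hu) hw ?_
        rw [sum_add_single] at hl
        simp at hl; lia
    have h2 : actPlusTensor H H₂ (word k l) (u ⊗ₜ actGen H₂ (.E i) w) = 0 := by
      by_cases h : β i = 0
      · rw [actGen_E_eq_zero H₂ i h hw, TensorProduct.tmul_zero, map_zero]
      · obtain ⟨γ, rfl⟩ := exists_eq_add_single h
        refine ih hu (actGen_E_weightPart H₂ i hw) ?_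
        rw [sum_add_single] at hl
        simp at hl; lia
    rw [h1, h2, smul_zero, add_zero]

theorem exists_isAdmissible_actPlusTensor [FiniteDimensional k V₁] [FiniteDimensional k V₂] :
    ∃ N, IsAdmissible χ N (actPlusTensor H H₂).toLinearMap := by
  obtain ⟨N, hN⟩ := exists_forall_word_eq_zero (actPlusTensor H H₂) _ (span_weightPart_tmul H H₂) (by
    rintro _ ⟨α, β, u, hu, w, hw, rfl⟩
    exact ⟨_, fun l hl => actPlusTensor_word H H₂ l hu hw hl⟩)
  exact ⟨N, fun x hx => by simp [actPlusTensor, plusHom, mkU_plus χ x hx], hN⟩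

/-! ### The diagonal operator -/

/-- The eigenvalue `χ(β, α) Λ₁(K^{-β}) Λ₂(L^α)` of the diagonal operator. -/
def diagScalar (α β : Fin θ → ℕ) : k :=
  (χ.toFun (toInt β) (toInt α) : k) * H.Λ (torusK χ (-toInt β)) * H₂.Λ (torusL χ (toInt α))

theorem Λ_torusK_mul (α : Fin θ → ℤ) : H.Λ (torusK χ (-α)) * H.Λ (torusK χ α) = 1 := by
  rw [← map_mul, ← torusK_add, neg_add_cancel, torusK_zero, map_one]

theorem Λ_torusL_mul (α : Fin θ → ℤ) : H.Λ (torusL χ (-α)) * H.Λ (torusL χ α) = 1 := by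
  rw [← map_mul, ← torusL_add, neg_add_cancel, torusL_zero, map_one]

theorem diagScalar_ne_zero (α β : Fin θ → ℕ) : diagScalar H H₂ α β ≠ 0 :=
  mul_ne_zero (mul_ne_zero (Units.ne_zero _) (left_ne_zero_of_mul_eq_one (Λ_torusK_mul H _)))
    (right_ne_zero_of_mul_eq_one (Λ_torusL_mul H₂ _))

/-- This shift rule and `diagScalar_add_right` are, besides nonvanishing, all that is used of the
eigenvalue formula. Raising the first weight costs an `L_i`-eigenvalue on the second factor; raising
the second costs an inverse `K_i`-eigenvalue on the first. -/
theorem diagScalar_add_left (α β : Fin θ → ℕ) (i : Fin θ) :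
    diagScalar H H₂ (α + Pi.single i 1) β = weightL H₂ i β * diagScalar H H₂ α β := by
  rw [diagScalar, diagScalar, weightL, toInt_add_single, χ.map_add_right, torusL_add, map_mul,
    Units.val_mul]
  ring

theorem diagScalar_add_right (α β : Fin θ → ℕ) (i : Fin θ) :
    weightK H i α * diagScalar H H₂ α (β + Pi.single i 1) = diagScalar H H₂ α β := by
  rw [diagScalar, diagScalar, weightK, toInt_add_single, χ.map_add_left, neg_add, torusK_add,
    map_mul, Units.val_mul]
  have h1 := Λ_torusK_mul H (simpleRoot i)
  have h2 := Units.inv_mul (χ.toFun (simpleRoot i) (toInt α))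
  linear_combination (χ.toFun (toInt β) (toInt α)).val * H.Λ (torusK χ (-toInt β)) *
    H₂.Λ (torusL χ (toInt α)) * (H.Λ (torusK χ (-simpleRoot i)) *
      H.Λ (torusK χ (simpleRoot i)) * h2 + h1)

variable {H H₂} {f : Module.End k (V₁ ⊗[k] V₂)}

theorem IsDiagonalOperator.apply (hf : IsDiagonalOperator H H₂ f) {α β : Fin θ → ℕ} {u : V₁}
    {w : V₂} (hu : u ∈ weightPart H α) (hw : w ∈ weightPart H₂ β) :
    f (u ⊗ₜ w) = diagScalar H H₂ α β • (u ⊗ₜ w) := by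
  obtain ⟨X, hX, rfl⟩ := hu
  obtain ⟨Y, hY, rfl⟩ := hw
  exact hf α β X hX Y hY

/-- Weight tensors span and are scaled by nonzero scalars, so `f` is onto; in finite dimension that
is enough. -/
theorem IsDiagonalOperator.isUnit [FiniteDimensional k V₁] [FiniteDimensional k V₂]
    (hf : IsDiagonalOperator H H₂ f) : IsUnit f := by
  rw [LinearMap.isUnit_iff_range_eq_top, eq_top_iff, ← span_weightPart_tmul H H₂,
    Submodule.span_le]
  rintro _ ⟨α, β, u, hu, w, hw, rfl⟩
  refine ⟨(diagScalar H H₂ α β)⁻¹ • (u ⊗ₜ w), ?_⟩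
  rw [map_smul, hf.apply hu hw, smul_smul, inv_mul_cancel₀ (diagScalar_ne_zero H H₂ α β), one_smul]

/-- Together with the next three rules this says that conjugation by `f` takes `Δ(E_i)` to `E_i ⊗
L_i + 1 ⊗ E_i` and `Δ(F_i)` to `F_i ⊗ 1 + K_i ⊗ F_i`, the elements that the canonical operator can
handle. -/
theorem IsDiagonalOperator.E_left (hf : IsDiagonalOperator H H₂ f) (i : Fin θ) :
    TensorProduct.map (actGen H (.E i)) 1 * f =
      f * TensorProduct.map (actGen H (.E i)) (actGen H₂ (.L i)) := by
  refine tensor_ext_weightPart H H₂ fun α β u hu w hw => ?_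
  rw [Module.End.mul_apply, Module.End.mul_apply, hf.apply hu hw, map_smul, TensorProduct.map_tmul,
    TensorProduct.map_tmul, actGen_L_weightPart H₂ i hw, TensorProduct.tmul_smul, map_smul,
    Module.End.one_apply]
  by_cases h : α i = 0
  · simp [actGen_E_eq_zero H i h hu]
  · obtain ⟨γ, rfl⟩ := exists_eq_add_single h
    rw [hf.apply (actGen_E_weightPart H i hu) hw, diagScalar_add_left, smul_smul]

theorem IsDiagonalOperator.E_right (hf : IsDiagonalOperator H H₂ f) (i : Fin θ) :
    TensorProduct.map (actGen H (.K i)) (actGen H₂ (.E i)) * f =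
      f * TensorProduct.map 1 (actGen H₂ (.E i)) := by
  refine tensor_ext_weightPart H H₂ fun α β u hu w hw => ?_
  rw [Module.End.mul_apply, Module.End.mul_apply, hf.apply hu hw, map_smul, TensorProduct.map_tmul,
    TensorProduct.map_tmul, actGen_K_weightPart H i hu, ← TensorProduct.smul_tmul',
    Module.End.one_apply]
  by_cases h : β i = 0
  · simp [actGen_E_eq_zero H₂ i h hw]
  · obtain ⟨γ, rfl⟩ := exists_eq_add_single h
    rw [hf.apply hu (actGen_E_weightPart H₂ i hw), ← diagScalar_add_right H H₂ α γ i, smul_smul,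
      mul_comm]

theorem IsDiagonalOperator.F_left (hf : IsDiagonalOperator H H₂ f) (i : Fin θ) :
    TensorProduct.map (actGen H (.F i)) (actGen H₂ (.L i)) * f =
      f * TensorProduct.map (actGen H (.F i)) 1 := by
  refine tensor_ext_weightPart H H₂ fun α β u hu w hw => ?_
  rw [Module.End.mul_apply, Module.End.mul_apply, hf.apply hu hw, map_smul, TensorProduct.map_tmul,
    TensorProduct.map_tmul, actGen_L_weightPart H₂ i hw, TensorProduct.tmul_smul,
    Module.End.one_apply, hf.apply (actGen_F_weightPart H i hu) hw, diagScalar_add_left, smul_smul,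
    mul_comm]

theorem IsDiagonalOperator.F_right (hf : IsDiagonalOperator H H₂ f) (i : Fin θ) :
    TensorProduct.map 1 (actGen H₂ (.F i)) * f =
      f * TensorProduct.map (actGen H (.K i)) (actGen H₂ (.F i)) := by
  refine tensor_ext_weightPart H H₂ fun α β u hu w hw => ?_
  rw [Module.End.mul_apply, Module.End.mul_apply, hf.apply hu hw, map_smul, TensorProduct.map_tmul,
    TensorProduct.map_tmul, actGen_K_weightPart H i hu, ← TensorProduct.smul_tmul', map_smul,
    Module.End.one_apply, hf.apply hu (actGen_F_weightPart H₂ i hw),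
    ← diagScalar_add_right H H₂ α β i, smul_smul]

theorem IsDiagonalOperator.commute_of_eigen (hf : IsDiagonalOperator H H₂ f)
    {g : Module.End k (V₁ ⊗[k] V₂)} (hg : ∀ α β, ∃ c : k, ∀ u ∈ weightPart H α,
      ∀ w ∈ weightPart H₂ β, g (u ⊗ₜ w) = c • (u ⊗ₜ w)) : Commute g f := by
  refine tensor_ext_weightPart H H₂ fun α β u hu w hw => ?_
  obtain ⟨c, hc⟩ := hg α β
  rw [Module.End.mul_apply, Module.End.mul_apply, hf.apply hu hw, map_smul, hc u hu w hw, map_smul,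
    hf.apply hu hw, smul_comm]

theorem IsDiagonalOperator.commute_L_right (hf : IsDiagonalOperator H H₂ f) (i : Fin θ) :
    Commute (TensorProduct.map 1 (actGen H₂ (.L i))) f :=
  hf.commute_of_eigen fun _ β => ⟨weightL H₂ i β, fun u _ w hw => by
    simp [actGen_L_weightPart H₂ i hw]⟩

theorem IsDiagonalOperator.commute_K (hf : IsDiagonalOperator H H₂ f) (i : Fin θ) :
    Commute (TensorProduct.map (actGen H (.K i)) (actGen H₂ (.K i))) f :=
  hf.commute_of_eigen fun α β => ⟨weightK H₂ i β * weightK H i α, fun u hu w hw => by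
    simp [actGen_K_weightPart H i hu, actGen_K_weightPart H₂ i hw, ← TensorProduct.smul_tmul',
      smul_smul]⟩

theorem IsDiagonalOperator.commute_L (hf : IsDiagonalOperator H H₂ f) (i : Fin θ) :
    Commute (TensorProduct.map (actGen H (.L i)) (actGen H₂ (.L i))) f :=
  hf.commute_of_eigen fun α β => ⟨weightL H₂ i β * weightL H i α, fun u hu w hw => by
    simp [actGen_L_weightPart H i hu, actGen_L_weightPart H₂ i hw, ← TensorProduct.smul_tmul',
      smul_smul]⟩

end module

end

section

variable {k : Type*} [Field k] {θ : ℕ} {χ : Bicharacter k θ}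

/-! ### Representations of `𝔲(χ) ⊗ 𝔲(χ)` -/

/-- The image of a generator in `𝔲(χ)`. -/
def genU (χ : Bicharacter k θ) (g : Gen θ) : SmallU χ := mkU χ (gen χ g)

section pair

variable {R : Type*} [Ring R] [Algebra k R] (φ : SmallU χ ⊗[k] SmallU χ →ₐ[k] R)

/-- The action of `𝓤⁺(χ)` through the first tensor factor. -/
def plusL : TV k θ →ₐ[k] R :=
  φ.comp ((Algebra.TensorProduct.includeLeft (S := k)).comp (plusHom χ))

/-- The action of `𝓤⁺(χ)` through the second tensor factor. -/
def plusR : TV k θ →ₐ[k] R := φ.comp (Algebra.TensorProduct.includeRight.comp (plusHom χ))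

/-- The action of `𝓤⁻(χ)` through the first tensor factor. -/
def minusL : TV k θ →ₐ[k] R :=
  φ.comp ((Algebra.TensorProduct.includeLeft (S := k)).comp (minusHom χ))

/-- The action of `𝓤⁻(χ)` through the second tensor factor. -/
def minusR : TV k θ →ₐ[k] R := φ.comp (Algebra.TensorProduct.includeRight.comp (minusHom χ))

theorem plusHom_ι (i : Fin θ) : plusHom χ (FreeAlgebra.ι k i) = genU χ (.E i) := by
  simp [plusHom, plusToBigU_ι, genU]

theorem minusHom_ι (i : Fin θ) : minusHom χ (FreeAlgebra.ι k i) = genU χ (.F i) := by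
  simp [minusHom, minusToBigU_ι, genU]

theorem plusL_apply (x : TV k θ) : plusL φ x = φ (plusHom χ x ⊗ₜ 1) := rfl

theorem plusR_apply (x : TV k θ) : plusR φ x = φ (1 ⊗ₜ plusHom χ x) := rfl

theorem minusL_apply (x : TV k θ) : minusL φ x = φ (minusHom χ x ⊗ₜ 1) := rfl

theorem minusR_apply (x : TV k θ) : minusR φ x = φ (1 ⊗ₜ minusHom χ x) := rfl

theorem minusHom_idealMinus {y : TV k θ} (hy : y ∈ idealMinus χ) : minusHom χ y = 0 :=
  mkU_minus χ y hy

theorem minusR_idealMinus (y : TV k θ) (hy : y ∈ idealMinus χ) : minusR φ y = 0 := by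
  rw [minusR_apply, minusHom_idealMinus hy, TensorProduct.tmul_zero, map_zero]

theorem commute_tmul (a b : SmallU χ) : Commute (φ (a ⊗ₜ 1)) (φ (1 ⊗ₜ b)) := by
  simp [Commute, SemiconjBy, ← map_mul]

theorem map_tmul_eq (a b : SmallU χ) : φ (a ⊗ₜ b) = φ (a ⊗ₜ 1) * φ (1 ⊗ₜ b) := by
  simp [← map_mul]

theorem map_canonical (B : HomogBases χ) (β : Fin θ → ℕ) : φ (canonical B β) =
    LinearMap.mul' k R (TensorProduct.map (plusL φ).toLinearMap (minusR φ).toLinearMap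
      (canonDeg B β)) := by
  rw [canonical_eq]
  generalize canonDeg B β = t
  induction t with
  | zero => simp
  | add a b ha hb => simp only [map_add, ha, hb]
  | tmul a b => exact map_tmul_eq φ _ _

/-! ### Convolution inverse of the canonical element -/

theorem K_mul_antipode {β : Fin θ → ℕ} {x : TV k θ} (hx : x ∈ homog k β) :
    (torusK χ (toInt β) : SmallU χ) * antipodeU χ (plusHom χ x) =
      plusHom χ (braidedAntipode χ x) := by
  change mkU χ (powK χ (toInt β)) * antipodeU χ (mkU χ (plusToBigU χ x)) = _
  rw [antipodeU_mkU, antipode_plus χ x hx, map_mul, ← mul_assoc, ← map_mul, ← powK_add,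
    add_neg_cancel, powK_zero, map_one, one_mul]
  rfl

/-- On degree `β` the antipode is `K^{-β}` times the braided antipode, so the prefactor `K^β ⊗ 1`
leaves the braided antipode alone, a convolution inverse of the identity. -/
theorem map_canonical' (B : HomogBases χ) (β : Fin θ → ℕ) : φ (canonical' B β) =
    LinearMap.mul' k R (TensorProduct.map ((plusL φ).toLinearMap.comp (braidedAntipode χ))
      (minusR φ).toLinearMap (canonDeg B β)) := by
  rw [canonical', canonical_eq, canonDeg]
  simp only [map_sum, map_smul, TensorProduct.map_tmul, AlgHom.toLinearMap_apply,
    LinearMap.comp_apply, LinearMap.mul'_apply, LinearMap.id_apply, Finset.mul_sum, mul_smul_comm,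
    Algebra.TensorProduct.tmul_mul_tmul, one_mul, K_mul_antipode (liftE_mem B β _), plusL_apply,
    minusR_apply, ← map_tmul_eq]

theorem IsAdmissible.antipode {N : ℕ} {e : TV k θ →ₗ[k] R} (he : IsAdmissible χ N e) :
    IsAdmissible χ N (e.comp (braidedAntipode χ)) :=
  ⟨fun x hx => he.ideal _ (idealPlus_isBraidedHopfIdeal.antipode x hx),
    fun l hl => he.homog (by rwa [← length_eq_sum_wdeg]) (braidedAntipode_word χ l)⟩

theorem isAdmissible_counit (N : ℕ) :
    IsAdmissible χ N ((Algebra.linearMap k R).comp (braidedCounit k θ).toLinearMap) :=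
  ⟨fun x hx => by simp [idealPlus_isBraidedHopfIdeal.counit x hx], fun l hl => by
    match l, hl with
    | i :: l, _ => simp [word_cons, braidedCounit]⟩

/-- The tensor `1 ⊗ 1` contracts to the counit, which is the unit for convolution. -/
theorem pairOp_counit (B : HomogBases χ) (N : ℕ) (f : TV k θ →ₐ[k] R)
    (hf : ∀ y ∈ idealMinus χ, f y = 0) :
    pairOp B N ((Algebra.linearMap k R).comp (braidedCounit k θ).toLinearMap) f.toLinearMap =
      1 := by
  rw [← pairOp_unique B (isAdmissible_counit N) hf (t := 1 ⊗ₜ 1)]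
  · simp
  · ext1 X
    simp [etaFree_apply, rev_one, form_symm χ X, form_one, Algebra.algebraMap_eq_smul_one]

theorem mul'_map_algHom (e : TV k θ →ₐ[k] R) (P Q : TV k θ →ₗ[k] TV k θ)
    (t : TV k θ ⊗[k] TV k θ) :
    LinearMap.mul' k R (TensorProduct.map (e.toLinearMap.comp P) (e.toLinearMap.comp Q) t) =
      e (LinearMap.mul' k _ (TensorProduct.map P Q t)) := by
  induction t with
  | zero => simp
  | add a b ha hb => simp only [map_add, ha, hb]
  | tmul a b => simp

theorem commute_plusL_minusR (x y : TV k θ) : Commute (plusL φ x) (minusR φ y) :=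
  commute_tmul φ _ _

theorem pairOp_mul_antipode (B : HomogBases χ) {N : ℕ}
    (he : IsAdmissible χ N (plusL φ).toLinearMap) :
    pairOp B N (plusL φ).toLinearMap (minusR φ).toLinearMap *
      pairOp B N ((plusL φ).toLinearMap.comp (braidedAntipode χ)) (minusR φ).toLinearMap = 1 := by
  rw [pairOp_mul B (minusR φ) he he.antipode (isAdmissible_counit N) (minusR_idealMinus φ),
    pairOp_counit B N _ (minusR_idealMinus φ)]
  · exact fun x y => commute_plusL_minusR φ _ y
  · intro X
    have := mul'_map_algHom (plusL φ) LinearMap.id (braidedAntipode χ) (braidedComul χ X)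
    rw [LinearMap.comp_id] at this
    rw [this, mul_id_antipode_comul, AlgHom.commutes]
    rfl

theorem pairOp_antipode_mul (B : HomogBases χ) {N : ℕ}
    (he : IsAdmissible χ N (plusL φ).toLinearMap) :
    pairOp B N ((plusL φ).toLinearMap.comp (braidedAntipode χ)) (minusR φ).toLinearMap *
      pairOp B N (plusL φ).toLinearMap (minusR φ).toLinearMap = 1 := by
  rw [pairOp_mul B (minusR φ) he.antipode he (isAdmissible_counit N) (minusR_idealMinus φ),
    pairOp_counit B N _ (minusR_idealMinus φ)]
  · exact fun x y => commute_plusL_minusR φ _ y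
  · intro X
    have := mul'_map_algHom (plusL φ) (braidedAntipode χ) LinearMap.id (braidedComul χ X)
    rw [LinearMap.comp_id] at this
    rw [this, mul_antipode_id_comul, AlgHom.commutes]
    rfl

/-! ### The intertwining property -/

theorem smallU_induction {p : SmallU χ → Prop} (hgen : ∀ g, p (genU χ g))
    (hscalar : ∀ c : k, p (algebraMap k _ c)) (hadd : ∀ a b, p a → p b → p (a + b))
    (hmul : ∀ a b, p a → p b → p (a * b)) (X : SmallU χ) : p X := by
  obtain ⟨Y, rfl⟩ := mkU_surjective X
  obtain ⟨z, rfl⟩ := mkBigU_surjective Y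
  induction z using FreeAlgebra.induction with
  | grade0 r => rw [AlgHom.commutes, AlgHom.commutes]; exact hscalar r
  | grade1 g => exact hgen g
  | mul a b ha hb => rw [map_mul, map_mul]; exact hmul _ _ ha hb
  | add a b ha hb => rw [map_add, map_add]; exact hadd _ _ ha hb

theorem comulU_genU (g : Gen θ) : comulU χ (genU χ g) =
    Algebra.TensorProduct.map (mkU χ) (mkU χ) (comulGen χ g) := by
  rw [genU, comulU_mkU, comulBigU_gen]

/-- The coproduct followed by the flip. -/
def comulOpU (χ : Bicharacter k θ) : SmallU χ →ₐ[k] SmallU χ ⊗[k] SmallU χ :=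
  (Algebra.TensorProduct.comm k (SmallU χ) (SmallU χ)).toAlgHom.comp (comulU χ)

theorem comulOpU_apply (X : SmallU χ) :
    comulOpU χ X = TensorProduct.comm k (SmallU χ) (SmallU χ) (comulU χ X) := rfl

/-- The coproduct is intertwined if it is on the generators. -/
theorem comul_intertwine {r : R}
    (hE : ∀ i, r * φ (comulU χ (genU χ (.E i))) = φ (comulOpU χ (genU χ (.E i))) * r)
    (hF : ∀ i, r * φ (comulU χ (genU χ (.F i))) = φ (comulOpU χ (genU χ (.F i))) * r)
    (hK : ∀ i, r * φ (comulU χ (genU χ (.K i))) = φ (comulOpU χ (genU χ (.K i))) * r)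
    (hL : ∀ i, r * φ (comulU χ (genU χ (.L i))) = φ (comulOpU χ (genU χ (.L i))) * r)
    (X : SmallU χ) : r * φ (comulU χ X) = φ (comulOpU χ X) * r := by
  -- The intertwining property passes to two-sided inverses, which covers `K_i⁻¹` and `L_i⁻¹`.
  have hinv : ∀ a b : SmallU χ, a * b = 1 → b * a = 1 →
      r * φ (comulU χ a) = φ (comulOpU χ a) * r → r * φ (comulU χ b) = φ (comulOpU χ b) * r := by
    intro a b hab hba h
    have h1 : φ (comulOpU χ b) * φ (comulOpU χ a) = 1 := by rw [← map_mul, ← map_mul, hba]; simp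
    have h2 : φ (comulU χ a) * φ (comulU χ b) = 1 := by rw [← map_mul, ← map_mul, hab]; simp
    calc r * φ (comulU χ b) = φ (comulOpU χ b) * (φ (comulOpU χ a) * r) * φ (comulU χ b) := by
          rw [← mul_assoc, h1, one_mul]
      _ = φ (comulOpU χ b) * r * (φ (comulU χ a) * φ (comulU χ b)) := by
          rw [← h]; simp only [mul_assoc]
      _ = _ := by rw [h2, mul_one]
  induction X using smallU_induction with
  | hgen g =>
    cases g with
    | E i => exact hE i
    | F i => exact hF i
    | K i => exact hK i
    | Kinv i =>
      refine hinv (genU χ (.K i)) _ ?_ ?_ (hK i)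
      · rw [genU, genU, ← map_mul, K_Kinv, map_one]
      · rw [genU, genU, ← map_mul, Kinv_K, map_one]
    | L i => exact hL i
    | Linv i =>
      refine hinv (genU χ (.L i)) _ ?_ ?_ (hL i)
      · rw [genU, genU, ← map_mul, L_Linv, map_one]
      · rw [genU, genU, ← map_mul, Linv_L, map_one]
  | hscalar c => simp only [AlgHom.commutes]; exact (Algebra.commutes c r).symm
  | hadd a b ha hb => simp only [map_add, mul_add, add_mul, ha, hb]
  | hmul a b ha hb =>
    simp only [map_mul]
    rw [← mul_assoc, ha, mul_assoc, hb, mul_assoc]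

/-- Conjugation by `t ⊗ t` scales each `E_j` by `c j` and each `F_j` by its inverse. The letters on
the two sides of `𝓒_β` match, so the scalars cancel. -/
theorem pairOp_commute_torus (B : HomogBases χ) (N : ℕ) (t : SmallU χ) (c : Fin θ → k)
    (hc : ∀ j, c j ≠ 0) (hE : ∀ j, genU χ (.E j) * t = c j • (t * genU χ (.E j)))
    (hF : ∀ j, genU χ (.F j) * t = (c j)⁻¹ • (t * genU χ (.F j))) :
    Commute (pairOp B N (plusL φ).toLinearMap (minusR φ).toLinearMap) (φ (t ⊗ₜ t)) := by
  let e' : TV k θ →ₐ[k] R := FreeAlgebra.lift k fun j => c j • plusL φ (FreeAlgebra.ι k j)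
  let f' : TV k θ →ₐ[k] R := FreeAlgebra.lift k fun j => (c j)⁻¹ • minusR φ (FreeAlgebra.ι k j)
  have h1 := pairOp_conj B N (e := plusL φ) (e' := e') (f := minusR φ) (f' := f')
    (g := φ (t ⊗ₜ t))
    (fun j => by
      simp only [e', FreeAlgebra.lift_ι_apply, plusL_apply, plusHom_ι, mul_smul_comm, ← map_mul,
        Algebra.TensorProduct.tmul_mul_tmul, hE, one_mul, mul_one, ← TensorProduct.smul_tmul',
        map_smul])
    (fun j => by
      simp only [f', FreeAlgebra.lift_ι_apply, minusR_apply, minusHom_ι, mul_smul_comm, ← map_mul,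
        Algebra.TensorProduct.tmul_mul_tmul, hF, one_mul, mul_one, TensorProduct.tmul_smul,
        map_smul])
  have h2 := pairOp_twist B N (e := plusL φ) (e' := e') (f := f') (f' := minusR φ)
    (z := fun j => algebraMap k R (c j)) (fun i j => Algebra.commutes _ _)
    (fun i j => Algebra.commutes _ _) (fun i j => Algebra.commutes _ _)
    (fun j => by simp [e', Algebra.smul_def])
    (fun j => by simp [f', ← Algebra.smul_def, smul_smul, hc j])
  rw [h2] at h1
  exact h1

theorem genU_mul (g h : Gen θ) : genU χ g * genU χ h = mkU χ (gen χ g * gen χ h) := by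
  rw [genU, genU, map_mul]

/-- `R = C f⁻¹` intertwines the coproduct and the opposite coproduct. -/
theorem pairOp_intertwine (B : HomogBases χ) {N : ℕ}
    (he : IsAdmissible χ N (plusL φ).toLinearMap) {f f' : R} (hff' : f * f' = 1)
    (hf'f : f' * f = 1)
    (hEl : ∀ i, φ (genU χ (.E i) ⊗ₜ 1) * f = f * φ (genU χ (.E i) ⊗ₜ genU χ (.L i)))
    (hEr : ∀ i, φ (genU χ (.K i) ⊗ₜ genU χ (.E i)) * f = f * φ (1 ⊗ₜ genU χ (.E i)))
    (hFl : ∀ i, φ (genU χ (.F i) ⊗ₜ genU χ (.L i)) * f = f * φ (genU χ (.F i) ⊗ₜ 1))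
    (hFr : ∀ i, φ (1 ⊗ₜ genU χ (.F i)) * f = f * φ (genU χ (.K i) ⊗ₜ genU χ (.F i)))
    (hK : ∀ i, Commute (φ (genU χ (.K i) ⊗ₜ genU χ (.K i))) f)
    (hL : ∀ i, Commute (φ (genU χ (.L i) ⊗ₜ genU χ (.L i))) f) (X : SmallU χ) :
    pairOp B (N + 1) (plusL φ).toLinearMap (minusR φ).toLinearMap * f' * φ (comulU χ X) =
      φ (comulOpU χ X) *
        (pairOp B (N + 1) (plusL φ).toLinearMap (minusR φ).toLinearMap * f') := by
  set C := pairOp B (N + 1) (plusL φ).toLinearMap (minusR φ).toLinearMap with hC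
  -- Intertwining by `C f'` is split in two: `x` passes through `f` and becomes `y`, then `y` passes
  -- through `C` and becomes `z`.
  have key : ∀ x y z : R, x * f = f * y → C * y = z * C → C * f' * x = z * (C * f') := by
    intro x y z hxy hyz
    calc C * f' * x = C * f' * (x * f) * f' := by
          simp only [mul_assoc, hff', mul_one]
      _ = C * (f' * f) * y * f' := by rw [hxy]; simp only [mul_assoc]
      _ = _ := by rw [hf'f, mul_one, hyz, mul_assoc]
  refine comul_intertwine φ (fun i => ?_) (fun i => ?_) (fun i => ?_) (fun i => ?_) X
  -- Here `C (E_i ⊗ L_i + 1 ⊗ E_i) = (E_i ⊗ K_i + 1 ⊗ E_i) C` is the commutator rule for `1 ⊗ E_i`,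
  -- with its terms rearranged.
  · refine key _ (φ (genU χ (.E i) ⊗ₜ genU χ (.L i)) + φ (1 ⊗ₜ genU χ (.E i))) _ ?_ ?_
    · rw [comulU_genU]
      simp only [comulGen, map_add, Algebra.TensorProduct.map_tmul, map_one, mul_add, add_mul]
      exact congrArg₂ (· + ·) (hEl i) (hEr i)
    · have h := pairOp_commutator_left B (plusL φ) (minusR φ) i (g := φ (1 ⊗ₜ genU χ (.E i)))
        (κ := φ (1 ⊗ₜ genU χ (.K i))) (l := φ (1 ⊗ₜ genU χ (.L i))) (he.mono N.le_succ)
        (minusR_idealMinus φ) (fun x => commute_tmul φ _ _) (fun x => commute_tmul φ _ _)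
        (fun y => commute_plusL_minusR φ _ y) (fun y => by
          have h := congrArg (fun z => φ (1 ⊗ₜ mkU χ z)) (E_mul_minus χ i (rev k θ y))
          simp only [rev_rev, map_add, map_sub, TensorProduct.tmul_add, TensorProduct.tmul_sub,
            map_mul] at h
          simp only [minusR_apply, ← map_mul, Algebra.TensorProduct.tmul_mul_tmul, one_mul]
          exact h)
      rw [← hC, plusL_apply, plusHom_ι, mul_assoc C, ← map_tmul_eq,
        ← (commute_tmul φ _ _).eq, ← map_tmul_eq] at h
      rw [comulOpU_apply, comulU_genU]
      simp only [comulGen, map_add, Algebra.TensorProduct.map_tmul, map_one, add_mul, mul_add,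
        TensorProduct.comm_tmul]
      have h' : φ (1 ⊗ₜ genU χ (.E i)) * C + φ (genU χ (.E i) ⊗ₜ genU χ (.K i)) * C =
          C * φ (genU χ (.E i) ⊗ₜ genU χ (.L i)) + C * φ (1 ⊗ₜ genU χ (.E i)) := by
        rw [h]; abel
      exact h'.symm
  -- Likewise `C (F_i ⊗ 1 + K_i ⊗ F_i) = (F_i ⊗ 1 + L_i ⊗ F_i) C` is the commutator rule for `F_i ⊗
  -- 1`.
  · refine key _ (φ (genU χ (.F i) ⊗ₜ 1) + φ (genU χ (.K i) ⊗ₜ genU χ (.F i))) _ ?_ ?_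
    · rw [comulU_genU]
      simp only [comulGen, map_add, Algebra.TensorProduct.map_tmul, map_one, mul_add, add_mul]
      exact congrArg₂ (· + ·) (hFl i) (hFr i)
    · have h := pairOp_commutator_right B (plusL φ) (minusR φ) i (g := φ (genU χ (.F i) ⊗ₜ 1))
        (κ := φ (genU χ (.K i) ⊗ₜ 1)) (l := φ (genU χ (.L i) ⊗ₜ 1)) he
        (minusR_idealMinus φ) (fun x => (commute_tmul φ _ _).symm)
        (fun x => (commute_tmul φ _ _).symm)
        (fun x => commute_plusL_minusR φ x _) (fun x => by
          have h := congrArg (fun z => φ (mkU χ z ⊗ₜ 1)) (plus_mul_F χ i x)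
          simp only [map_add, map_sub, TensorProduct.add_tmul, TensorProduct.sub_tmul,
            map_mul] at h
          simp only [plusL_apply, ← map_mul, Algebra.TensorProduct.tmul_mul_tmul, one_mul]
          exact h)
      rw [← hC, minusR_apply, minusHom_ι, mul_assoc C, ← (commute_tmul φ _ _).eq, ← map_tmul_eq,
        ← map_tmul_eq] at h
      rw [comulOpU_apply, comulU_genU]
      simp only [comulGen, map_add, Algebra.TensorProduct.map_tmul, map_one, add_mul, mul_add,
        TensorProduct.comm_tmul]
      have h' : C * φ (genU χ (.F i) ⊗ₜ 1) + C * φ (genU χ (.K i) ⊗ₜ genU χ (.F i)) =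
          φ (genU χ (.L i) ⊗ₜ genU χ (.F i)) * C + φ (genU χ (.F i) ⊗ₜ 1) * C := by
        rw [h]; abel
      exact h'
  · rw [comulOpU_apply, comulU_genU]
    simp only [comulGen, Algebra.TensorProduct.map_tmul, TensorProduct.comm_tmul]
    refine key _ _ _ (hK i).eq (pairOp_commute_torus φ B (N + 1) (genU χ (.K i))
      (fun j => (χ.q i j)⁻¹) (fun j => inv_ne_zero (q_ne_zero χ i j)) (fun j => ?_)
      (fun j => ?_)).eq
    · rw [genU_mul, genU_mul, K_E, map_smul, smul_smul, inv_mul_cancel₀ (q_ne_zero χ i j), one_smul]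
    · rw [genU_mul, genU_mul, F_K, map_smul, inv_inv]
  · rw [comulOpU_apply, comulU_genU]
    simp only [comulGen, Algebra.TensorProduct.map_tmul, TensorProduct.comm_tmul]
    refine key _ _ _ (hL i).eq (pairOp_commute_torus φ B (N + 1) (genU χ (.L i))
      (fun j => χ.q j i) (fun j => q_ne_zero χ j i) (fun j => ?_) (fun j => ?_)).eq
    · rw [genU_mul, genU_mul, E_L, map_smul]
    · rw [genU_mul, genU_mul, L_F, map_smul, smul_smul, inv_mul_cancel₀ (q_ne_zero χ j i), one_smul]

end pair

end

section

variable {k : Type*} [Field k] {θ : ℕ} {χ : Bicharacter k θ}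

/-! ### Coproducts of the canonical element -/

section fusion

variable {R : Type*} [Ring R] [Algebra k R]

/-- The algebra map `x ↦ K^{deg x} ⊗ x` followed by a representation. -/
def coactPlusRep (φ : SmallU χ ⊗[k] SmallU χ →ₐ[k] R) : TV k θ →ₐ[k] R :=
  φ.comp ((Algebra.TensorProduct.map (mkU χ) (mkU χ)).comp (coactPlus χ))

theorem coactPlusRep_homog (φ : SmallU χ ⊗[k] SmallU χ →ₐ[k] R) {β : Fin θ → ℕ} {x : TV k θ}
    (hx : x ∈ homog k β) :
    coactPlusRep φ x = φ (mkU χ (powK χ (toInt β)) ⊗ₜ 1) * plusR φ x := by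
  simp only [coactPlusRep, AlgHom.comp_apply, coactPlus_homog χ x hx,
    Algebra.TensorProduct.map_tmul]
  exact map_tmul_eq φ _ _

theorem coactPlusRep_ι (φ : SmallU χ ⊗[k] SmallU χ →ₐ[k] R) (i : Fin θ) :
    coactPlusRep φ (FreeAlgebra.ι k i) =
      φ (genU χ (.K i) ⊗ₜ 1) * plusR φ (FreeAlgebra.ι k i) := by
  simp only [coactPlusRep, AlgHom.comp_apply, coactPlus, FreeAlgebra.lift_ι_apply,
    Algebra.TensorProduct.map_tmul, plusR_apply, plusHom_ι]
  exact map_tmul_eq φ _ _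

/-- On homogeneous elements this map is `plusR φ` up to a torus factor on the left, and gradedness
of `𝓘⁺` reduces the ideal condition to that case. -/
theorem isAdmissible_coactPlusRep {φ : SmallU χ ⊗[k] SmallU χ →ₐ[k] R} {N : ℕ}
    (he : IsAdmissible χ N (plusR φ).toLinearMap) :
    IsAdmissible χ N (coactPlusRep φ).toLinearMap := by
  refine ⟨fun x hx => ?_, fun l hl => ?_⟩
  · suffices h : idealPlus χ ≤ LinearMap.ker (coactPlusRep φ).toLinearMap from h hx
    refine idealPlus_isBraidedHopfIdeal.graded.trans (iSup_le fun β b hb => ?_)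
    have := he.ideal b hb.1
    rw [AlgHom.toLinearMap_apply] at this
    rw [LinearMap.mem_ker, AlgHom.toLinearMap_apply, coactPlusRep_homog φ hb.2, this, mul_zero]
  · have := he.nil l hl
    rw [AlgHom.toLinearMap_apply] at this
    rw [AlgHom.toLinearMap_apply, coactPlusRep_homog φ (word_mem_homog l), this, mul_zero]

/-- The bosonization formula `Δ(x) = x₁ K^{deg x₂} ⊗ x₂`, read as a convolution so that `pairOp_mul`
applies. -/
theorem mul'_plusL_coactPlusRep (φ : SmallU χ ⊗[k] SmallU χ →ₐ[k] R) (x : TV k θ) :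
    LinearMap.mul' k R (TensorProduct.map (plusL φ).toLinearMap (coactPlusRep φ).toLinearMap
      (braidedComul χ x)) = φ (comulU χ (plusHom χ x)) := by
  change _ = φ (comulU χ (mkU χ (plusToBigU χ x)))
  rw [comulU_mkU, comul_plus]
  generalize braidedComul χ x = t
  induction t with
  | zero => simp
  | add a b ha hb => simp only [map_add, ha, hb]
  | tmul a b =>
    rw [bosonPlus_tmul, map_mul, map_mul, Algebra.TensorProduct.map_tmul, map_one]
    rfl

/-- The image of `(Δ ⊗ id)(𝓒)`, where `g` is a diagonal operator. -/
theorem pairOp_comul_left (B : HomogBases χ) {N : ℕ} (φ : SmallU χ ⊗[k] SmallU χ →ₐ[k] R)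
    (f : TV k θ →ₐ[k] R) (h1 : IsAdmissible χ N (plusL φ).toLinearMap)
    (h2 : IsAdmissible χ N (plusR φ).toLinearMap)
    (h3 : IsAdmissible χ N (φ.comp ((comulU χ).comp (plusHom χ))).toLinearMap)
    (hf : ∀ y ∈ idealMinus χ, f y = 0) (hc : ∀ t y, Commute (φ t) (f y)) {g g' : R}
    (hg : g' * g = 1) (hgE : ∀ b, Commute (φ (1 ⊗ₜ b)) g)
    (hgF : ∀ i, f (FreeAlgebra.ι k i) * g =
      g * (φ (genU χ (.K i) ⊗ₜ 1) * f (FreeAlgebra.ι k i))) :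
    pairOp B N (φ.comp ((comulU χ).comp (plusHom χ))).toLinearMap f.toLinearMap =
      pairOp B N (plusL φ).toLinearMap f.toLinearMap * g' *
        pairOp B N (plusR φ).toLinearMap f.toLinearMap * g := by
  let f' : TV k θ →ₐ[k] R := FreeAlgebra.lift k fun i =>
    φ (genU χ (.K i) ⊗ₜ 1) * f (FreeAlgebra.ι k i)
  -- Passing `g` through the canonical operator attaches `K_i` to every letter on the `f` side. The
  -- twist moves these factors to the `E` side, where they form `coactPlusRep`.
  have hconj := pairOp_conj B N (e := plusR φ) (e' := plusR φ) (f := f) (f' := f') (g := g)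
    (fun i => (hgE _).eq) (fun i => by simp only [f', FreeAlgebra.lift_ι_apply, hgF])
  have htwist := pairOp_twist B N (e := plusR φ) (e' := coactPlusRep φ) (f := f) (f' := f')
    (z := fun i => φ (genU χ (.K i) ⊗ₜ 1))
    (fun i j => by
      simp only [Commute, SemiconjBy, ← map_mul, Algebra.TensorProduct.tmul_mul_tmul, mul_one,
        genU_mul, gen_comm χ _ _ (.K i) (.K j)])
    (fun i j => commute_tmul φ _ _) (fun i j => hc _ _) (coactPlusRep_ι φ)
    (fun i => by simp only [f', FreeAlgebra.lift_ι_apply])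
  rw [mul_assoc, hconj, ← htwist, mul_assoc, ← mul_assoc g', hg, one_mul,
    pairOp_mul B f h1 (isAdmissible_coactPlusRep h2) h3 hf (fun x y => hc _ y)
      (mul'_plusL_coactPlusRep φ)]

/-- The algebra map `y ↦ y ⊗ L^{deg y}` followed by a representation. -/
def coactMinusRep (φ : SmallU χ ⊗[k] SmallU χ →ₐ[k] R) : TV k θ →ₐ[k] R :=
  φ.comp ((Algebra.TensorProduct.map (mkU χ) (mkU χ)).comp (coactMinus χ))

theorem coactMinusRep_ι (φ : SmallU χ ⊗[k] SmallU χ →ₐ[k] R) (i : Fin θ) :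
    coactMinusRep φ (FreeAlgebra.ι k i) =
      φ (1 ⊗ₜ genU χ (.L i)) * minusL φ (FreeAlgebra.ι k i) := by
  simp only [coactMinusRep, AlgHom.comp_apply, coactMinus, FreeAlgebra.lift_ι_apply,
    Algebra.TensorProduct.map_tmul, minusL_apply, minusHom_ι, ← map_mul,
    Algebra.TensorProduct.tmul_mul_tmul, one_mul, mul_one]
  rfl

theorem coactMinusRep_idealMinus (φ : SmallU χ ⊗[k] SmallU χ →ₐ[k] R) (y : TV k θ)
    (hy : y ∈ idealMinus χ) : coactMinusRep φ y = 0 := by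
  obtain ⟨x, hx, rfl⟩ := hy
  suffices h : idealPlus χ ≤ LinearMap.ker ((coactMinusRep φ).toLinearMap.comp (rev k θ)) from h hx
  refine idealPlus_isBraidedHopfIdeal.graded.trans (iSup_le fun β b hb => ?_)
  simp only [coactMinusRep, LinearMap.mem_ker, LinearMap.comp_apply, AlgHom.toLinearMap_apply,
    AlgHom.comp_apply, coactMinus_homog χ b hb.2, Algebra.TensorProduct.map_tmul,
    mkU_rev χ b hb.1, TensorProduct.zero_tmul, map_zero]

/-- For `y ∈ T(V)` one has `Δ(Ω y) = Ω(y₁) ⊗ Ω(y₂) L^{deg y₁}`. The factor `1 ⊗ Ω(y₂)` is written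
first, which is why the flipped coproduct `comulRev` appears. -/
theorem mul'_minusR_coactMinusRep (φ : SmallU χ ⊗[k] SmallU χ →ₐ[k] R) :
    (LinearMap.mul' k R).comp ((TensorProduct.map (minusR φ).toLinearMap
      (coactMinusRep φ).toLinearMap).comp (comulRev χ)) =
      (φ.comp ((comulU χ).comp (minusHom χ))).toLinearMap := by
  ext1 y
  change _ = φ (comulU χ (mkU χ (minusToBigU χ y)))
  rw [comulU_mkU, ← rev_rev y, comul_minus]
  simp only [comulRev, LinearMap.comp_apply, LinearEquiv.coe_coe, rev_rev]
  generalize braidedComul χ (rev k θ y) = t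
  induction t with
  | zero => simp
  | add a b ha hb => simp only [map_add, ha, hb]
  | tmul a b =>
    rw [bosonMinus_tmul, map_mul, map_mul, Algebra.TensorProduct.map_tmul, map_one]
    rfl

/-- The image of `(id ⊗ Δ)(𝓒)`, where `g` is a diagonal operator. -/
theorem pairOp_comul_right (B : HomogBases χ) {N : ℕ} (φ : SmallU χ ⊗[k] SmallU χ →ₐ[k] R)
    (e : TV k θ →ₐ[k] R) (he : IsAdmissible χ N e.toLinearMap)
    (hc : ∀ x t, Commute (e x) (φ t)) {g g' : R}
    (hg : g' * g = 1) (hgF : ∀ b, Commute (φ (b ⊗ₜ 1)) g)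
    (hgE : ∀ i, e (FreeAlgebra.ι k i) * g =
      g * (φ (1 ⊗ₜ genU χ (.L i)) * e (FreeAlgebra.ι k i))) :
    pairOp B N e.toLinearMap (φ.comp ((comulU χ).comp (minusHom χ))).toLinearMap =
      pairOp B N e.toLinearMap (minusR φ).toLinearMap * g' *
        pairOp B N e.toLinearMap (minusL φ).toLinearMap * g := by
  let e' : TV k θ →ₐ[k] R := FreeAlgebra.lift k fun i =>
    φ (1 ⊗ₜ genU χ (.L i)) * e (FreeAlgebra.ι k i)
  -- Dual to `pairOp_comul_left`: conjugation by `g` attaches `L_i` to the letters of the `E` side,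
  -- and the twist moves them to the `F` side.
  have hconj := pairOp_conj B N (e := e) (e' := e') (f := minusL φ) (f' := minusL φ) (g := g)
    (fun i => by simp only [e', FreeAlgebra.lift_ι_apply, hgE]) (fun i => (hgF _).eq)
  have htwist := pairOp_twist B N (e := e) (e' := e') (f := minusL φ) (f' := coactMinusRep φ)
    (z := fun i => φ (1 ⊗ₜ genU χ (.L i)))
    (fun i j => by
      simp only [Commute, SemiconjBy, ← map_mul, Algebra.TensorProduct.tmul_mul_tmul, mul_one,
        genU_mul, gen_comm χ _ _ (.L i) (.L j)])
    (fun i j => (hc _ _).symm) (fun i j => (commute_tmul φ _ _).symm)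
    (fun i => by simp only [e', FreeAlgebra.lift_ι_apply]) (coactMinusRep_ι φ)
  rw [mul_assoc, hconj, htwist, mul_assoc, ← mul_assoc g', hg, one_mul,
    pairOp_mul_comulRev B e he (minusR_idealMinus φ) (coactMinusRep_idealMinus φ)
      (fun x y => (hc x _).symm), mul'_minusR_coactMinusRep]

theorem map_pairOp {R' : Type*} [Ring R'] [Algebra k R'] (ψ : R →ₐ[k] R') (B : HomogBases χ)
    (N : ℕ) (e f : TV k θ →ₐ[k] R) : ψ (pairOp B N e.toLinearMap f.toLinearMap) =
      pairOp B N (ψ.comp e).toLinearMap (ψ.comp f).toLinearMap := by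
  simp only [pairOp]
  generalize canon B N = t
  induction t with
  | zero => simp
  | add a b ha hb => simp only [map_add, ha, hb]
  | tmul a b => simp

end fusion

/-! ### Operators on threefold tensor products -/

section legs

variable {V₁ : Type*} [AddCommGroup V₁] [Module k V₁] {V₂ : Type*} [AddCommGroup V₂] [Module k V₂]
  {V₃ : Type*} [AddCommGroup V₃] [Module k V₃]

/-- `F ↦ F^{(1,2)}` as an algebra map. -/
def leg₁₂Hom (V₃ : Type*) [AddCommGroup V₃] [Module k V₃] :
    Module.End k (V₁ ⊗[k] V₂) →ₐ[k] Module.End k (V₁ ⊗[k] V₂ ⊗[k] V₃) where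
  toFun := leg₁₂ V₃
  map_one' := TensorProduct.map_id
  map_mul' F G := by
    refine TensorProduct.ext' fun x y => ?_
    simp [leg₁₂]
  map_zero' := TensorProduct.map_zero_left _
  map_add' F G := TensorProduct.map_add_left _ _ _
  commutes' c := by
    refine TensorProduct.ext' fun x y => ?_
    simp [leg₁₂, Module.algebraMap_end_apply, TensorProduct.smul_tmul']

/-- `F ↦ F^{(1,3)}` as an algebra map. -/
def leg₁₃Hom (V₂ : Type*) [AddCommGroup V₂] [Module k V₂] :
    Module.End k (V₁ ⊗[k] V₃) →ₐ[k] Module.End k (V₁ ⊗[k] V₂ ⊗[k] V₃) where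
  toFun := leg₁₃ V₂
  map_one' := by ext; simp [leg₁₃]
  map_mul' F G := by
    refine LinearMap.ext fun x => ?_
    simp only [leg₁₃, LinearMap.comp_apply, LinearEquiv.coe_coe, Module.End.mul_apply,
      LinearEquiv.apply_symm_apply]
    rw [← Module.End.mul_apply, Module.End.mul_eq_comp, Module.End.mul_eq_comp,
      ← TensorProduct.map_comp, LinearMap.id_comp]
  map_zero' := by ext; simp [leg₁₃]
  map_add' F G := by ext; simp [leg₁₃, TensorProduct.add_tmul]
  commutes' c := by
    ext
    simp [leg₁₃, Module.algebraMap_end_apply, ← TensorProduct.smul_tmul']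

/-- `F ↦ F^{(2,3)}` as an algebra map. -/
def leg₂₃Hom (V₁ : Type*) [AddCommGroup V₁] [Module k V₁] :
    Module.End k (V₂ ⊗[k] V₃) →ₐ[k] Module.End k (V₁ ⊗[k] V₂ ⊗[k] V₃) where
  toFun := leg₂₃ V₁
  map_one' := by ext; simp [leg₂₃]
  map_mul' F G := by
    refine LinearMap.ext fun x => ?_
    simp only [leg₂₃, LinearMap.comp_apply, LinearEquiv.coe_coe, Module.End.mul_apply,
      LinearEquiv.apply_symm_apply]
    rw [← Module.End.mul_apply, Module.End.mul_eq_comp, Module.End.mul_eq_comp,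
      ← TensorProduct.map_comp, LinearMap.id_comp]
  map_zero' := by ext; simp [leg₂₃]
  map_add' F G := by ext; simp [leg₂₃, TensorProduct.tmul_add]
  commutes' c := by
    ext
    simp [leg₂₃, Module.algebraMap_end_apply]

theorem leg₁₃_map (a : Module.End k V₁) (c : Module.End k V₃) :
    leg₁₃ V₂ (TensorProduct.map a c) = TensorProduct.map (TensorProduct.map a 1) c := by
  ext; simp [leg₁₃]

theorem leg₂₃_map (b : Module.End k V₂) (c : Module.End k V₃) :
    leg₂₃ V₁ (TensorProduct.map b c) = TensorProduct.map (TensorProduct.map 1 b) c := by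
  ext; simp [leg₂₃]

theorem commute_leg₁₂ (F : Module.End k (V₁ ⊗[k] V₂)) (c : Module.End k V₃) :
    Commute (leg₁₂ V₃ F) (TensorProduct.map 1 c) := by
  refine TensorProduct.ext' fun x y => ?_
  simp [leg₁₂]

theorem commute_leg₁₃ (F : Module.End k (V₁ ⊗[k] V₃)) (b : Module.End k V₂) :
    Commute (TensorProduct.map (TensorProduct.map 1 b) 1) (leg₁₃ V₂ F) := by
  have h : TensorProduct.map (TensorProduct.map 1 b) 1 =
      (TensorProduct.rightComm k V₁ V₂ V₃).symm.toLinearMap ∘ₗ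
    (TensorProduct.map LinearMap.id b : Module.End k (V₁ ⊗[k] V₃ ⊗[k] V₂)) ∘ₗ
    (TensorProduct.rightComm k V₁ V₂ V₃).toLinearMap := by
    ext; simp
  rw [h]
  refine LinearMap.ext fun x => ?_
  simp only [leg₁₃, LinearMap.comp_apply, LinearEquiv.coe_coe, Module.End.mul_apply,
    LinearEquiv.apply_symm_apply]
  rw [← LinearMap.comp_apply (TensorProduct.map _ _), ← LinearMap.comp_apply (TensorProduct.map _ _),
    ← TensorProduct.map_comp, ← TensorProduct.map_comp]
  simp

theorem commute_leg₂₃ (F : Module.End k (V₂ ⊗[k] V₃)) (a : Module.End k V₁) :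
    Commute (TensorProduct.map (TensorProduct.map a 1) 1) (leg₂₃ V₁ F) := by
  have h : TensorProduct.map (TensorProduct.map a 1) 1 =
      (TensorProduct.assoc k V₁ V₂ V₃).symm.toLinearMap ∘ₗ
    (TensorProduct.map a LinearMap.id : Module.End k (V₁ ⊗[k] (V₂ ⊗[k] V₃))) ∘ₗ
    (TensorProduct.assoc k V₁ V₂ V₃).toLinearMap := by
    ext; simp
  rw [h]
  refine LinearMap.ext fun x => ?_
  simp only [leg₂₃, LinearMap.comp_apply, LinearEquiv.coe_coe, Module.End.mul_apply,
    LinearEquiv.apply_symm_apply]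
  rw [← LinearMap.comp_apply (TensorProduct.map _ _), ← LinearMap.comp_apply (TensorProduct.map _ _),
    ← TensorProduct.map_comp, ← TensorProduct.map_comp]
  simp

end legs

end

section

variable {k : Type*} [Field k] {θ : ℕ} {χ : Bicharacter k θ}

/-! ### The operators on twofold tensor products -/

section twofold

variable {V₁ : Type*} [AddCommGroup V₁] [Module k V₁] {V₂ : Type*} [AddCommGroup V₂] [Module k V₂]
  (H₁ : HighestWeightModule χ V₁) (H₂ : HighestWeightModule χ V₂)

/-- The weight parts always span, so independence gives direct sum decompositions of both factors,
and the scalars can be prescribed on each pair of summands. -/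
theorem exists_isDiagonalOperator (h₁ : iSupIndep (weightPart H₁))
    (h₂ : iSupIndep (weightPart H₂)) : ∃ f, IsDiagonalOperator H₁ H₂ f := by
  classical
  let e₁ := LinearEquiv.ofBijective (DirectSum.coeLinearMap (weightPart H₁))
    (DirectSum.isInternal_submodule_of_iSupIndep_of_iSup_eq_top h₁ (iSup_weightPart H₁))
  let e₂ := LinearEquiv.ofBijective (DirectSum.coeLinearMap (weightPart H₂))
    (DirectSum.isInternal_submodule_of_iSupIndep_of_iSup_eq_top h₂ (iSup_weightPart H₂))
  have he₁ : ∀ α (u : weightPart H₁ α), e₁.symm u = DirectSum.lof k _ _ α u := fun α u => by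
    rw [LinearEquiv.symm_apply_eq]
    exact (DirectSum.coeLinearMap_lof _ _ _).symm
  have he₂ : ∀ α (u : weightPart H₂ α), e₂.symm u = DirectSum.lof k _ _ α u := fun α u => by
    rw [LinearEquiv.symm_apply_eq]
    exact (DirectSum.coeLinearMap_lof _ _ _).symm
  let b := DirectSum.toModule k (Fin θ → ℕ) _ fun α => LinearMap.flip
    (DirectSum.toModule k (Fin θ → ℕ) _ fun β => LinearMap.flip (diagScalar H₁ H₂ α β •
      (TensorProduct.mk k V₁ V₂).compl₁₂ (weightPart H₁ α).subtype (weightPart H₂ β).subtype))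
  have hb : ∀ α β (u : weightPart H₁ α) (w : weightPart H₂ β),
      b (DirectSum.lof k _ _ α u) (DirectSum.lof k _ _ β w) =
        diagScalar H₁ H₂ α β • ((u : V₁) ⊗ₜ (w : V₂)) := fun α β u w => by
    simp [b]
  refine ⟨TensorProduct.lift (b.compl₁₂ e₁.symm.toLinearMap e₂.symm.toLinearMap),
    fun α β X hX Y hY => ?_⟩
  have h := hb α β ⟨_, ⟨X, hX, rfl⟩⟩ ⟨_, ⟨Y, hY, rfl⟩⟩
  rw [← he₁, ← he₂] at h
  exact h

theorem IsAdmissible.of_ker {N : ℕ} {R R' : Type*} [Ring R] [Algebra k R] [Ring R'] [Algebra k R']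
    {e : TV k θ →ₗ[k] R} {e' : TV k θ →ₗ[k] R'} (he : IsAdmissible χ N e)
    (h : ∀ x, e x = 0 → e' x = 0) : IsAdmissible χ N e' :=
  ⟨fun x hx => h x (he.ideal x hx), fun l hl => h _ (he.nil l hl)⟩

theorem IsAdmissible.finite {N : ℕ} {R : Type*} [Ring R] [Algebra k R] {e : TV k θ →ₗ[k] R}
    (he : IsAdmissible χ N e) (f : TV k θ →ₗ[k] R) (B : HomogBases χ) :
    {β | LinearMap.mul' k R (TensorProduct.map e f (canonDeg B β)) ≠ 0}.Finite := by
  refine (finite_setOf_sum_le N).subset fun β hβ => ?_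
  by_contra h
  exact hβ (by rw [he.map_canonDeg f B (not_le.1 h), map_zero])

variable {H₁} in
theorem isAdmissible_plusL_rep₂ {N : ℕ} (h : IsAdmissible χ N (actPlus H₁).toLinearMap) :
    IsAdmissible χ N (plusL (rep₂ H₁ H₂)).toLinearMap :=
  h.of_ker fun x hx => by
    rw [AlgHom.toLinearMap_apply] at hx ⊢
    rw [plusL_apply, rep₂_tmul]
    change TensorProduct.map (actPlus H₁ x) _ = 0
    rw [hx, TensorProduct.map_zero_left]

variable {H₁ H₂} in
theorem opC_eq (B : HomogBases χ) {N : ℕ} (h : IsAdmissible χ N (actPlus H₁).toLinearMap) :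
    opC B H₁ H₂ = pairOp B N (plusL (rep₂ H₁ H₂)).toLinearMap
      (minusR (rep₂ H₁ H₂)).toLinearMap := by
  simp only [opC, map_canonical]
  exact finsum_canonDeg B (isAdmissible_plusL_rep₂ H₂ h) _

variable {H₁ H₂} in
theorem opC'_eq (B : HomogBases χ) {N : ℕ} (h : IsAdmissible χ N (actPlus H₁).toLinearMap) :
    opC' B H₁ H₂ = pairOp B N ((plusL (rep₂ H₁ H₂)).toLinearMap.comp (braidedAntipode χ))
      (minusR (rep₂ H₁ H₂)).toLinearMap := by
  simp only [opC', map_canonical']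
  exact finsum_canonDeg B (isAdmissible_plusL_rep₂ H₂ h).antipode _

variable [FiniteDimensional k V₁]

theorem finite_canonical (B : HomogBases χ) : {β | rep₂ H₁ H₂ (canonical B β) ≠ 0}.Finite := by
  obtain ⟨N, hN⟩ := exists_isAdmissible_actPlus H₁
  simp only [map_canonical]
  exact (isAdmissible_plusL_rep₂ H₂ hN).finite _ B

theorem finite_canonical' (B : HomogBases χ) : {β | rep₂ H₁ H₂ (canonical' B β) ≠ 0}.Finite := by
  obtain ⟨N, hN⟩ := exists_isAdmissible_actPlus H₁
  simp only [map_canonical']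
  exact (isAdmissible_plusL_rep₂ H₂ hN).antipode.finite _ B

theorem opC_mul_opC' (B : HomogBases χ) : opC B H₁ H₂ * opC' B H₁ H₂ = 1 := by
  obtain ⟨N, hN⟩ := exists_isAdmissible_actPlus H₁
  rw [opC_eq B hN, opC'_eq B hN, pairOp_mul_antipode _ B (isAdmissible_plusL_rep₂ H₂ hN)]

theorem opC'_mul_opC (B : HomogBases χ) : opC' B H₁ H₂ * opC B H₁ H₂ = 1 := by
  obtain ⟨N, hN⟩ := exists_isAdmissible_actPlus H₁
  rw [opC_eq B hN, opC'_eq B hN, pairOp_antipode_mul _ B (isAdmissible_plusL_rep₂ H₂ hN)]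

variable [FiniteDimensional k V₂] {H₁ H₂}

theorem isUnit_opR (B : HomogBases χ) {f : Module.End k (V₁ ⊗[k] V₂)}
    (hf : IsDiagonalOperator H₁ H₂ f) : IsUnit (opR B H₁ H₂ f) :=
  IsUnit.mul ⟨⟨_, _, opC_mul_opC' H₁ H₂ B, opC'_mul_opC H₁ H₂ B⟩, rfl⟩ hf.isUnit.ringInverse

theorem opR_intertwine (B : HomogBases χ) {f : Module.End k (V₁ ⊗[k] V₂)}
    (hf : IsDiagonalOperator H₁ H₂ f) (X : SmallU χ) :
    opR B H₁ H₂ f * rep₂ H₁ H₂ (comulU χ X) = rep₂ H₁ H₂ (comulOpU χ X) * opR B H₁ H₂ f := by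
  obtain ⟨N, hN⟩ := exists_isAdmissible_actPlus H₁
  -- The operator does not depend on the truncation; the bound `N + 1` leaves the room needed for
  -- the commutator with `F_i`.
  rw [opR, opC_eq B (hN.mono N.le_succ)]
  refine pairOp_intertwine _ B (isAdmissible_plusL_rep₂ H₂ hN)
    (Ring.mul_inverse_cancel _ hf.isUnit) (Ring.inverse_mul_cancel _ hf.isUnit)
    (fun i => ?_) (fun i => ?_) (fun i => ?_) (fun i => ?_) (fun i => ?_) (fun i => ?_) X
  all_goals simp only [rep₂_tmul, map_one]
  · exact hf.E_left i
  · exact hf.E_right i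
  · exact hf.F_left i
  · exact hf.F_right i
  · exact hf.commute_K i
  · exact hf.commute_L i

end twofold

end

section

variable {k : Type*} [Field k] {θ : ℕ} {χ : Bicharacter k θ}

/-! ### Triples of commuting representations -/

section triple

variable {R : Type*} [Ring R] [Algebra k R]

/-- The pairs `(1,2)`, `(1,3)` and `(2,3)` of three commuting representations. -/
structure IsTriple (φ₁₂ φ₁₃ φ₂₃ : SmallU χ ⊗[k] SmallU χ →ₐ[k] R) : Prop where
  fst : ∀ a, φ₁₂ (a ⊗ₜ 1) = φ₁₃ (a ⊗ₜ 1)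
  snd : ∀ a, φ₁₂ (1 ⊗ₜ a) = φ₂₃ (a ⊗ₜ 1)
  thd : ∀ a, φ₁₃ (1 ⊗ₜ a) = φ₂₃ (1 ⊗ₜ a)
  commute_thd : ∀ t a, Commute (φ₁₂ t) (φ₁₃ (1 ⊗ₜ a))
  commute_fst : ∀ a t, Commute (φ₁₂ (a ⊗ₜ 1)) (φ₂₃ t)

/-- The commutation rules of a diagonal operator. -/
structure IsDiagonalFor (φ : SmallU χ ⊗[k] SmallU χ →ₐ[k] R) (g : R) : Prop where
  E_left : ∀ i, φ (genU χ (.E i) ⊗ₜ 1) * g = g * φ (genU χ (.E i) ⊗ₜ genU χ (.L i))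
  F_left : ∀ i, φ (genU χ (.F i) ⊗ₜ genU χ (.L i)) * g = g * φ (genU χ (.F i) ⊗ₜ 1)
  F_right : ∀ i, φ (1 ⊗ₜ genU χ (.F i)) * g = g * φ (genU χ (.K i) ⊗ₜ genU χ (.F i))
  L_right : ∀ i, Commute (φ (1 ⊗ₜ genU χ (.L i))) g

/-- The operator attached to the canonical element. -/
def canonOp (B : HomogBases χ) (N : ℕ) (φ : SmallU χ ⊗[k] SmallU χ →ₐ[k] R) : R :=
  pairOp B N (plusL φ).toLinearMap (minusR φ).toLinearMap

variable {φ₁₂ φ₁₃ φ₂₃ : SmallU χ ⊗[k] SmallU χ →ₐ[k] R} (B : HomogBases χ) {N : ℕ}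

theorem IsTriple.plusL₁₂ (hT : IsTriple φ₁₂ φ₁₃ φ₂₃) : plusL φ₁₂ = plusL φ₁₃ :=
  AlgHom.ext fun _ => hT.fst _

theorem IsTriple.plusR₁₂ (hT : IsTriple φ₁₂ φ₁₃ φ₂₃) : plusR φ₁₂ = plusL φ₂₃ :=
  AlgHom.ext fun _ => hT.snd _

theorem IsTriple.minusR₁₂ (hT : IsTriple φ₁₂ φ₁₃ φ₂₃) : minusR φ₁₂ = minusL φ₂₃ :=
  AlgHom.ext fun _ => hT.snd _

theorem IsTriple.minusR₁₃ (hT : IsTriple φ₁₂ φ₁₃ φ₂₃) : minusR φ₁₃ = minusR φ₂₃ :=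
  AlgHom.ext fun _ => hT.thd _

theorem IsTriple.pairOp_comulLeft (hT : IsTriple φ₁₂ φ₁₃ φ₂₃)
    (h₁ : IsAdmissible χ N (plusL φ₁₂).toLinearMap)
    (h₂ : IsAdmissible χ N (plusR φ₁₂).toLinearMap)
    (h₁₂ : IsAdmissible χ N (φ₁₂.comp ((comulU χ).comp (plusHom χ))).toLinearMap)
    {b b' : R} (hb : IsDiagonalFor φ₁₃ b) (hb₂ : ∀ a, Commute (φ₁₂ (1 ⊗ₜ a)) b)
    (hb' : b' * b = 1) :
    pairOp B N (φ₁₂.comp ((comulU χ).comp (plusHom χ))).toLinearMap (minusR φ₁₃).toLinearMap =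
      canonOp B N φ₁₃ * b' * canonOp B N φ₂₃ * b := by
  rw [canonOp, canonOp, pairOp_comul_left B φ₁₂ (minusR φ₁₃) h₁ h₂ h₁₂ (minusR_idealMinus _)
    (fun t y => hT.commute_thd t _) hb' hb₂ (fun i => ?_), hT.plusL₁₂, hT.plusR₁₂, hT.minusR₁₃]
  rw [minusR_apply, minusHom_ι, hT.fst, ← map_tmul_eq]
  exact hb.F_right i

theorem IsTriple.pairOp_comulRight (hT : IsTriple φ₁₂ φ₁₃ φ₂₃)
    (h₁ : IsAdmissible χ N (plusL φ₁₂).toLinearMap)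
    {b b' : R} (hb : IsDiagonalFor φ₁₃ b) (hb₂ : ∀ a, Commute (φ₁₂ (1 ⊗ₜ a)) b)
    (hb' : b' * b = 1) :
    pairOp B N (plusL φ₁₂).toLinearMap (φ₂₃.comp ((comulU χ).comp (minusHom χ))).toLinearMap =
      canonOp B N φ₁₃ * b' * canonOp B N φ₁₂ * b := by
  rw [canonOp, canonOp, pairOp_comul_right B φ₂₃ (plusL φ₁₂) h₁ (fun x t => hT.commute_fst _ t) hb'
    (fun a => by rw [← hT.snd]; exact hb₂ a) (fun i => ?_), hT.minusR₁₂, ← hT.minusR₁₃, hT.plusL₁₂]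
  rw [plusL_apply, plusHom_ι, hT.fst, ← hT.thd, ← (commute_tmul _ _ _).eq, ← map_tmul_eq]
  exact hb.E_left i

/-- The flip turns `τ ∘ Δ` into `Δ` for the representation with legs 1 and 2 exchanged, to which
`pairOp_comul_left` applies with `c` in place of `b`. -/
theorem IsTriple.pairOp_comulLeft_op (hT : IsTriple φ₁₂ φ₁₃ φ₂₃)
    (h₁ : IsAdmissible χ N (plusL φ₁₂).toLinearMap)
    (h₂ : IsAdmissible χ N (plusR φ₁₂).toLinearMap)
    (h₁₂ : IsAdmissible χ N (φ₁₂.comp ((comulOpU χ).comp (plusHom χ))).toLinearMap)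
    {c c' : R} (hc : IsDiagonalFor φ₂₃ c) (hc₁ : ∀ a, Commute (φ₁₂ (a ⊗ₜ 1)) c)
    (hc' : c' * c = 1) :
    pairOp B N (φ₁₂.comp ((comulOpU χ).comp (plusHom χ))).toLinearMap (minusR φ₁₃).toLinearMap =
      canonOp B N φ₂₃ * c' * canonOp B N φ₁₃ * c := by
  let φ₂₁ := φ₁₂.comp (Algebra.TensorProduct.comm k (SmallU χ) (SmallU χ)).toAlgHom
  have hL : plusL φ₂₁ = plusL φ₂₃ := AlgHom.ext fun x => hT.snd (plusHom χ x)
  have hR : plusR φ₂₁ = plusL φ₁₃ := AlgHom.ext fun x => hT.fst (plusHom χ x)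
  rw [hT.plusR₁₂, ← hL] at h₂
  rw [hT.plusL₁₂, ← hR] at h₁
  have h := pairOp_comul_left B φ₂₁ (minusR φ₁₃) h₂ h₁ h₁₂ (minusR_idealMinus _)
    (fun t y => hT.commute_thd _ _) hc' hc₁ (fun i => by
      rw [minusR_apply, minusHom_ι, hT.thd]
      change _ = _ * (φ₁₂ (1 ⊗ₜ _) * _)
      rw [hT.snd, ← map_tmul_eq]
      exact hc.F_right i)
  rw [hL, hR, hT.minusR₁₃] at h
  rw [canonOp, canonOp, hT.minusR₁₃]
  exact h

/-- Conjugation by `b` attaches `L_i` in leg 3 to each `E_i` in leg 1, while conjugation by `c`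
attaches the inverse of `L_i` in leg 3 to each `F_i` in leg 2. The degrees on the two sides agree,
so these factors cancel for the product `b c`, though not for `b` or `c` alone in general. -/
theorem IsTriple.commute_canonOp (hT : IsTriple φ₁₂ φ₁₃ φ₂₃) (N : ℕ) {b c : R}
    (hb : IsDiagonalFor φ₁₃ b) (hb₂ : ∀ a, Commute (φ₁₂ (1 ⊗ₜ a)) b)
    (hc : IsDiagonalFor φ₂₃ c) (hc₁ : ∀ a, Commute (φ₁₂ (a ⊗ₜ 1)) c) :
    Commute (canonOp B N φ₁₂) (b * c) := by
  let z : Fin θ → R := fun i => φ₂₃ (1 ⊗ₜ genU χ (.L i))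
  let z' : Fin θ → R := fun i => φ₂₃ (1 ⊗ₜ genU χ (.Linv i))
  have hzz' : ∀ i, z i * z' i = 1 := fun i => by
    simp only [z, z', ← map_mul, Algebra.TensorProduct.tmul_mul_tmul, one_mul, genU_mul, L_Linv,
      map_one, ← Algebra.TensorProduct.one_def]
  have hz'z : ∀ i, z' i * z i = 1 := fun i => by
    simp only [z, z', ← map_mul, Algebra.TensorProduct.tmul_mul_tmul, one_mul, genU_mul, Linv_L,
      map_one, ← Algebra.TensorProduct.one_def]
  have hz₁₂ : ∀ i t, Commute (φ₁₂ t) (z i) := fun i t => by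
    simp only [z, ← hT.thd]; exact hT.commute_thd t _
  let e' : TV k θ →ₐ[k] R := FreeAlgebra.lift k fun i => z i * plusL φ₁₂ (FreeAlgebra.ι k i)
  let f' : TV k θ →ₐ[k] R := FreeAlgebra.lift k fun i => z' i * minusR φ₁₂ (FreeAlgebra.ι k i)
  have hconj := pairOp_conj B N (e := plusL φ₁₂) (e' := e') (f := minusR φ₁₂) (f' := f')
    (g := b * c)
    (fun i => by
      have h := hb.E_left i
      rw [map_tmul_eq φ₁₃ (genU χ (.E i)) (genU χ (.L i)), (commute_tmul _ _ _).eq, ← hT.fst,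
        hT.thd] at h
      simp only [e', FreeAlgebra.lift_ι_apply, plusL_apply, plusHom_ι]
      rw [← mul_assoc, h, mul_assoc, mul_assoc, (hc₁ _).eq, ← mul_assoc _ c, (hc.L_right i).eq]
      simp only [z, mul_assoc])
    (fun i => by
      have h := hc.F_left i
      rw [map_tmul_eq, (commute_tmul _ _ _).eq, ← hT.snd, mul_assoc] at h
      have hz'c : Commute (z' i) c := by
        have h := (hc.L_right i).eq
        calc z' i * c = z' i * (c * z i) * z' i := by rw [mul_assoc, mul_assoc, hzz', mul_one]
          _ = c * z' i := by rw [← h, ← mul_assoc (z' i), hz'z, one_mul]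
      have h' : φ₁₂ (1 ⊗ₜ genU χ (.F i)) * c = c * (z' i * φ₁₂ (1 ⊗ₜ genU χ (.F i))) := by
        rw [← mul_assoc c, ← hz'c.eq, mul_assoc, ← h, ← mul_assoc (z' i), hz'z, one_mul]
      simp only [f', FreeAlgebra.lift_ι_apply, minusR_apply, minusHom_ι]
      rw [← mul_assoc, (hb₂ _).eq, mul_assoc, h', mul_assoc])
  have htwist := pairOp_twist B N (e := plusL φ₁₂) (e' := e') (f := f') (f' := minusR φ₁₂)
    (z := z)
    (fun i j => by
      simp only [z, Commute, SemiconjBy, ← map_mul, Algebra.TensorProduct.tmul_mul_tmul, mul_one,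
        genU_mul, gen_comm χ _ _ (.L i) (.L j)])
    (fun i j => (hz₁₂ i _).symm)
    (fun i j => by
      simp only [f', FreeAlgebra.lift_ι_apply]
      refine Commute.mul_right ?_ (hz₁₂ i _).symm
      simp only [z, z', Commute, SemiconjBy, ← map_mul, Algebra.TensorProduct.tmul_mul_tmul,
        mul_one, genU_mul, gen_comm χ _ _ (.L i) (.Linv j)])
    (fun i => by simp only [e', FreeAlgebra.lift_ι_apply])
    (fun i => by simp only [f', FreeAlgebra.lift_ι_apply, ← mul_assoc, hzz', one_mul])
  rw [htwist] at hconj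
  exact hconj

/-- The Yang–Baxter equation. -/
theorem IsTriple.yangBaxter (hT : IsTriple φ₁₂ φ₁₃ φ₂₃)
    (h₁ : IsAdmissible χ N (plusL φ₁₂).toLinearMap)
    (h₂ : IsAdmissible χ N (plusR φ₁₂).toLinearMap)
    (h₁₂ : IsAdmissible χ N (φ₁₂.comp ((comulU χ).comp (plusHom χ))).toLinearMap)
    {a' b b' c c' : R}
    (hb : IsDiagonalFor φ₁₃ b) (hb₂ : ∀ x, Commute (φ₁₂ (1 ⊗ₜ x)) b)
    (hc : IsDiagonalFor φ₂₃ c) (hc₁ : ∀ x, Commute (φ₁₂ (x ⊗ₜ 1)) c)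
    (hbb' : b * b' = 1) (hb'b : b' * b = 1) (hcc' : c * c' = 1) (hc'c : c' * c = 1)
    (hab : Commute a' b) (hac : Commute a' c) (hbc : Commute b c)
    (hR : IsUnit (canonOp B N φ₁₂ * a'))
    (hRΔ : ∀ X, canonOp B N φ₁₂ * a' * φ₁₂ (comulU χ X) =
      φ₁₂ (comulOpU χ X) * (canonOp B N φ₁₂ * a'))
    (hR₃ : ∀ x, Commute (canonOp B N φ₁₂ * a') (φ₁₃ (1 ⊗ₜ x))) :
    canonOp B N φ₁₂ * a' * (canonOp B N φ₁₃ * b') * (canonOp B N φ₂₃ * c') =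
      canonOp B N φ₂₃ * c' * (canonOp B N φ₁₃ * b') * (canonOp B N φ₁₂ * a') := by
  have hRbc : Commute (canonOp B N φ₁₂ * a') (b * c) :=
    Commute.mul_left (hT.commute_canonOp B N hb hb₂ hc hc₁) (hab.mul_right hac)
  set r := canonOp B N φ₁₂ * a'
  -- Intertwining gives `φ₁₂(τΔ(X)) r = r φ₁₂(Δ(X))`; as `r` is invertible, the opposite action
  -- vanishes wherever the original one does.
  have hop : IsAdmissible χ N (φ₁₂.comp ((comulOpU χ).comp (plusHom χ))).toLinearMap :=
    h₁₂.of_ker fun x hx => by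
      refine hR.mul_left_injective ?_
      simp only [AlgHom.toLinearMap_apply, AlgHom.comp_apply] at hx ⊢
      rw [← hRΔ, hx, mul_zero, zero_mul]
  have hX := hT.pairOp_comulLeft B h₁ h₂ h₁₂ hb hb₂ hb'b
  have hZ := hT.pairOp_comulLeft_op B h₁ h₂ hop hc hc₁ hc'c
  -- `r` carries the image of `(Δ ⊗ id)(𝓒)` to that of `(τΔ ⊗ id)(𝓒)`, since it intertwines the
  -- first two legs and commutes with the third.
  have hconj := pairOp_conj B N (e := φ₁₂.comp ((comulOpU χ).comp (plusHom χ)))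
    (e' := φ₁₂.comp ((comulU χ).comp (plusHom χ))) (f := minusR φ₁₃) (f' := minusR φ₁₃) (g := r)
    (fun i => (hRΔ _).symm) (fun i => (hR₃ _).symm.eq)
  rw [hX, hZ] at hconj
  -- Since `r` commutes with `b c`, it commutes with the inverse `b' c' = c' b'`, and `c` then
  -- cancels `c'`.
  have hinv : c * (r * (b' * c')) = b' * r := by
    have h1 : b * c * (c' * b') = 1 := by
      rw [mul_assoc, ← mul_assoc c, hcc', one_mul, hbb']
    have h2 : c' * b' * (b * c) = 1 := by
      rw [mul_assoc, ← mul_assoc b', hb'b, one_mul, hc'c]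
    have h3 : b' * c' = c' * b' := by
      calc b' * c' = c' * b' * (b * c) * (b' * c') := by rw [h2, one_mul]
        _ = c' * b' * (c * b * (b' * c')) := by rw [hbc.eq, mul_assoc]
        _ = c' * b' := by rw [mul_assoc c, ← mul_assoc b, hbb', one_mul, hcc', mul_one]
    have h4 : r * (c' * b') = c' * b' * r := by
      calc r * (c' * b') = c' * b' * ((b * c) * r) * (c' * b') := by
            rw [← mul_assoc (c' * b'), h2, one_mul]
        _ = c' * b' * r * (b * c * (c' * b')) := by rw [← hRbc.eq]; simp only [mul_assoc]
        _ = _ := by rw [h1, mul_one]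
    rw [h3, h4, ← mul_assoc c, ← mul_assoc c, hcc', one_mul]
  calc r * (canonOp B N φ₁₃ * b') * (canonOp B N φ₂₃ * c')
      = r * (canonOp B N φ₁₃ * b' * canonOp B N φ₂₃ * b) * (b' * c') := by
        simp only [mul_assoc]
        rw [← mul_assoc b b', hbb', one_mul]
    _ = canonOp B N φ₂₃ * c' * (canonOp B N φ₁₃) * (c * (r * (b' * c'))) := by
        rw [← hconj]; simp only [mul_assoc]
    _ = _ := by rw [hinv]; simp only [mul_assoc]

end triple

end

section

variable {k : Type*} [Field k] {θ : ℕ} {χ : Bicharacter k θ}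

/-! ### The operators on threefold tensor products -/

section threefold

section pull

variable {V₁ : Type*} [AddCommGroup V₁] [Module k V₁] {V₂ : Type*} [AddCommGroup V₂] [Module k V₂]
  {H₁ : HighestWeightModule χ V₁} {H₂ : HighestWeightModule χ V₂}
  {R : Type*} [Ring R] [Algebra k R] (ψ : Module.End k (V₁ ⊗[k] V₂) →ₐ[k] R)

theorem map_opC (B : HomogBases χ) {N : ℕ} (h : IsAdmissible χ N (actPlus H₁).toLinearMap) :
    ψ (opC B H₁ H₂) = canonOp B N (ψ.comp (rep₂ H₁ H₂)) := by
  rw [opC_eq B h, map_pairOp]; rfl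

theorem IsDiagonalOperator.isDiagonalFor {f : Module.End k (V₁ ⊗[k] V₂)}
    (hf : IsDiagonalOperator H₁ H₂ f) : IsDiagonalFor (ψ.comp (rep₂ H₁ H₂)) (ψ f) where
  E_left i := by
    simp only [AlgHom.comp_apply, rep₂_tmul, map_one, ← map_mul]
    exact congrArg ψ (hf.E_left i)
  F_left i := by
    simp only [AlgHom.comp_apply, rep₂_tmul, map_one, ← map_mul]
    exact congrArg ψ (hf.F_left i)
  F_right i := by
    simp only [AlgHom.comp_apply, rep₂_tmul, map_one, ← map_mul]
    exact congrArg ψ (hf.F_right i)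
  L_right i := by
    simp only [AlgHom.comp_apply, rep₂_tmul, map_one]
    exact (hf.commute_L_right i).map ψ

end pull

variable {V₁ : Type*} [AddCommGroup V₁] [Module k V₁] {V₂ : Type*} [AddCommGroup V₂] [Module k V₂]
  {V₃ : Type*} [AddCommGroup V₃] [Module k V₃]
  (H₁ : HighestWeightModule χ V₁) (H₂ : HighestWeightModule χ V₂) (H₃ : HighestWeightModule χ V₃)

/-- The algebra of endomorphisms of a threefold tensor product. -/
def End₃ (k V₁ V₂ V₃ : Type*) [Field k] [AddCommGroup V₁] [Module k V₁] [AddCommGroup V₂]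
    [Module k V₂] [AddCommGroup V₃] [Module k V₃] := Module.End k (V₁ ⊗[k] V₂ ⊗[k] V₃)

instance : Ring (End₃ k V₁ V₂ V₃) :=
  inferInstanceAs (Ring (Module.End k (V₁ ⊗[k] V₂ ⊗[k] V₃)))

instance : Algebra k (End₃ k V₁ V₂ V₃) :=
  inferInstanceAs (Algebra k (Module.End k (V₁ ⊗[k] V₂ ⊗[k] V₃)))

/-- `F ↦ F^{(1,2)}` with values in `End₃`. -/
def ext₁₂ (V₃ : Type*) [AddCommGroup V₃] [Module k V₃] :
    Module.End k (V₁ ⊗[k] V₂) →ₐ[k] End₃ k V₁ V₂ V₃ := leg₁₂Hom V₃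

/-- `F ↦ F^{(1,3)}` with values in `End₃`. -/
def ext₁₃ (V₂ : Type*) [AddCommGroup V₂] [Module k V₂] :
    Module.End k (V₁ ⊗[k] V₃) →ₐ[k] End₃ k V₁ V₂ V₃ := leg₁₃Hom V₂

/-- `F ↦ F^{(2,3)}` with values in `End₃`. -/
def ext₂₃ (V₁ : Type*) [AddCommGroup V₁] [Module k V₁] :
    Module.End k (V₂ ⊗[k] V₃) →ₐ[k] End₃ k V₁ V₂ V₃ := leg₂₃Hom V₁

theorem ext₁₂_map_one (a : Module.End k V₁) :
    ext₁₂ V₃ (TensorProduct.map a (1 : Module.End k V₂)) = ext₁₃ V₂ (TensorProduct.map a 1) :=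
  (leg₁₃_map a 1).symm

theorem ext₁₂_one_map (b : Module.End k V₂) :
    ext₁₂ V₃ (TensorProduct.map (1 : Module.End k V₁) b) = ext₂₃ V₁ (TensorProduct.map b 1) :=
  (leg₂₃_map b 1).symm

theorem ext₁₃_one_map (c : Module.End k V₃) :
    ext₁₃ V₂ (TensorProduct.map (1 : Module.End k V₁) c) = ext₂₃ V₁ (TensorProduct.map 1 c) :=
  (leg₁₃_map 1 c).trans (leg₂₃_map 1 c).symm

theorem commute_ext₁₂ (F : Module.End k (V₁ ⊗[k] V₂)) (c : Module.End k V₃) :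
    Commute (ext₁₂ V₃ F) (ext₁₃ V₂ (TensorProduct.map 1 c)) := by
  have h := commute_leg₁₂ F c
  rw [← TensorProduct.map_one, ← leg₁₃_map] at h
  exact h

theorem commute_ext₁₃ (b : Module.End k V₂) (F : Module.End k (V₁ ⊗[k] V₃)) :
    Commute (ext₁₂ V₃ (TensorProduct.map 1 b)) (ext₁₃ V₂ F) :=
  commute_leg₁₃ F b

theorem commute_ext₂₃ (a : Module.End k V₁) (F : Module.End k (V₂ ⊗[k] V₃)) :
    Commute (ext₁₂ V₃ (TensorProduct.map a 1)) (ext₂₃ V₁ F) :=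
  commute_leg₂₃ F a

theorem isTriple_ext : IsTriple ((ext₁₂ V₃).comp (rep₂ H₁ H₂)) ((ext₁₃ V₂).comp (rep₂ H₁ H₃))
    ((ext₂₃ V₁).comp (rep₂ H₂ H₃)) where
  fst a := by simp only [AlgHom.comp_apply, rep₂_tmul, map_one, ext₁₂_map_one]
  snd a := by simp only [AlgHom.comp_apply, rep₂_tmul, map_one, ext₁₂_one_map]
  thd a := by simp only [AlgHom.comp_apply, rep₂_tmul, map_one, ext₁₃_one_map]
  commute_thd t a := by
    simp only [AlgHom.comp_apply, rep₂_tmul, map_one]; exact commute_ext₁₂ _ _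
  commute_fst a t := by
    simp only [AlgHom.comp_apply, rep₂_tmul, map_one]; exact commute_ext₂₃ _ _

/-- `ρ₁ ⊗ ρ₂ ⊗ ρ₃` with values in `End₃`. -/
def repEnd₃ : SmallU χ ⊗[k] SmallU χ ⊗[k] SmallU χ →ₐ[k] End₃ k V₁ V₂ V₃ := rep₃ H₁ H₂ H₃

theorem repEnd₃_tmul (t : SmallU χ ⊗[k] SmallU χ) (c : SmallU χ) :
    repEnd₃ H₁ H₂ H₃ (t ⊗ₜ c) =
      (ext₁₂ V₃).comp (rep₂ H₁ H₂) t * (ext₁₃ V₂).comp (rep₂ H₁ H₃) (1 ⊗ₜ c) := by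
  have h : rep₃ H₁ H₂ H₃ (t ⊗ₜ c) =
      leg₁₂ V₃ (rep₂ H₁ H₂ t) * leg₁₃ V₂ (TensorProduct.map 1 (H₃.ρ c)) := by
    rw [leg₁₃_map, TensorProduct.map_one]
    refine TensorProduct.ext' fun x y => ?_
    simp [rep₃, Module.endTensorEndAlgHom_apply, leg₁₂]
  simp only [AlgHom.comp_apply, rep₂_tmul, map_one]
  exact h

theorem repEnd₃_assoc_tmul (a : SmallU χ) (t : SmallU χ ⊗[k] SmallU χ) :
    repEnd₃ H₁ H₂ H₃ ((TensorProduct.assoc k _ _ _).symm (a ⊗ₜ t)) =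
      (ext₁₂ V₃).comp (rep₂ H₁ H₂) (a ⊗ₜ 1) * (ext₂₃ V₁).comp (rep₂ H₂ H₃) t := by
  have hT := isTriple_ext H₁ H₂ H₃
  induction t with
  | zero => simp
  | add s t hs ht => simp only [TensorProduct.tmul_add, map_add, mul_add, hs, ht]
  | tmul b c =>
    rw [TensorProduct.assoc_symm_tmul, repEnd₃_tmul, map_tmul_eq _ a b, map_tmul_eq _ b c,
      hT.snd, hT.thd, mul_assoc]

theorem repEnd₃_comulLeft (B : HomogBases χ) (β : Fin θ → ℕ) :
    repEnd₃ H₁ H₂ H₃ (comulLeft χ (canonical B β)) = LinearMap.mul' k _ (TensorProduct.map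
      (((ext₁₂ V₃).comp (rep₂ H₁ H₂)).comp ((comulU χ).comp (plusHom χ))).toLinearMap
      (minusR ((ext₁₃ V₂).comp (rep₂ H₁ H₃))).toLinearMap (canonDeg B β)) := by
  rw [canonical_eq]
  generalize canonDeg B β = t
  induction t with
  | zero => simp
  | add a b ha hb => simp only [map_add, ha, hb]
  | tmul a b => exact repEnd₃_tmul H₁ H₂ H₃ _ _

theorem repEnd₃_comulRight (B : HomogBases χ) (β : Fin θ → ℕ) :
    repEnd₃ H₁ H₂ H₃ (comulRight χ (canonical B β)) = LinearMap.mul' k _ (TensorProduct.map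
      (plusL ((ext₁₂ V₃).comp (rep₂ H₁ H₂))).toLinearMap
      (((ext₂₃ V₁).comp (rep₂ H₂ H₃)).comp ((comulU χ).comp (minusHom χ))).toLinearMap
      (canonDeg B β)) := by
  rw [canonical_eq]
  generalize canonDeg B β = t
  induction t with
  | zero => simp
  | add a b ha hb => simp only [map_add, ha, hb]
  | tmul a b => exact repEnd₃_assoc_tmul H₁ H₂ H₃ _ _

variable {H₁ H₂ H₃}

theorem isAdmissible_plusL_ext₁₂ {N : ℕ} (h : IsAdmissible χ N (actPlus H₁).toLinearMap) :
    IsAdmissible χ N (plusL ((ext₁₂ V₃).comp (rep₂ H₁ H₂))).toLinearMap :=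
  (isAdmissible_plusL_rep₂ H₂ h).comp (ext₁₂ V₃).toLinearMap

theorem isAdmissible_plusR_ext₁₂ {N : ℕ} (h : IsAdmissible χ N (actPlus H₂).toLinearMap) :
    IsAdmissible χ N (plusR ((ext₁₂ V₃).comp (rep₂ H₁ H₂))).toLinearMap :=
  h.of_ker fun x hx => by
    rw [AlgHom.toLinearMap_apply] at hx ⊢
    rw [plusR_apply, AlgHom.comp_apply, rep₂_tmul]
    change ext₁₂ V₃ (TensorProduct.map _ (actPlus H₂ x)) = 0
    rw [hx, TensorProduct.map_zero_right, map_zero]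

theorem isAdmissible_comul_ext₁₂ {N : ℕ} (h : IsAdmissible χ N (actPlusTensor H₁ H₂).toLinearMap) :
    IsAdmissible χ N
      (((ext₁₂ V₃).comp (rep₂ H₁ H₂)).comp ((comulU χ).comp (plusHom χ))).toLinearMap :=
  h.comp (ext₁₂ V₃).toLinearMap

theorem finite_comulLeft [FiniteDimensional k V₁] [FiniteDimensional k V₂] (B : HomogBases χ) :
    {β | rep₃ H₁ H₂ H₃ (comulLeft χ (canonical B β)) ≠ 0}.Finite := by
  obtain ⟨N, hN⟩ := exists_isAdmissible_actPlusTensor H₁ H₂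
  have h := (isAdmissible_comul_ext₁₂ (V₃ := V₃) hN).finite
    (minusR ((ext₁₃ V₂).comp (rep₂ H₁ H₃))).toLinearMap B
  simp only [← repEnd₃_comulLeft] at h
  exact h

theorem finite_comulRight [FiniteDimensional k V₁] (B : HomogBases χ) :
    {β | rep₃ H₁ H₂ H₃ (comulRight χ (canonical B β)) ≠ 0}.Finite := by
  obtain ⟨N, hN⟩ := exists_isAdmissible_actPlus H₁
  have h := (isAdmissible_plusL_ext₁₂ (H₂ := H₂) (V₃ := V₃) hN).finite
    (((ext₂₃ V₁).comp (rep₂ H₂ H₃)).comp ((comulU χ).comp (minusHom χ))).toLinearMap B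
  simp only [← repEnd₃_comulRight] at h
  exact h

variable (H₁ H₂) in
theorem exists_common_bound [FiniteDimensional k V₁] [FiniteDimensional k V₂] : ∃ N,
    IsAdmissible χ N (actPlus H₁).toLinearMap ∧ IsAdmissible χ N (actPlus H₂).toLinearMap ∧
      IsAdmissible χ N (actPlusTensor H₁ H₂).toLinearMap := by
  obtain ⟨N₁, h₁⟩ := exists_isAdmissible_actPlus H₁
  obtain ⟨N₂, h₂⟩ := exists_isAdmissible_actPlus H₂
  obtain ⟨N₃, h₃⟩ := exists_isAdmissible_actPlusTensor H₁ H₂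
  exact ⟨N₁ + N₂ + N₃, h₁.mono (by lia), h₂.mono (by lia), h₃.mono (by lia)⟩

/-! ### Diagonal operators on three factors and the resulting identities -/

section diagonal

variable {f₁₂ : Module.End k (V₁ ⊗[k] V₂)} {f₁₃ : Module.End k (V₁ ⊗[k] V₃)}
  {f₂₃ : Module.End k (V₂ ⊗[k] V₃)}

theorem ext₁₃_commute (b : SmallU χ) :
    Commute ((ext₁₂ V₃).comp (rep₂ H₁ H₂) (1 ⊗ₜ b)) (ext₁₃ V₂ f₁₃) := by
  rw [AlgHom.comp_apply, rep₂_tmul, map_one]; exact commute_ext₁₃ _ _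

theorem ext₂₃_commute (a : SmallU χ) :
    Commute ((ext₁₂ V₃).comp (rep₂ H₁ H₂) (a ⊗ₜ 1)) (ext₂₃ V₁ f₂₃) := by
  rw [AlgHom.comp_apply, rep₂_tmul, map_one]; exact commute_ext₂₃ _ _

variable (H₁ H₂ H₃) in
-- Both operators are scalar on each product of weight parts, and such products span; directness of
-- the sums is not needed.
theorem commute_of_eigen₃ {F G : Module.End k (V₁ ⊗[k] V₂ ⊗[k] V₃)}
    (h : ∀ α β γ, ∃ c d : k, ∀ u ∈ weightPart H₁ α, ∀ v ∈ weightPart H₂ β, ∀ w ∈ weightPart H₃ γ,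
      F (u ⊗ₜ v ⊗ₜ w) = c • (u ⊗ₜ v ⊗ₜ w) ∧ G (u ⊗ₜ v ⊗ₜ w) = d • (u ⊗ₜ v ⊗ₜ w)) :
    Commute F G := by
  refine TensorProduct.ext ?_
  refine tensor_ext_weightPart (M := V₃ →ₗ[k] V₁ ⊗[k] V₂ ⊗[k] V₃) H₁ H₂ fun α β u hu v hv => ?_
  refine LinearMap.ext_on (span_weightPart H₃) ?_
  rintro w ⟨γ, hw⟩
  obtain ⟨c, d, hcd⟩ := h α β γ
  obtain ⟨hF, hG⟩ := hcd u hu v hv w hw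
  change F (G (u ⊗ₜ v ⊗ₜ w)) = G (F (u ⊗ₜ v ⊗ₜ w))
  rw [hF, hG, map_smul, map_smul, hF, hG, smul_comm]

theorem IsDiagonalOperator.leg₁₂_apply (hf : IsDiagonalOperator H₁ H₂ f₁₂) {α β : Fin θ → ℕ}
    {u : V₁} (hu : u ∈ weightPart H₁ α) {v : V₂} (hv : v ∈ weightPart H₂ β) (w : V₃) :
    leg₁₂ V₃ f₁₂ (u ⊗ₜ v ⊗ₜ w) = diagScalar H₁ H₂ α β • (u ⊗ₜ v ⊗ₜ w) := by
  simp [leg₁₂, hf.apply hu hv, TensorProduct.smul_tmul']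

theorem IsDiagonalOperator.leg₁₃_apply (hf : IsDiagonalOperator H₁ H₃ f₁₃) {α β : Fin θ → ℕ}
    {u : V₁} (hu : u ∈ weightPart H₁ α) (v : V₂) {w : V₃} (hw : w ∈ weightPart H₃ β) :
    leg₁₃ V₂ f₁₃ (u ⊗ₜ v ⊗ₜ w) = diagScalar H₁ H₃ α β • (u ⊗ₜ v ⊗ₜ w) := by
  simp only [leg₁₃, LinearMap.comp_apply, LinearEquiv.coe_coe, TensorProduct.rightComm_tmul,
    TensorProduct.map_tmul, hf.apply hu hw, LinearMap.id_apply, ← TensorProduct.smul_tmul',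
    map_smul]
  rfl

theorem IsDiagonalOperator.leg₂₃_apply (hf : IsDiagonalOperator H₂ H₃ f₂₃) {α β : Fin θ → ℕ}
    (u : V₁) {v : V₂} (hv : v ∈ weightPart H₂ α) {w : V₃} (hw : w ∈ weightPart H₃ β) :
    leg₂₃ V₁ f₂₃ (u ⊗ₜ v ⊗ₜ w) = diagScalar H₂ H₃ α β • (u ⊗ₜ v ⊗ₜ w) := by
  simp only [leg₂₃, LinearMap.comp_apply, LinearEquiv.coe_coe, TensorProduct.assoc_tmul,
    TensorProduct.map_tmul, hf.apply hv hw, LinearMap.id_apply, TensorProduct.tmul_smul,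
    map_smul, TensorProduct.assoc_symm_tmul]

theorem IsDiagonalOperator.commute_ext₁₂_ext₁₃ (h₁₂ : IsDiagonalOperator H₁ H₂ f₁₂)
    (h₁₃ : IsDiagonalOperator H₁ H₃ f₁₃) : Commute (ext₁₂ V₃ f₁₂) (ext₁₃ V₂ f₁₃) :=
  commute_of_eigen₃ H₁ H₂ H₃ fun _ _ _ => ⟨_, _, fun _ hu v hv w hw =>
    ⟨h₁₂.leg₁₂_apply hu hv w, h₁₃.leg₁₃_apply hu v hw⟩⟩

theorem IsDiagonalOperator.commute_ext₁₂_ext₂₃ (h₁₂ : IsDiagonalOperator H₁ H₂ f₁₂)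
    (h₂₃ : IsDiagonalOperator H₂ H₃ f₂₃) : Commute (ext₁₂ V₃ f₁₂) (ext₂₃ V₁ f₂₃) :=
  commute_of_eigen₃ H₁ H₂ H₃ fun _ _ _ => ⟨_, _, fun u hu _ hv w hw =>
    ⟨h₁₂.leg₁₂_apply hu hv w, h₂₃.leg₂₃_apply u hv hw⟩⟩

theorem IsDiagonalOperator.commute_ext₁₃_ext₂₃ (h₁₃ : IsDiagonalOperator H₁ H₃ f₁₃)
    (h₂₃ : IsDiagonalOperator H₂ H₃ f₂₃) : Commute (ext₁₃ V₂ f₁₃) (ext₂₃ V₁ f₂₃) :=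
  commute_of_eigen₃ H₁ H₂ H₃ fun _ _ _ => ⟨_, _, fun u hu v hv _ hw =>
    ⟨h₁₃.leg₁₃_apply hu v hw, h₂₃.leg₂₃_apply u hv hw⟩⟩

variable [FiniteDimensional k V₁] [FiniteDimensional k V₂]

theorem finsum_comulLeft (B : HomogBases χ) [FiniteDimensional k V₃]
    (hf : IsDiagonalOperator H₁ H₃ f₁₃) :
    ∑ᶠ β, repEnd₃ H₁ H₂ H₃ (comulLeft χ (canonical B β)) =
      ext₁₃ V₂ (opC B H₁ H₃) * Ring.inverse (ext₁₃ V₂ f₁₃) * ext₂₃ V₁ (opC B H₂ H₃) *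
        ext₁₃ V₂ f₁₃ := by
  obtain ⟨N, h₁, h₂, h₁₂⟩ := exists_common_bound H₁ H₂
  simp only [repEnd₃_comulLeft]
  rw [finsum_canonDeg B (isAdmissible_comul_ext₁₂ h₁₂), map_opC _ B h₁, map_opC _ B h₂]
  exact (isTriple_ext H₁ H₂ H₃).pairOp_comulLeft B (isAdmissible_plusL_ext₁₂ h₁)
    (isAdmissible_plusR_ext₁₂ h₂) (isAdmissible_comul_ext₁₂ h₁₂) (hf.isDiagonalFor _)
    ext₁₃_commute (Ring.inverse_mul_cancel _ (hf.isUnit.map (ext₁₃ V₂)))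

theorem finsum_comulRight (B : HomogBases χ) [FiniteDimensional k V₃]
    (hf : IsDiagonalOperator H₁ H₃ f₁₃) :
    ∑ᶠ β, repEnd₃ H₁ H₂ H₃ (comulRight χ (canonical B β)) =
      ext₁₃ V₂ (opC B H₁ H₃) * Ring.inverse (ext₁₃ V₂ f₁₃) * ext₁₂ V₃ (opC B H₁ H₂) *
        ext₁₃ V₂ f₁₃ := by
  obtain ⟨N, h₁, h₂, h₁₂⟩ := exists_common_bound H₁ H₂
  simp only [repEnd₃_comulRight]
  rw [finsum_canonDeg B (isAdmissible_plusL_ext₁₂ h₁), map_opC _ B h₁, map_opC _ B h₁]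
  exact (isTriple_ext H₁ H₂ H₃).pairOp_comulRight B (isAdmissible_plusL_ext₁₂ h₁)
    (hf.isDiagonalFor _) ext₁₃_commute (Ring.inverse_mul_cancel _ (hf.isUnit.map (ext₁₃ V₂)))

theorem opR_yangBaxter (B : HomogBases χ) [FiniteDimensional k V₃]
    (h₁₂ : IsDiagonalOperator H₁ H₂ f₁₂) (h₁₃ : IsDiagonalOperator H₁ H₃ f₁₃)
    (h₂₃ : IsDiagonalOperator H₂ H₃ f₂₃) :
    ext₁₂ V₃ (opR B H₁ H₂ f₁₂) * ext₁₃ V₂ (opR B H₁ H₃ f₁₃) * ext₂₃ V₁ (opR B H₂ H₃ f₂₃) =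
      ext₂₃ V₁ (opR B H₂ H₃ f₂₃) * ext₁₃ V₂ (opR B H₁ H₃ f₁₃) * ext₁₂ V₃ (opR B H₁ H₂ f₁₂) := by
  obtain ⟨N, hN₁, hN₂, hN₁₂⟩ := exists_common_bound H₁ H₂
  have hR : ext₁₂ V₃ (opR B H₁ H₂ f₁₂) =
      canonOp B N ((ext₁₂ V₃).comp (rep₂ H₁ H₂)) * ext₁₂ V₃ (Ring.inverse f₁₂) := by
    rw [opR, map_mul, map_opC _ B hN₁]
  -- Commuting with a unit implies commuting with its inverse. Here `Ring.inverse` is the true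
  -- inverse, because a diagonal operator is a unit.
  have hcomm : ∀ G : End₃ k V₁ V₂ V₃, Commute (ext₁₂ V₃ f₁₂) G →
      Commute (ext₁₂ V₃ (Ring.inverse f₁₂)) G := fun G hG => by
    refine Commute.units_inv_left (u := ⟨ext₁₂ V₃ f₁₂, ext₁₂ V₃ (Ring.inverse f₁₂), ?_, ?_⟩) hG
    · rw [← map_mul, Ring.mul_inverse_cancel _ h₁₂.isUnit, map_one]
    · rw [← map_mul, Ring.inverse_mul_cancel _ h₁₂.isUnit, map_one]
  have h := (isTriple_ext H₁ H₂ H₃).yangBaxter B (isAdmissible_plusL_ext₁₂ hN₁)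
    (isAdmissible_plusR_ext₁₂ hN₂) (isAdmissible_comul_ext₁₂ hN₁₂)
    (a' := ext₁₂ V₃ (Ring.inverse f₁₂)) (b' := ext₁₃ V₂ (Ring.inverse f₁₃))
    (c' := ext₂₃ V₁ (Ring.inverse f₂₃))
    (h₁₃.isDiagonalFor (ext₁₃ V₂)) ext₁₃_commute (h₂₃.isDiagonalFor (ext₂₃ V₁)) ext₂₃_commute
    (by rw [← map_mul, Ring.mul_inverse_cancel _ h₁₃.isUnit, map_one])
    (by rw [← map_mul, Ring.inverse_mul_cancel _ h₁₃.isUnit, map_one])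
    (by rw [← map_mul, Ring.mul_inverse_cancel _ h₂₃.isUnit, map_one])
    (by rw [← map_mul, Ring.inverse_mul_cancel _ h₂₃.isUnit, map_one])
    (hcomm _ (h₁₂.commute_ext₁₂_ext₁₃ h₁₃)) (hcomm _ (h₁₂.commute_ext₁₂_ext₂₃ h₂₃))
    (h₁₃.commute_ext₁₃_ext₂₃ h₂₃)
    (by rw [← hR]; exact (isUnit_opR B h₁₂).map (ext₁₂ V₃))
    (fun X => by
      rw [← hR, AlgHom.comp_apply, AlgHom.comp_apply, ← map_mul, ← map_mul, opR_intertwine B h₁₂])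
    (fun x => by
      rw [← hR, AlgHom.comp_apply, rep₂_tmul, map_one]; exact commute_ext₁₂ _ _)
  rw [hR, opR, opR, map_mul (ext₁₃ V₂), map_mul (ext₂₃ V₁), map_opC _ B hN₁, map_opC _ B hN₂]
  exact h

end diagonal

end threefold

end

end NicholsDouble

end

/-! ### Assembly of the main theorem -/

open scoped TensorProduct in
open NicholsDouble in
theorem mainTheorem2 {k : Type*} [Field k] [IsAlgClosed k] [CharZero k] {θ : ℕ}
    (χ : Bicharacter k θ) (B : HomogBases χ)
    (V : Fin 3 → Type*) [∀ x, AddCommGroup (V x)] [∀ x, Module k (V x)]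
    [∀ x, FiniteDimensional k (V x)] (H : ∀ x, HighestWeightModule χ (V x)) :
    -- the Gram matrices of `η`, whose inverses define the canonical elements, are invertible
    (∀ β, IsUnit (gram B β)) ∧
    -- `f_xy` is well defined when the sums `V = ∑_α 𝔲⁻_{-α} v` are direct, and it is invertible
    (∀ x y, iSupIndep (weightPart (H x)) → iSupIndep (weightPart (H y)) →
      ∃ f, IsDiagonalOperator (H x) (H y) f) ∧
    (∀ x y f, IsDiagonalOperator (H x) (H y) f → IsUnit f) ∧
    -- `C_xy` is invertible, with the stated inverse (all sums over `β` have finite support)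
    (∀ x y,
      {β | rep₂ (H x) (H y) (canonical B β) ≠ 0}.Finite ∧
      {β | rep₂ (H x) (H y) (canonical' B β) ≠ 0}.Finite ∧
      opC B (H x) (H y) * opC' B (H x) (H y) = 1 ∧
      opC' B (H x) (H y) * opC B (H x) (H y) = 1) ∧
    -- `R_xy` intertwines `Δ` and `τ ∘ Δ`
    (∀ x y f, IsDiagonalOperator (H x) (H y) f →
      IsUnit (opR B (H x) (H y) f) ∧
      ∀ X : SmallU χ,
        opR B (H x) (H y) f * rep₂ (H x) (H y) (comulU χ X) *
            Ring.inverse (opR B (H x) (H y) f) =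
          rep₂ (H x) (H y) (TensorProduct.comm k (SmallU χ) (SmallU χ) (comulU χ X))) ∧
    -- the images of `(Δ ⊗ id)(𝓒_β)` and of `(id ⊗ Δ)(𝓒_β)`
    {β | rep₃ (H 0) (H 1) (H 2) (comulLeft χ (canonical B β)) ≠ 0}.Finite ∧
    {β | rep₃ (H 0) (H 1) (H 2) (comulRight χ (canonical B β)) ≠ 0}.Finite ∧
    (∀ f₁₃, IsDiagonalOperator (H 0) (H 2) f₁₃ →
      ∑ᶠ β, rep₃ (H 0) (H 1) (H 2) (comulLeft χ (canonical B β)) =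
          leg₁₃ (V 1) (opC B (H 0) (H 2)) * Ring.inverse (leg₁₃ (V 1) f₁₃) *
            leg₂₃ (V 0) (opC B (H 1) (H 2)) * leg₁₃ (V 1) f₁₃ ∧
      ∑ᶠ β, rep₃ (H 0) (H 1) (H 2) (comulRight χ (canonical B β)) =
          leg₁₃ (V 1) (opC B (H 0) (H 2)) * Ring.inverse (leg₁₃ (V 1) f₁₃) *
            leg₁₂ (V 2) (opC B (H 0) (H 1)) * leg₁₃ (V 1) f₁₃) ∧
    -- the Yang–Baxter equation
    (∀ f₁₂ f₁₃ f₂₃, IsDiagonalOperator (H 0) (H 1) f₁₂ → IsDiagonalOperator (H 0) (H 2) f₁₃ →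
      IsDiagonalOperator (H 1) (H 2) f₂₃ →
      leg₁₂ (V 2) (opR B (H 0) (H 1) f₁₂) * leg₁₃ (V 1) (opR B (H 0) (H 2) f₁₃) *
          leg₂₃ (V 0) (opR B (H 1) (H 2) f₂₃) =
        leg₂₃ (V 0) (opR B (H 1) (H 2) f₂₃) * leg₁₃ (V 1) (opR B (H 0) (H 2) f₁₃) *
          leg₁₂ (V 2) (opR B (H 0) (H 1) f₁₂)) := by
  refine ⟨isUnit_gram B, fun x y => exists_isDiagonalOperator (H x) (H y), fun x y f hf => hf.isUnit,
    fun x y => ⟨finite_canonical _ _ B, finite_canonical' _ _ B, opC_mul_opC' _ _ B,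
      opC'_mul_opC _ _ B⟩, fun x y f hf => ⟨isUnit_opR B hf, fun X => ?_⟩,
    finite_comulLeft B, finite_comulRight B,
    fun f₁₃ hf => ⟨finsum_comulLeft B hf, finsum_comulRight B hf⟩,
    fun f₁₂ f₁₃ f₂₃ h₁₂ h₁₃ h₂₃ => opR_yangBaxter B h₁₂ h₁₃ h₂₃⟩
  rw [opR_intertwine B hf, mul_assoc, Ring.mul_inverse_cancel _ (isUnit_opR B hf), mul_one,
    comulOpU_apply]
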